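/- Let $R$ be a (finite, reduced, crystallographic) irreducible root system in a real vector space, $P$ its weight lattice, $W_0$ its Weyl group, and $W = W_0 \ltimes P$ the extended affine Weyl group. Fix a base of $R$. Let $S$ be the set of simple reflections of $W_a = W_0 \ltimes \mathbb{Z}R$, $S_0 = S \cap W_0$, $s_0$ the unique element of $S \setminus S_0$, and $l$ and $\le$ the length function and the Bruhat order on $W$. For $w \in W$ put $R(w) = \{s \in S \mid ws \le w\}$, and let $Y_0 = \{w \in W \mid R(w) \subseteq \{s_0\}\}$ and $\Gamma_0 = \{w \in W \mid R(w) = S_0\}$. Let $w_0$ be the longest element of $W_0$. Let $k$ be a field, $q \in k$ nonzero, and $q^{1/2} \in k$ a square root of $q$. Let $H$ be the Hecke algebra of $(W,S)$ over $k$ with parameter $q$, with standard basis $T_w$ ($w \in W$), so that $T_1 = 1$, $T_xT_y = T_{xy}$ if $l(xy) = l(x) + l(y)$, and $(T_s - q)(T_s+1) = 0$ for $s \in S$. With the Kazhdan–Lusztig polynomials $P_{y,w}$ put $$C_w = q^{-\frac{l(w)}{2}} \sum_{y \le w} P_{y,w}(q)\, T_y, \qquad C'_w = q^{\frac{l(w)}{2}}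 \sum_{y \le w} (-1)^{l(w)-l(y)} q^{-l(y)} P_{y,w}(q^{-1})\, T_y,$$ and $C = C_{w_0}$, $C' = C'_{w_0}$. Let $\mathcal{I}$, $\mathcal{I}'$ be the $k$-subspaces of $H$ spanned by all $C_w$, respectively all $C'_w$, with $w \in W \setminus Y_0$, and let $M$, $M'$ be the $k$-subspaces spanned by all $C_w$, respectively all $C'_w$, with $w \in \Gamma_0$. **Lemma 2.2.** The subspaces $\mathcal{I}, \mathcal{I}', M, M'$ are left ideals of $H$, and $M = HC$, $M' = HC'$. The map $h \mapsto hC'$ induces an isomorphism of left $H$-modules from $N = H/\mathcal{I}$ onto $M'$, and the map $h \mapsto hC$ induces an isomorphism of left $H$-modules from $N' = H/\mathcal{I}'$ onto $M$. -/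

import Mathlib

open scoped Polynomial

noncomputable section

namespace AffineHecke

universe u₁ u₂ u₃ u₄

section Group

variable {ι : Type u₁} {V : Type u₂} {V' : Type u₃} [AddCommGroup V] [Module ℝ V]
  [AddCommGroup V'] [Module ℝ V'] (R : RootPairing ι ℝ V V')

/-- The weight lattice: the vectors having integral pairing with every coroot. -/
def weightLattice : AddSubgroup V where
  carrier := {x | ∀ i, ∃ n : ℤ, R.coroot' i x = n}
  zero_mem' := fun i => ⟨0, by simp⟩
  add_mem' := by
    intro x y hx hy i
    obtain ⟨m, hm⟩ := hx i
    obtain ⟨n, hn⟩ := hy i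
    exact ⟨m + n, by rw [map_add, hm, hn]; push_cast; rfl⟩
  neg_mem' := by
    intro x hx i
    obtain ⟨m, hm⟩ := hx i
    exact ⟨-m, by rw [map_neg, hm]; push_cast; rfl⟩

theorem root_mem_weightLattice [R.IsCrystallographic] (i : ι) :
    R.root i ∈ weightLattice R := by
  intro j
  exact ⟨R.pairingIn ℤ i j, by
    simpa using (R.algebraMap_pairingIn ℤ i j).symm⟩

theorem smul_mem_weightLattice (w : R.weylGroup) {x : V} (hx : x ∈ weightLattice R) :
    w • x ∈ weightLattice R := by
  obtain ⟨g, hg⟩ := w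
  change g • x ∈ weightLattice R
  revert x
  induction hg using RootPairing.weylGroup.induction with
  | mem j =>
    intro x hx i
    obtain ⟨m, hm⟩ := hx (R.reflectionPerm j i)
    refine ⟨m, ?_⟩
    rw [← hm]
    change R.coroot' i (R.reflection j x) = R.coroot' (R.reflectionPerm j i) x
    simp [RootPairing.reflection_apply, RootPairing.coroot_reflectionPerm,
      RootPairing.coreflection_apply, RootPairing.coroot', RootPairing.root', mul_comm]
  | one => intro x hx; simpa using hx
  | mul g₁ g₂ _ _ h₁ h₂ => intro x hx; rw [mul_smul]; exact h₁ (h₂ hx)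

/-- The action of the finite Weyl group on the weight lattice, the latter written
multiplicatively. -/
def weylAct : R.weylGroup →* MulAut (Multiplicative (weightLattice R)) where
  toFun w :=
    { toFun := fun x => .ofAdd ⟨w • (x.toAdd : V), smul_mem_weightLattice R w x.toAdd.2⟩
      invFun := fun x => .ofAdd ⟨w⁻¹ • (x.toAdd : V), smul_mem_weightLattice R w⁻¹ x.toAdd.2⟩
      left_inv := fun x => by
        apply Multiplicative.toAdd.injective; apply Subtype.ext; simp
      right_inv := fun x => by
        apply Multiplicative.toAdd.injective; apply Subtype.ext; simp
      map_mul' := fun x y => by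
        apply Multiplicative.toAdd.injective; apply Subtype.ext; simp }
  map_one' := by
    refine MulEquiv.ext fun x => Multiplicative.toAdd.injective (Subtype.ext ?_)
    exact one_smul R.weylGroup (x.toAdd : V)
  map_mul' w w' := by
    refine MulEquiv.ext fun x => Multiplicative.toAdd.injective (Subtype.ext ?_)
    exact mul_smul w w' (x.toAdd : V)

/-- The extended affine Weyl group: the semidirect product of the weight lattice by the finite
Weyl group. -/
abbrev ExtAffineWeyl : Type (max u₁ u₂ u₃) :=
  SemidirectProduct (Multiplicative (weightLattice R)) R.weylGroup (weylAct R)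

/-- The finite Weyl group as a subgroup of the extended affine Weyl group. -/
def finiteWeyl : Subgroup (ExtAffineWeyl R) := SemidirectProduct.inr.range

variable {R}

/-- The action of the extended affine Weyl group on `V` by affine transformations: the finite
Weyl group acts linearly, the weight lattice by translations. -/
def affAct (g : ExtAffineWeyl R) (x : V) : V := g.right • x + (g.left.toAdd : V)

/-- The affine reflection `x ↦ x - (⟨x, αᵢ^∨⟩ - n) αᵢ`, in the hyperplane `⟨x, αᵢ^∨⟩ = n`.
These are the reflections of the affine Weyl group (finite Weyl group) ⋉ (root lattice). -/
def affRefl [R.IsCrystallographic] (i : ι) (n : ℤ) : ExtAffineWeyl R :=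
  ⟨.ofAdd (n • ⟨R.root i, root_mem_weightLattice R i⟩), RootPairing.weylGroup.ofIdx R i⟩

variable (b : R.Base)

/-- The fundamental alcove. -/
def alcove : Set V := {x | ∀ i, b.IsPos i → 0 < R.coroot' i x ∧ R.coroot' i x < 1}

/-- The hyperplane `⟨x, αᵢ^∨⟩ = n` separates `A` from `B`. -/
def Separates (i : ι) (n : ℤ) (A B : Set V) : Prop :=
  ((∀ x ∈ A, R.coroot' i x < n) ∧ ∀ y ∈ B, n < R.coroot' i y) ∨
  ((∀ x ∈ A, n < R.coroot' i x) ∧ ∀ y ∈ B, R.coroot' i y < n)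

/-- The length of `g`: the number of hyperplanes `⟨x, α^∨⟩ = n` (`α` a positive root, `n` an
integer) separating the fundamental alcove from its image under `g`. -/
def length (g : ExtAffineWeyl R) : ℕ :=
  {h : ι × ℤ | b.IsPos h.1 ∧
    Separates (R := R) h.1 h.2 (alcove b) (affAct g '' alcove b)}.ncard

/-- The coroot of index `i` is the highest coroot. -/
def IsHighestCoroot (i : ι) : Prop :=
  ∀ j, R.coroot i - R.coroot j ∈ AddSubmonoid.closure (R.coroot '' b.support)

variable [R.IsCrystallographic]

/-- The set `{s₀}`, where `s₀` is the reflection in the wall of the fundamental alcove that does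
not pass through the origin. -/
def affineSimple : Set (ExtAffineWeyl R) := {s | ∃ i, IsHighestCoroot b i ∧ s = affRefl i 1}

/-- The simple reflections of the affine Weyl group. -/
def simples : Set (ExtAffineWeyl R) := {s | ∃ i ∈ b.support, s = affRefl i 0} ∪ affineSimple b

/-- The simple reflections of the finite Weyl group. -/
def finiteSimples : Set (ExtAffineWeyl R) := simples b ∩ finiteWeyl R

/-- The Bruhat order: `y ≤ w` if `w` is obtained from `y` by successive multiplications by
reflections, each of which increases the length. -/
def BruhatLE (y w : ExtAffineWeyl R) : Prop :=
  Relation.ReflTransGen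
    (fun x z => length b x < length b z ∧ ∃ (i : ι) (n : ℤ), z = x * affRefl i n) y w

/-- The right descent set `R(w)`. -/
def rightDescents (w : ExtAffineWeyl R) : Set (ExtAffineWeyl R) :=
  {s ∈ simples b | BruhatLE b (w * s) w}

/-- The set `Y₀` of all `w` with `R(w) ⊆ {s₀}`. -/
def Y₀ : Set (ExtAffineWeyl R) := {w | rightDescents b w ⊆ affineSimple b}

/-- The set `Γ₀` of all `w` such that `R(w)` is the set of finite simple reflections. -/
def Γ₀ : Set (ExtAffineWeyl R) := {w | rightDescents b w = finiteSimples b}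

end Group

section Hecke

variable {ι : Type u₁} {V : Type u₂} {V' : Type u₃} [AddCommGroup V] [Module ℝ V]
  [AddCommGroup V'] [Module ℝ V'] {R : RootPairing ι ℝ V V'} [R.IsCrystallographic]
  (b : R.Base) {A : Type u₄} [CommRing A]

/-- The defining relations of the Hecke algebra with parameter `q`. -/
inductive HeckeRel (q : A) :
    FreeAlgebra A (ExtAffineWeyl R) → FreeAlgebra A (ExtAffineWeyl R) → Prop
  | one : HeckeRel q (FreeAlgebra.ι A 1) 1
  | mul (x y : ExtAffineWeyl R) (h : length b (x * y) = length b x + length b y) :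
      HeckeRel q (FreeAlgebra.ι A x * FreeAlgebra.ι A y) (FreeAlgebra.ι A (x * y))
  | quad (s : ExtAffineWeyl R) (hs : s ∈ simples b) :
      HeckeRel q ((FreeAlgebra.ι A s - algebraMap A _ q) * (FreeAlgebra.ι A s + 1)) 0

/-- The Hecke algebra of the extended affine Weyl group over `A` with parameter `q`, presented by
generators `T_w` and the relations `T_1 = 1`, `T_x T_y = T_{xy}` if lengths add, and
`(T_s - q)(T_s + 1) = 0` for simple reflections `s`. -/
abbrev Hecke (q : A) : Type (max u₁ u₂ u₃ u₄) := RingQuot (HeckeRel b q)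

/-- The standard basis element `T_w`. -/
def T (q : A) (w : ExtAffineWeyl R) : Hecke b q :=
  RingQuot.mkAlgHom A (HeckeRel b q) (FreeAlgebra.ι A w)

/-- The square of the generator `v = q^{1/2}` of `ℤ[v, v⁻¹]`: the generic parameter. -/
abbrev genericParam : LaurentPolynomial ℤ := LaurentPolynomial.T 2

/-- The family `p` is `(P_{y,w})_y`, the Kazhdan–Lusztig polynomials for `w`: it vanishes off
`{y | y ≤ w}`, `P_{w,w} = 1`, `deg P_{y,w} ≤ (l(w) - l(y) - 1)/2` for `y < w`, and in the generic
Hecke algebra `v^{-l(w)} ∑_y P_{y,w}(v²) T_y` equals its image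
`v^{l(w)} ∑_y P_{y,w}(v⁻²) (T_{y⁻¹})⁻¹` under the bar involution. -/
structure IsKL (w : ExtAffineWeyl R) (p : ExtAffineWeyl R →₀ ℤ[X]) : Prop where
  le_of_ne_zero : ∀ y, p y ≠ 0 → BruhatLE b y w
  self : p w = 1
  degree : ∀ y, BruhatLE b y w → y ≠ w → 2 * (p y).natDegree + 1 + length b y ≤ length b w
  bar :
    (LaurentPolynomial.T (-(length b w : ℤ)) : LaurentPolynomial ℤ) •
        p.sum (fun y f => Polynomial.aeval (LaurentPolynomial.T 2 : LaurentPolynomial ℤ) f •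
          T b genericParam y) =
      (LaurentPolynomial.T (length b w : ℤ) : LaurentPolynomial ℤ) •
        p.sum (fun y f => Polynomial.aeval (LaurentPolynomial.T (-2) : LaurentPolynomial ℤ) f •
          Ring.inverse (T b genericParam y⁻¹))

open Classical in
/-- The family `(P_{y,w})_y` of Kazhdan–Lusztig polynomials for `w`; there is exactly one family
as in `IsKL`. -/
def klPoly (w : ExtAffineWeyl R) : ExtAffineWeyl R →₀ ℤ[X] :=
  if h : ∃ p, IsKL b w p then h.choose else 0

variable {k : Type u₄} [Field k]

/-- `C_w = q^{-l(w)/2} ∑_{y ≤ w} P_{y,w}(q) T_y`, where `v` is the chosen square root of `q`. -/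
def C (q v : k) (w : ExtAffineWeyl R) : Hecke b q :=
  v⁻¹ ^ length b w • (klPoly b w).sum fun y f => Polynomial.aeval q f • T b q y

/-- `C'_w = q^{l(w)/2} ∑_{y ≤ w} (-1)^{l(w)-l(y)} q^{-l(y)} P_{y,w}(q⁻¹) T_y`, where `v` is the
chosen square root of `q`. -/
def C' (q v : k) (w : ExtAffineWeyl R) : Hecke b q :=
  v ^ length b w • (klPoly b w).sum fun y f =>
    ((-1) ^ (length b w - length b y) * q⁻¹ ^ length b y * Polynomial.aeval q⁻¹ f) • T b q y

end Hecke

end AffineHecke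

end

/-! If `w s < w` then `P_{ys,w} = P_{y,w}`, so `C_w T_s = q C_w` and `C'_w T_s = -C'_w`. Both
families are treated at once: in an `IsSymmetricFamily` of ratio `r` the coefficient of `D_w` at `y
s > y` is `r` times the one at `y`, which gives the eigenvalue `q r`. Here `r = 1` for `C` and `r =
-q⁻¹` for `C'`. The conditions `(q r + 1)(r - 1) = 0` and `q r r' = -1` say that `q r` and `q r'`
are the two roots of the quadratic relation; they need not be distinct.

The elements with `x T_s = q r x` for all `s ∈ J` form a left ideal. Looking at the longest elements
of supports, one sees that it is spanned by the `D_w` with `J ⊆ R(w)` (`IsSymmetricFamily.le_span`).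
So the `D_w` with some descent in `S₀` span the sum of the eigenideals of the `s ∈ S₀`, and those
with all of `S₀` as descents span their intersection.

Up to a scalar, `D_{w₀}` is the sum of the `r ^ l(u) T_u` over the finite Weyl group. An element of
the intersection is determined by its coefficients at the minimal representatives `d` of the cosets
`d W₀`, and among these `T_d D_{w₀}` sees only `d`; hence the intersection is `H D_{w₀}`
(`exists_eq_mul_longest`). An eigenvector for `q r` has the form `g (T_s - q r')`, which kills the
left eigenvector `D'_{w₀}`. Modulo such eigenvectors every `T_w` is a multiple of some `T_d`, and
the `T_d D'_{w₀}` are independent, so the sum of the eigenideals is exactly the annihilator of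
`D'_{w₀}` (`mul_longest_eq_zero_iff`).

This rests on three foundations. Counting separating hyperplanes gives a length function with the
exchange property (`isLengthFn_length`). The regular representation shows that the `T_w` form a
basis. The usual recursion gives the Kazhdan–Lusztig polynomials together with their symmetry
(`exists_isAbstractKL`). Finally, no `w` has all of `S` as right descents, so `Γ₀` is the set of `w`
with `S₀ ⊆ R(w)`. -/

noncomputable section

namespace AffineHecke

/-! ### Length functions from inversion sets; exchange; parabolic cosets. -/

section Length

variable {W : Type*} [Group W]

/-- Abstract inversion sets: `N g` is the set of reflections whose mirror separates the fundamental
chamber from its image under `g`. -/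
structure IsInversionSystem (S T : Set W) (N : W → Set W) : Prop where
  finite : ∀ g, (N g).Finite
  subset : ∀ g, N g ⊆ T
  mul : ∀ g h t, t ∈ T → (t ∈ N (g * h) ↔ ¬ (t ∈ N g ↔ g⁻¹ * t * g ∈ N h))
  simple_subset : S ⊆ T
  sq : ∀ t ∈ T, t * t = 1
  conj : ∀ t ∈ T, ∀ g : W, g * t * g⁻¹ ∈ T
  self_mem : ∀ t ∈ T, t ∈ N t
  simple : ∀ s ∈ S, N s = {s}
  exists_simple : ∀ g, (N g).Nonempty → ∃ s ∈ S, s ∈ N g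

/-- The properties of the length function of an extended Coxeter group with simple reflections `S`
and reflections `T` used to construct its Hecke algebra and the Kazhdan-Lusztig polynomials. -/
structure IsLengthFn (S T : Set W) (l : W → ℕ) : Prop where
  one : l 1 = 0
  inv : ∀ g, l g⁻¹ = l g
  mul_le : ∀ g h, l (g * h) ≤ l g + l h
  simple_subset : S ⊆ T
  sq : ∀ t ∈ T, t * t = 1
  conj : ∀ t ∈ T, ∀ g : W, g * t * g⁻¹ ∈ T
  simple_mul : ∀ s ∈ S, ∀ g, l (s * g) = l g + 1 ∨ l (s * g) + 1 = l g
  lift : ∀ s ∈ S, ∀ t ∈ T, t ≠ s → ∀ x, l x < l (t * x) → l (s * x) < l (s * (t * x))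
  exists_descent : ∀ g, l g ≠ 0 → ∃ s ∈ S, l (s * g) < l g

namespace IsInversionSystem

variable {S T : Set W} {N : W → Set W} (h : IsInversionSystem S T N)
include h

theorem one : N 1 = ∅ := by
  ext t
  constructor
  · intro ht
    have := (h.mul 1 1 t (h.subset _ ht)).1 (by simpa using ht)
    simp at this
  · simp

theorem mem_inv (g t : W) : t ∈ N g⁻¹ ↔ g * t * g⁻¹ ∈ N g := by
  by_cases ht : t ∈ T
  · have := h.mul g⁻¹ g t ht
    rw [inv_mul_cancel, h.one, inv_inv] at this
    simpa using this
  · constructor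
    · exact fun h' => absurd (h.subset _ h') ht
    · intro h'
      have := h.conj _ (h.subset _ h') g⁻¹
      simp [mul_assoc] at this
      exact absurd this ht

theorem ncard_inv (g : W) : (N g⁻¹).ncard = (N g).ncard := by
  have : N g = MulAut.conj g '' N g⁻¹ := by
    ext t
    rw [Set.mem_image]
    constructor
    · intro ht
      refine ⟨g⁻¹ * t * g, ?_, by simp [mul_assoc]⟩
      rw [h.mem_inv]
      simpa [mul_assoc] using ht
    · rintro ⟨u, hu, rfl⟩
      simpa [h.mem_inv] using hu
  rw [this, Set.ncard_image_of_injective _ (MulAut.conj g).injective]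

theorem ncard_mul_le (g k : W) : (N (g * k)).ncard ≤ (N g).ncard + (N k).ncard := by
  have : N (g * k) ⊆ N g ∪ MulAut.conj g '' N k := by
    intro t ht
    have h1 := (h.mul g k t (h.subset _ ht)).1 ht
    by_cases h2 : t ∈ N g
    · exact Or.inl h2
    · refine Or.inr ⟨g⁻¹ * t * g, ?_, by simp [mul_assoc]⟩
      tauto
  refine (Set.ncard_le_ncard this ((h.finite g).union ((h.finite k).image _))).trans ?_
  refine (Set.ncard_union_le _ _).trans ?_
  rw [Set.ncard_image_of_injective _ (MulAut.conj g).injective]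

theorem simple_inv {s : W} (hs : s ∈ S) : s⁻¹ = s :=
  inv_eq_of_mul_eq_one_left (h.sq s (h.simple_subset hs))

/-- By the cocycle rule and `N s = {s}`, conjugation by `s` carries `N g` onto `N (s * g)` up to the
element `s` itself, which is added or removed. -/
theorem ncard_simple_mul {s : W} (hs : s ∈ S) (g : W) :
    (s ∉ N g → (N (s * g)).ncard = (N g).ncard + 1) ∧
    (s ∈ N g → (N (s * g)).ncard + 1 = (N g).ncard) := by
  have key : ∀ g, s ∉ N g → (N (s * g)).ncard = (N g).ncard + 1 := by
    intro g hg
    have : N (s * g) = insert s (MulAut.conj s '' N g) := by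
      ext t
      rw [Set.mem_insert_iff, Set.mem_image]
      have hsts : s⁻¹ * s * s = s := by simp
      constructor
      · intro ht
        have h1 := (h.mul s g t (h.subset _ ht)).1 ht
        rw [h.simple s hs, Set.mem_singleton_iff] at h1
        by_cases h2 : t = s
        · exact Or.inl h2
        · exact Or.inr ⟨s⁻¹ * t * s, by tauto, by simp [mul_assoc]⟩
      · rintro (rfl | ⟨u, hu, rfl⟩)
        · rw [h.mul t g t (h.simple_subset hs), h.simple t hs, hsts]
          simp [hg]
        · have hu' : MulAut.conj s u ∈ T := h.conj _ (h.subset _ hu) s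
          rw [h.mul s g _ hu', h.simple s hs, Set.mem_singleton_iff]
          have h3 : MulAut.conj s u ≠ s := by
            intro h4
            rw [MulAut.conj_apply, mul_inv_eq_iff_eq_mul, mul_right_inj] at h4
            exact hg (h4 ▸ hu)
          have h4 : s⁻¹ * (MulAut.conj s u) * s = u := by simp [mul_assoc]
          rw [h4]
          tauto
    rw [this, Set.ncard_insert_of_notMem _ ((h.finite g).image _),
      Set.ncard_image_of_injective _ (MulAut.conj s).injective]
    rintro ⟨u, hu, h5⟩
    rw [MulAut.conj_apply, mul_inv_eq_iff_eq_mul, mul_right_inj] at h5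
    exact hg (h5 ▸ hu)
  refine ⟨key g, fun hg => ?_⟩
  have h1 : s ∉ N (s * g) := by
    rw [h.mul s g s (h.simple_subset hs), h.simple s hs]
    simpa using hg
  have := key _ h1
  rw [← mul_assoc, h.sq s (h.simple_subset hs), one_mul] at this
  exact this.symm

theorem exists_simple_ncard (g : W) (hg : (N g).ncard ≠ 0) :
    ∃ s ∈ S, (N (s * g)).ncard + 1 = (N g).ncard := by
  obtain ⟨s, hs, hsg⟩ := h.exists_simple g (Set.nonempty_of_ncard_ne_zero hg)
  exact ⟨s, hs, (h.ncard_simple_mul hs g).2 hsg⟩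

/-- A simple `s ∈ N g` different from `t` moves the question to `s t s` and the shorter `s * g`;
going back through `s` costs at most one. No reduced words are needed. -/
theorem ncard_refl_mul_lt_of_mem (g : W) : ∀ t ∈ N g, (N (t * g)).ncard < (N g).ncard := by
  induction hn : (N g).ncard using Nat.strong_induction_on generalizing g with
  | _ n ih =>
    intro t ht
    have h0 : (N g).ncard ≠ 0 := by
      exact Set.ncard_ne_zero_of_mem ht (h.finite g)
    obtain ⟨s, hs, h1⟩ := h.exists_simple_ncard g h0
    have hss := h.sq s (h.simple_subset hs)
    by_cases hts : t = s
    · subst hts; omega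
    · have h2 : s * t * s ∈ N (s * g) := by
        have h3 : s * t * s ∈ T := by
          have := h.conj t (h.subset _ ht) s
          rwa [h.simple_inv hs] at this
        rw [h.mul s g _ h3, h.simple s hs, Set.mem_singleton_iff]
        have h4 : s⁻¹ * (s * t * s) * s = t := by simp [mul_assoc, hss]
        rw [h4]
        have h5 : s * t * s ≠ s := by
          intro h6
          rw [mul_eq_right, mul_eq_one_iff_inv_eq, h.simple_inv hs] at h6
          exact hts h6.symm
        tauto
      have h6 := ih _ (by omega) (s * g) rfl _ h2
      have h7 : s * t * s * (s * g) = s * (t * g) := by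
        rw [mul_assoc (s * t) s, ← mul_assoc s s g, hss, one_mul, mul_assoc]
      rw [h7] at h6
      have h8 : (N (t * g)).ncard ≤ 1 + (N (s * (t * g))).ncard := by
        have := h.ncard_mul_le s (s * (t * g))
        rw [← mul_assoc s s, hss, one_mul, h.simple s hs, Set.ncard_singleton] at this
        exact this
      omega

/-- Since `t ∈ N t`, exactly one of `N g` and `N (t * g)` contains `t`, so the preceding inequality
applies to one of the two. -/
theorem mem_iff_ncard_lt {t : W} (ht : t ∈ T) (g : W) :
    t ∈ N g ↔ (N (t * g)).ncard < (N g).ncard := by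
  refine ⟨h.ncard_refl_mul_lt_of_mem g t, fun hlt => ?_⟩
  by_contra hg
  have h1 : t ∈ N (t * g) := by
    rw [h.mul t g t ht]
    have h2 : t⁻¹ * t * t = t := by simp
    rw [h2]
    have := h.self_mem t ht
    tauto
  have := h.ncard_refl_mul_lt_of_mem _ t h1
  rw [← mul_assoc, h.sq t ht, one_mul] at this
  omega

theorem isLengthFn : IsLengthFn S T (fun g => (N g).ncard) where
  one := by simp [h.one]
  inv := h.ncard_inv
  mul_le := h.ncard_mul_le
  simple_subset := h.simple_subset
  sq := h.sq
  conj := h.conj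
  simple_mul s hs g := by
    by_cases hg : s ∈ N g
    · exact Or.inr ((h.ncard_simple_mul hs g).2 hg)
    · exact Or.inl ((h.ncard_simple_mul hs g).1 hg)
  lift s hs t ht hts x hx := by
    have hss := h.sq s (h.simple_subset hs)
    have hc : s * t * s ∈ T := by
      have := h.conj t ht s
      rwa [h.simple_inv hs] at this
    have h1 : t ∉ N x := by
      rw [h.mem_iff_ncard_lt ht]
      exact not_lt.2 hx.le
    -- Left multiplication by `s` turns the reflection `t` into `s t s`; as `t ≠ s`, the cocycle
    -- rule carries the absence of `t` from `N x` over to `N (s * x)`.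
    have h2 : s * t * s ∉ N (s * x) := by
      rw [h.mul s x _ hc, h.simple s hs, Set.mem_singleton_iff]
      have h4 : s⁻¹ * (s * t * s) * s = t := by simp [mul_assoc, hss]
      have h5 : s * t * s ≠ s := by
        intro h6
        rw [mul_eq_right, mul_eq_one_iff_inv_eq, h.simple_inv hs] at h6
        exact hts h6.symm
      rw [h4]
      tauto
    have h3 : s * t * s ∈ N (s * t * s * (s * x)) := by
      rw [h.mul _ (s * x) _ hc]
      rw [inv_mul_cancel, one_mul]
      have := h.self_mem _ hc
      tauto
    have h4 := h.ncard_refl_mul_lt_of_mem _ _ h3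
    have h5 : s * t * s * (s * x) = s * (t * x) := by
      rw [mul_assoc (s * t) s, ← mul_assoc s s x, hss, one_mul, mul_assoc]
    rw [← mul_assoc, h.sq _ hc, one_mul, h5] at h4
    exact h4
  exists_descent g hg := by
    obtain ⟨s, hs, h1⟩ := h.exists_simple_ncard g hg
    exact ⟨s, hs, by omega⟩

end IsInversionSystem

namespace IsLengthFn

variable {S T : Set W} {l : W → ℕ} (h : IsLengthFn S T l)
include h

theorem simple_sq {s : W} (hs : s ∈ S) : s * s = 1 := h.sq s (h.simple_subset hs)

theorem simple_inv {s : W} (hs : s ∈ S) : s⁻¹ = s :=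
  inv_eq_of_mul_eq_one_left (h.simple_sq hs)

theorem simple_mul_cancel {s : W} (hs : s ∈ S) (g : W) : s * (s * g) = g := by
  rw [← mul_assoc, h.simple_sq hs, one_mul]

theorem mul_simple_cancel {s : W} (hs : s ∈ S) (g : W) : g * s * s = g := by
  rw [mul_assoc, h.simple_sq hs, mul_one]

theorem refl_inv {t : W} (ht : t ∈ T) : t⁻¹ = t := inv_eq_of_mul_eq_one_left (h.sq t ht)

theorem conj' {t : W} (ht : t ∈ T) (g : W) : g⁻¹ * t * g ∈ T := by
  simpa using h.conj t ht g⁻¹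

theorem inv_mul_simple {s : W} (hs : s ∈ S) (g : W) : (g * s)⁻¹ = s * g⁻¹ := by
  rw [mul_inv_rev, h.simple_inv hs]

theorem length_mul_simple {s : W} (hs : s ∈ S) (g : W) : l (g * s) = l (s * g⁻¹) := by
  rw [← h.inv, h.inv_mul_simple hs]

theorem length_simple {s : W} (hs : s ∈ S) : l s = 1 := by
  have := h.simple_mul s hs 1
  rw [mul_one, h.one] at this
  omega

theorem mul_simple {s : W} (hs : s ∈ S) (g : W) : l (g * s) = l g + 1 ∨ l (g * s) + 1 = l g := by
  rw [h.length_mul_simple hs, ← h.inv g]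
  exact h.simple_mul s hs _

theorem mul_simple_of_lt {s : W} (hs : s ∈ S) {g : W} (hg : l g < l (g * s)) :
    l (g * s) = l g + 1 := by
  have := h.mul_simple hs g
  omega

theorem mul_simple_of_gt {s : W} (hs : s ∈ S) {g : W} (hg : l (g * s) < l g) :
    l (g * s) + 1 = l g := by
  have := h.mul_simple hs g
  omega

theorem mul_simple_lt_or_gt {s : W} (hs : s ∈ S) (g : W) : l g < l (g * s) ∨ l (g * s) < l g := by
  have := h.mul_simple hs g
  omega

theorem not_lt_mul_simple {s : W} (hs : s ∈ S) {g : W} : ¬ l g < l (g * s) ↔ l (g * s) < l g := by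
  have := h.mul_simple hs g
  omega

theorem simple_mul_lt_or_gt {s : W} (hs : s ∈ S) (g : W) : l g < l (s * g) ∨ l (s * g) < l g := by
  have := h.simple_mul s hs g
  omega

theorem exists_right_descent (g : W) (hg : l g ≠ 0) : ∃ s ∈ S, l (g * s) < l g := by
  obtain ⟨s, hs, h1⟩ := h.exists_descent g⁻¹ (by rwa [h.inv])
  refine ⟨s, hs, ?_⟩
  rwa [h.length_mul_simple hs, ← h.inv g]

theorem length_zero_mul {x : W} (hx : l x = 0) (g : W) : l (x * g) = l g := by
  apply le_antisymm
  · have := h.mul_le x g; omega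
  · have := h.mul_le x⁻¹ (x * g)
    rw [inv_mul_cancel_left, h.inv] at this
    omega

theorem length_mul_zero {x : W} (hx : l x = 0) (g : W) : l (g * x) = l g := by
  rw [← h.inv, mul_inv_rev, h.length_zero_mul (by rw [h.inv, hx]), h.inv]

theorem lift_right {s : W} (hs : s ∈ S) {t : W} (ht : t ∈ T) (hts : t ≠ s) {x : W}
    (hx : l x < l (x * t)) : l (x * s) < l (x * t * s) := by
  have h1 := h.lift s hs t ht hts x⁻¹ (by
    rw [h.inv, ← h.inv (t * x⁻¹), mul_inv_rev, inv_inv, h.refl_inv ht]; exact hx)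
  rw [h.length_mul_simple hs, h.length_mul_simple hs, mul_inv_rev, h.refl_inv ht]
  exact h1

/-- The exchange condition. -/
theorem simple_mul_eq_mul_simple {s t : W} (hs : s ∈ S) (ht : t ∈ S) {x : W}
    (h1 : l x < l (x * t)) (h2 : l (s * (x * t)) ≤ l (s * x)) : s * x = x * t := by
  by_contra hne
  -- Acting with `t` on the right of `x` is acting with the reflection `x t x⁻¹` on the left; `lift`
  -- excludes only the case where this reflection is `s`.
  have h3 := h.lift s hs (x * t * x⁻¹) (h.conj t (h.simple_subset ht) x) (by
    intro h4
    apply hne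
    rw [← h4]; group) x (by rw [inv_mul_cancel_right]; exact h1)
  rw [inv_mul_cancel_right] at h3
  omega

/-- The elements of the parabolic subgroup of `S₀` having a reduced word in `S₀`. -/
inductive ReducedIn (l : W → ℕ) (S₀ : Set W) : W → Prop
  | one : ReducedIn l S₀ 1
  | simple_mul (s g : W) (hs : s ∈ S₀) (hg : ReducedIn l S₀ g) (hl : l g < l (s * g)) :
      ReducedIn l S₀ (s * g)

section Parabolic

variable {S₀ : Set W} (hS₀ : S₀ ⊆ S)
include hS₀

/-- The first letter `r` can be put back in front of the word for `g s` unless `g s` is longer than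
`g` while `r g s` is shorter than `r g`. Exchange then gives `r g = g s`, so `r g s = g`. -/
theorem ReducedIn.mul_simple {g : W} (hg : ReducedIn l S₀ g) :
    ∀ s ∈ S₀, ReducedIn l S₀ (g * s) := by
  induction hg with
  | one =>
    intro s hs
    have := ReducedIn.simple_mul (l := l) s 1 hs .one (by
      rw [mul_one, h.one, h.length_simple (hS₀ hs)]; exact one_pos)
    simpa using this
  | simple_mul r g hr hg hl ih =>
    intro s hs
    by_cases h1 : l (r * g) < l (r * g * s)
    · rw [mul_assoc]
      refine .simple_mul r _ hr (ih s hs) ?_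
      rw [← mul_assoc]
      have := h.mul_simple (hS₀ hs) g
      omega
    · rcases h.mul_simple_lt_or_gt (hS₀ hs) g with h2 | h2
      · have := h.simple_mul_eq_mul_simple (hS₀ hr) (hS₀ hs) h2 (by rw [← mul_assoc]; omega)
        rwa [this, h.mul_simple_cancel (hS₀ hs)]
      · rw [mul_assoc]
        refine .simple_mul r _ hr (ih s hs) ?_
        rw [← mul_assoc]
        have := h.mul_simple (hS₀ hs) (r * g)
        have := h.simple_mul r (hS₀ hr) g
        omega

theorem reducedIn_of_mem_closure {g : W} (hg : g ∈ Subgroup.closure S₀) : ReducedIn l S₀ g := by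
  induction hg using Subgroup.closure_induction_right with
  | one => exact .one
  | mul_right x hx y hy ih => exact ReducedIn.mul_simple h hS₀ ih y hy
  | mul_inv_cancel x hx y hy ih =>
    rw [h.simple_inv (hS₀ hy)]
    exact ReducedIn.mul_simple h hS₀ ih y hy

theorem eq_one_of_mem_closure_of_length_eq_zero {g : W} (hg : g ∈ Subgroup.closure S₀)
    (h0 : l g = 0) : g = 1 := by
  cases h.reducedIn_of_mem_closure hS₀ hg with
  | one => rfl
  | simple_mul s g hs hg hl => omega

theorem exists_left_descent_of_mem_closure {g : W} (hg : g ∈ Subgroup.closure S₀)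
    (h0 : g ≠ 1) : ∃ s ∈ S₀, l (s * g) < l g := by
  cases h.reducedIn_of_mem_closure hS₀ hg with
  | one => exact absurd rfl h0
  | simple_mul s g hs hg hl => exact ⟨s, hs, by rwa [h.simple_mul_cancel (hS₀ hs)]⟩

theorem exists_right_descent_of_mem_closure {g : W} (hg : g ∈ Subgroup.closure S₀)
    (h0 : g ≠ 1) : ∃ s ∈ S₀, l (g * s) < l g := by
  obtain ⟨s, hs, h1⟩ := h.exists_left_descent_of_mem_closure hS₀ (inv_mem hg) (by simpa using h0)
  refine ⟨s, hs, ?_⟩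
  rwa [h.length_mul_simple (hS₀ hs), ← h.inv g]

/-- Induction on `l d`, removing a left descent `r`; the remaining `d'` is again minimal in its
coset. Additivity could fail only through an exchange `r d' x = d' x s`, which would put `d = r d'`
into the coset of `d'`, and then `d` would have a right descent in `S₀`. -/
theorem length_mul_of_min {d : W} (hd : ∀ s ∈ S₀, l d < l (d * s)) {u : W}
    (hu : u ∈ Subgroup.closure S₀) : l (d * u) = l d + l u := by
  induction hn : l d generalizing d u with
  | zero => rw [h.length_zero_mul hn, zero_add]
  | succ n ih =>
    obtain ⟨r, hr, hrd⟩ := h.exists_descent d (by omega)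
    obtain ⟨d', hd'⟩ : ∃ d', d = r * d' := ⟨r * d, (h.simple_mul_cancel hr d).symm⟩
    subst hd'
    rw [h.simple_mul_cancel hr] at hrd
    have hl : l d' = n := by have := h.simple_mul r hr d'; omega
    have hmin : ∀ s ∈ S₀, l d' < l (d' * s) := by
      intro s hs
      by_contra h1
      have h2 := (h.not_lt_mul_simple (hS₀ hs)).1 h1
      have h3 := h.simple_mul r hr (d' * s)
      have h4 := hd s hs
      rw [mul_assoc] at h4
      omega
    have IH : ∀ u ∈ Subgroup.closure S₀, l (d' * u) = n + l u := fun u hu => ih hmin hu hl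
    have hnr : ∀ x ∈ Subgroup.closure S₀, r * d' ≠ d' * x := by
      intro x hx h1
      have h2 : x ≠ 1 := by
        rintro rfl
        rw [mul_one] at h1
        rw [h1] at hrd
        omega
      obtain ⟨s, hs, h3⟩ := h.exists_right_descent_of_mem_closure hS₀ hx h2
      have h4 := hd s hs
      rw [h1, mul_assoc, IH _ hx, IH _ (mul_mem hx (Subgroup.subset_closure hs))] at h4
      omega
    clear ih
    have step : ∀ x ∈ Subgroup.closure S₀, ∀ s ∈ S₀, l (r * d' * x) = n + 1 + l x →
        l (r * d' * (x * s)) = n + 1 + l (x * s) := by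
      intro x hx s hs ihx
      have hs' : s ∈ Subgroup.closure S₀ := Subgroup.subset_closure hs
      have hxs := mul_mem hx hs'
      have h2 := IH _ hxs
      have h3 := IH _ hx
      have h4 := h.simple_mul r hr (d' * (x * s))
      rw [← mul_assoc r] at h4
      rw [mul_assoc r] at ihx h4 ⊢
      rcases h4 with h4 | h4
      · omega
      · exfalso
        have h6 := h.mul_simple (hS₀ hs) x
        rcases h.mul_simple_lt_or_gt (hS₀ hs) x with h5 | h5
        · have := h.simple_mul_eq_mul_simple hr (hS₀ hs) (x := d' * x)
            (by rw [mul_assoc]; omega) (by rw [mul_assoc d' x s]; omega)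
          refine hnr (x * s * x⁻¹) (mul_mem hxs (inv_mem hx)) ?_
          rw [← mul_assoc, ← mul_assoc, ← this]; group
        · have h7 := h.mul_simple (hS₀ hs) (r * (d' * x))
          rw [mul_assoc, mul_assoc d'] at h7
          omega
    induction hu using Subgroup.closure_induction_right with
    | one => rw [mul_one, hn, h.one]
    | mul_right x hx s hs ihx => exact step x hx s hs ihx
    | mul_inv_cancel x hx s hs ihx =>
      rw [h.simple_inv (hS₀ hs)]
      exact step x hx s hs ihx

/-- Every element is the product of a minimal coset representative and an element of the
parabolic subgroup. -/
theorem exists_min_mul (w : W) : ∃ d u, (∀ s ∈ S₀, l d < l (d * s)) ∧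
    u ∈ Subgroup.closure S₀ ∧ w = d * u := by
  induction hn : l w using Nat.strong_induction_on generalizing w with
  | _ n ih =>
    by_cases hw : ∀ s ∈ S₀, l w < l (w * s)
    · exact ⟨w, 1, hw, one_mem _, (mul_one w).symm⟩
    · push Not at hw
      obtain ⟨s, hs, h1⟩ := hw
      have := h.mul_simple (hS₀ hs) w
      obtain ⟨d, u, hd, hu, h2⟩ := ih (l (w * s)) (by omega) (w * s) rfl
      refine ⟨d, u * s, hd, mul_mem hu (Subgroup.subset_closure hs), ?_⟩
      rw [← mul_assoc, ← h2, h.mul_simple_cancel (hS₀ hs)]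

/-- Additivity of lengths used in both directions gives `u' u⁻¹` length zero, and such an element of
the parabolic subgroup is trivial. -/
theorem min_mul_unique {d d' u u' : W} (hd : ∀ s ∈ S₀, l d < l (d * s))
    (hd' : ∀ s ∈ S₀, l d' < l (d' * s)) (hu : u ∈ Subgroup.closure S₀)
    (hu' : u' ∈ Subgroup.closure S₀) (he : d * u = d' * u') : d = d' ∧ u = u' := by
  have h1 : d = d' * (u' * u⁻¹) := by rw [← mul_assoc, ← he]; group
  have h2 : d' = d * (u * u'⁻¹) := by rw [← mul_assoc, he]; group
  have h3 := h.length_mul_of_min hS₀ hd' (mul_mem hu' (inv_mem hu))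
  have h4 := h.length_mul_of_min hS₀ hd (mul_mem hu (inv_mem hu'))
  rw [← h1] at h3
  rw [← h2] at h4
  have h5 := h.eq_one_of_mem_closure_of_length_eq_zero hS₀ (mul_mem hu' (inv_mem hu)) (by omega)
  rw [h5, mul_one] at h1
  exact ⟨h1, (mul_inv_eq_one.1 h5).symm⟩

end Parabolic

end IsLengthFn

end Length

/-! ### The left regular representation on the free module over the group. -/

section RegularRepresentation

variable {W : Type*} [Group W] (l : W → ℕ) {A : Type*} [CommRing A] (q : A)

open Classical in
/-- Left multiplication by `T_s` on the free module over `W`. -/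
def leftOp (s : W) : (W →₀ A) →ₗ[A] (W →₀ A) :=
  Finsupp.linearCombination A fun x =>
    if l x < l (s * x) then Finsupp.single (s * x) 1
    else q • Finsupp.single (s * x) 1 + (q - 1) • Finsupp.single x 1

open Classical in
/-- Right multiplication by `T_s` on the free module over `W`. -/
def rightOp (s : W) : (W →₀ A) →ₗ[A] (W →₀ A) :=
  Finsupp.linearCombination A fun x =>
    if l x < l (x * s) then Finsupp.single (x * s) 1
    else q • Finsupp.single (x * s) 1 + (q - 1) • Finsupp.single x 1

variable (A) in
/-- Left translation on the free module over `W`. -/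
def leftTranslation (g : W) : (W →₀ A) →ₗ[A] (W →₀ A) :=
  Finsupp.linearCombination A fun x => Finsupp.single (g * x) 1

variable (A) in
/-- Right translation on the free module over `W`. -/
def rightTranslation (g : W) : (W →₀ A) →ₗ[A] (W →₀ A) :=
  Finsupp.linearCombination A fun x => Finsupp.single (x * g) 1

variable {l}

theorem leftOp_of_lt {s x : W} (hx : l x < l (s * x)) :
    leftOp l q s (Finsupp.single x 1) = Finsupp.single (s * x) 1 := by
  simp [leftOp, hx]

theorem leftOp_of_not_lt {s x : W} (hx : ¬ l x < l (s * x)) :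
    leftOp l q s (Finsupp.single x 1) =
      q • Finsupp.single (s * x) 1 + (q - 1) • Finsupp.single x 1 := by
  rw [leftOp, Finsupp.linearCombination_single, one_smul, if_neg hx]

theorem rightOp_of_lt {s x : W} (hx : l x < l (x * s)) :
    rightOp l q s (Finsupp.single x 1) = Finsupp.single (x * s) 1 := by
  simp [rightOp, hx]

theorem rightOp_of_not_lt {s x : W} (hx : ¬ l x < l (x * s)) :
    rightOp l q s (Finsupp.single x 1) =
      q • Finsupp.single (x * s) 1 + (q - 1) • Finsupp.single x 1 := by
  rw [rightOp, Finsupp.linearCombination_single, one_smul, if_neg hx]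

@[simp] theorem leftTranslation_single (g x : W) :
    leftTranslation A g (Finsupp.single x 1) = Finsupp.single (g * x) 1 := by
  simp [leftTranslation]

@[simp] theorem rightTranslation_single (g x : W) :
    rightTranslation A g (Finsupp.single x 1) = Finsupp.single (x * g) 1 := by
  simp [rightTranslation]

omit [Group W] in
theorem linearMap_ext_single {M : Type*} [AddCommGroup M] [Module A M]
    {f g : (W →₀ A) →ₗ[A] M}
    (hfg : ∀ x, f (Finsupp.single x 1) = g (Finsupp.single x 1)) : f = g :=
  Finsupp.lhom_ext' fun x => LinearMap.ext_ring (hfg x)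

variable {S T : Set W} (h : IsLengthFn S T l)
include h

/-- The lengths of `x`, `s x`, `x t`, `s x t` decide which formulas apply. The formulas agree at
once, except when `s x` and `x t` are both longer or both shorter than `x` and `s x t` has the
length of `x`; then exchange gives `s x = x t`. -/
theorem leftOp_comm_rightOp {s t : W} (hs : s ∈ S) (ht : t ∈ S) :
    Commute (leftOp l q s : Module.End A (W →₀ A)) (rightOp l q t) := by
  refine linearMap_ext_single fun x => ?_
  simp only [Module.End.mul_apply]
  have e1 := h.simple_mul s hs x
  have e2 := h.mul_simple ht x
  have e3 := h.simple_mul s hs (x * t)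
  have e4 := h.mul_simple ht (s * x)
  rw [mul_assoc] at e4
  by_cases ha : l x < l (s * x) <;> by_cases hb : l x < l (x * t)
  · rw [leftOp_of_lt q ha, rightOp_of_lt q hb]
    by_cases hc : l (s * x) < l (s * (x * t))
    · rw [leftOp_of_lt q (by omega), rightOp_of_lt q (by rwa [mul_assoc]), mul_assoc]
    · have hx := h.simple_mul_eq_mul_simple hs ht hb (not_lt.1 hc)
      rw [leftOp_of_not_lt q (by omega), rightOp_of_not_lt q (by rwa [mul_assoc]), ← hx,
        h.simple_mul_cancel hs, hx, h.mul_simple_cancel ht]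
  · rw [leftOp_of_lt q ha, rightOp_of_not_lt q hb, map_add, map_smul, map_smul,
      leftOp_of_lt q ha, leftOp_of_lt q (by omega),
      rightOp_of_not_lt q (by rw [mul_assoc]; omega), mul_assoc]
  · rw [leftOp_of_not_lt q ha, rightOp_of_lt q hb, map_add, map_smul, map_smul,
      rightOp_of_lt q hb, rightOp_of_lt q (by rw [mul_assoc]; omega),
      leftOp_of_not_lt q (by omega), mul_assoc]
  · rw [leftOp_of_not_lt q ha, rightOp_of_not_lt q hb]
    simp only [map_add, map_smul]
    rw [leftOp_of_not_lt q ha, rightOp_of_not_lt q hb]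
    by_cases hc : l (s * x) < l (s * (x * t))
    · have hx := h.simple_mul_eq_mul_simple hs ht (x := x * t)
        (by rw [h.mul_simple_cancel ht]; omega) (by rw [h.mul_simple_cancel ht]; omega)
      rw [h.mul_simple_cancel ht] at hx
      have hx' : s * x = x * t := by rw [← hx, h.simple_mul_cancel hs, hx]
      rw [leftOp_of_lt q (by omega), rightOp_of_lt q (by rw [mul_assoc]; omega), mul_assoc,
        hx, hx']
    · rw [leftOp_of_not_lt q (by omega), rightOp_of_not_lt q (by rwa [mul_assoc]), mul_assoc]
      module

theorem leftOp_comm_rightTranslation (s : W) {g : W} (hg : l g = 0) :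
    Commute (leftOp l q s : Module.End A (W →₀ A)) (rightTranslation A g) := by
  refine linearMap_ext_single fun x => ?_
  simp only [Module.End.mul_apply, rightTranslation_single]
  by_cases hx : l x < l (s * x)
  · rw [leftOp_of_lt q hx, leftOp_of_lt q (by
      rwa [← mul_assoc, h.length_mul_zero hg, h.length_mul_zero hg]),
      rightTranslation_single, mul_assoc]
  · rw [leftOp_of_not_lt q hx, leftOp_of_not_lt q (by
      rwa [← mul_assoc, h.length_mul_zero hg, h.length_mul_zero hg])]
    simp only [map_add, map_smul, rightTranslation_single, mul_assoc]

theorem leftTranslation_comm_rightOp (s : W) {g : W} (hg : l g = 0) :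
    Commute (leftTranslation A g : Module.End A (W →₀ A)) (rightOp l q s) := by
  refine linearMap_ext_single fun x => ?_
  simp only [Module.End.mul_apply, leftTranslation_single]
  by_cases hx : l x < l (x * s)
  · rw [rightOp_of_lt q hx, rightOp_of_lt q (by
      rwa [mul_assoc, h.length_zero_mul hg, h.length_zero_mul hg]),
      leftTranslation_single, mul_assoc]
  · rw [rightOp_of_not_lt q hx, rightOp_of_not_lt q (by
      rwa [mul_assoc, h.length_zero_mul hg, h.length_zero_mul hg])]
    simp only [map_add, map_smul, leftTranslation_single, mul_assoc]

omit h in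
theorem leftTranslation_comm_rightTranslation (g k : W) :
    Commute (leftTranslation A g : Module.End A (W →₀ A)) (rightTranslation A k) := by
  refine linearMap_ext_single fun x => ?_
  simp [mul_assoc]

variable (S l)

omit h in
/-- The commutant of the right multiplications. -/
def rightCommutant : Subalgebra A (Module.End A (W →₀ A)) :=
  Subalgebra.centralizer A
    (rightOp l q '' S ∪ rightTranslation A '' {g | l g = 0} : Set (Module.End A (W →₀ A)))

variable {S l}

omit h in
theorem mem_rightCommutant {f : Module.End A (W →₀ A)} : f ∈ rightCommutant l q S ↔
    (∀ s ∈ S, Commute f (rightOp l q s)) ∧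
      ∀ g, l g = 0 → Commute f (rightTranslation A g) := by
  rw [rightCommutant, Subalgebra.mem_centralizer_iff]
  constructor
  · intro hf
    exact ⟨fun s hs => (hf _ (Or.inl ⟨s, hs, rfl⟩)).symm,
      fun g hg => (hf _ (Or.inr ⟨g, hg, rfl⟩)).symm⟩
  · rintro ⟨h1, h2⟩ _ (⟨s, hs, rfl⟩ | ⟨g, hg, rfl⟩)
    · exact (h1 s hs).symm
    · exact (h2 g hg).symm

theorem leftOp_mem_rightCommutant {s : W} (hs : s ∈ S) : leftOp l q s ∈ rightCommutant l q S :=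
  (mem_rightCommutant q).2 ⟨fun _ ht => leftOp_comm_rightOp q h hs ht,
    fun _ hg => leftOp_comm_rightTranslation q h s hg⟩

theorem leftTranslation_mem_rightCommutant {g : W} (hg : l g = 0) :
    leftTranslation A g ∈ rightCommutant l q S :=
  (mem_rightCommutant q).2 ⟨fun s _ => leftTranslation_comm_rightOp q h s hg,
    fun k _ => leftTranslation_comm_rightTranslation g k⟩

/-- The basis vector at `x` arises from the one at `1` by a length-zero right translation and
length-increasing right operators, all of which commute with `f` and `g`. So evaluation at `1` is
injective on the commutant, and identities between left operators need checking only there. -/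
theorem rightCommutant_ext {f g : Module.End A (W →₀ A)} (hf : f ∈ rightCommutant l q S)
    (hg : g ∈ rightCommutant l q S)
    (h1 : f (Finsupp.single 1 1) = g (Finsupp.single 1 1)) : f = g := by
  rw [mem_rightCommutant] at hf hg
  refine linearMap_ext_single fun x => ?_
  induction hn : l x using Nat.strong_induction_on generalizing x with
  | _ n ih =>
    by_cases h0 : l x = 0
    · have e1 := LinearMap.congr_fun (hf.2 x h0).eq (Finsupp.single 1 1)
      have e2 := LinearMap.congr_fun (hg.2 x h0).eq (Finsupp.single 1 1)
      simp only [Module.End.mul_apply, rightTranslation_single, one_mul] at e1 e2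
      rw [e1, e2, h1]
    · obtain ⟨s, hs, hlt⟩ := h.exists_right_descent x h0
      have e1 := LinearMap.congr_fun (hf.1 s hs).eq (Finsupp.single (x * s) 1)
      have e2 := LinearMap.congr_fun (hg.1 s hs).eq (Finsupp.single (x * s) 1)
      simp only [Module.End.mul_apply] at e1 e2
      rw [rightOp_of_lt q (by rwa [h.mul_simple_cancel hs]), h.mul_simple_cancel hs] at e1 e2
      rw [e1, e2, ih _ (by omega) _ rfl]

theorem exists_mem_rightCommutant (w : W) :
    ∃ f ∈ rightCommutant l q S, f (Finsupp.single 1 1) = Finsupp.single w 1 := by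
  induction hn : l w using Nat.strong_induction_on generalizing w with
  | _ n ih =>
    by_cases h0 : l w = 0
    · exact ⟨_, leftTranslation_mem_rightCommutant q h h0, by simp⟩
    · obtain ⟨s, hs, hlt⟩ := h.exists_descent w h0
      obtain ⟨f, hf, hf'⟩ := ih _ (by omega) (s * w) rfl
      refine ⟨leftOp l q s * f, mul_mem (leftOp_mem_rightCommutant q h hs) hf, ?_⟩
      rw [Module.End.mul_apply, hf', leftOp_of_lt q (by rwa [h.simple_mul_cancel hs]),
        h.simple_mul_cancel hs]

/-- The operator of the standard basis element `T_w` in the left regular representation. -/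
def regularOp (w : W) : Module.End A (W →₀ A) := (exists_mem_rightCommutant q h w).choose

theorem regularOp_mem (w : W) : regularOp q h w ∈ rightCommutant l q S :=
  (exists_mem_rightCommutant q h w).choose_spec.1

theorem regularOp_single_one (w : W) :
    regularOp q h w (Finsupp.single 1 1) = Finsupp.single w 1 :=
  (exists_mem_rightCommutant q h w).choose_spec.2

theorem regularOp_one : regularOp q h 1 = 1 :=
  rightCommutant_ext q h (regularOp_mem q h 1) (one_mem _) (by simp [regularOp_single_one])

theorem regularOp_simple {s : W} (hs : s ∈ S) : regularOp q h s = leftOp l q s := by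
  refine rightCommutant_ext q h (regularOp_mem q h s) (leftOp_mem_rightCommutant q h hs) ?_
  rw [regularOp_single_one, leftOp_of_lt q, mul_one]
  rw [h.one, mul_one, h.length_simple hs]
  exact one_pos

theorem regularOp_single {x y : W} (hxy : l (x * y) = l x + l y) :
    regularOp q h x (Finsupp.single y 1) = Finsupp.single (x * y) 1 := by
  induction hn : l x using Nat.strong_induction_on generalizing x with
  | _ n ih =>
    by_cases h0 : l x = 0
    · have : regularOp q h x = leftTranslation A x :=
        rightCommutant_ext q h (regularOp_mem q h x) (leftTranslation_mem_rightCommutant q h h0)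
          (by simp [regularOp_single_one])
      rw [this, leftTranslation_single]
    · obtain ⟨s, hs, hlt⟩ := h.exists_descent x h0
      have e1 := h.simple_mul s hs x
      have e2 := h.simple_mul s hs (x * y)
      have e3 := h.mul_le (s * x) y
      rw [mul_assoc] at e3
      have : regularOp q h x = leftOp l q s * regularOp q h (s * x) := by
        refine rightCommutant_ext q h (regularOp_mem q h x)
          (mul_mem (leftOp_mem_rightCommutant q h hs) (regularOp_mem q h _)) ?_
        rw [Module.End.mul_apply, regularOp_single_one, regularOp_single_one,
          leftOp_of_lt q (by rwa [h.simple_mul_cancel hs]), h.simple_mul_cancel hs]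
      rw [this, Module.End.mul_apply, ih (l (s * x)) (by omega) (by rw [mul_assoc]; omega) rfl,
        mul_assoc, leftOp_of_lt q (by rw [h.simple_mul_cancel hs]; omega),
        h.simple_mul_cancel hs]

theorem regularOp_mul {x y : W} (hxy : l (x * y) = l x + l y) :
    regularOp q h x * regularOp q h y = regularOp q h (x * y) := by
  refine rightCommutant_ext q h (mul_mem (regularOp_mem q h _) (regularOp_mem q h _))
    (regularOp_mem q h _) ?_
  rw [Module.End.mul_apply, regularOp_single_one, regularOp_single_one, regularOp_single q h hxy]

theorem regularOp_quad {s : W} (hs : s ∈ S) :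
    (regularOp q h s - algebraMap A _ q) * (regularOp q h s + 1) = 0 := by
  have h1 : ¬ l s < l (s * s) := by rw [h.simple_sq hs, h.one]; omega
  have hmem : regularOp q h s + 1 ∈ rightCommutant l q S :=
    add_mem (regularOp_mem q h _) (one_mem _)
  refine (sub_mul (α := Module.End A (W →₀ A)) _ _ _).trans ?_
  rw [sub_eq_zero, ← Algebra.smul_def]
  refine rightCommutant_ext q h (mul_mem (regularOp_mem q h _) hmem)
    (Subalgebra.smul_mem _ hmem _) ?_
  rw [Module.End.mul_apply, LinearMap.smul_apply, LinearMap.add_apply, regularOp_single_one,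
    Module.End.one_apply, map_add, regularOp_single_one, regularOp_simple q h hs,
    leftOp_of_not_lt q h1, h.simple_sq hs]
  module

end RegularRepresentation

/-! ### Hecke relations in abstract form, for the generic and the specialised algebra alike. -/

section HeckeBasis

variable {W : Type*} [Group W] {A : Type*} [CommRing A] {H : Type*} [Ring H] [Algebra A H]

/-- The family `τ` satisfies the defining relations of the Hecke algebra with parameter `q`. -/
structure IsHeckeFamily (S : Set W) (l : W → ℕ) (q : A) (τ : W → H) : Prop where
  one : τ 1 = 1
  mul : ∀ x y, l (x * y) = l x + l y → τ x * τ y = τ (x * y)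
  quad : ∀ s ∈ S, (τ s - algebraMap A H q) * (τ s + 1) = 0

/-- The family `τ` is the standard basis of a Hecke algebra with parameter `q`. -/
structure IsHeckeBasis (S : Set W) (l : W → ℕ) (q : A) (τ : W → H) : Prop
    extends IsHeckeFamily S l q τ where
  linearIndependent : LinearIndependent A τ
  span : ⊤ ≤ Submodule.span A (Set.range τ)

namespace IsHeckeFamily

variable {S T : Set W} {l : W → ℕ} {q : A} {τ : W → H} (hτ : IsHeckeFamily S l q τ)
include hτ

theorem simple_mul_simple {s : W} (hs : s ∈ S) : τ s * τ s = (q - 1) • τ s + q • 1 := by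
  have := hτ.quad s hs
  rw [Algebra.algebraMap_eq_smul_one, sub_mul, mul_add, mul_add, mul_one, mul_one,
    smul_mul_assoc, one_mul] at this
  rw [sub_smul, one_smul, ← sub_eq_zero, ← this]
  abel

variable (h : IsLengthFn S T l)
include h

theorem mul_simple_of_lt {s : W} (hs : s ∈ S) {x : W} (hx : l x < l (x * s)) :
    τ x * τ s = τ (x * s) :=
  hτ.mul _ _ (by rw [h.length_simple hs]; exact h.mul_simple_of_lt hs hx)

theorem mul_simple_of_gt {s : W} (hs : s ∈ S) {x : W} (hx : l (x * s) < l x) :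
    τ x * τ s = (q - 1) • τ x + q • τ (x * s) := by
  have hx' : τ x = τ (x * s) * τ s := by
    rw [hτ.mul_simple_of_lt h hs (by rwa [h.mul_simple_cancel hs]), h.mul_simple_cancel hs]
  rw [hx', mul_assoc, hτ.simple_mul_simple hs, mul_add, mul_smul_comm, mul_smul_comm, mul_one]

/-- Induction on `l y`, moving a left descent of `y` over to `x`. -/
theorem mul_mem_span (x y : W) : τ x * τ y ∈ Submodule.span A (Set.range τ) := by
  have hmem : ∀ w, τ w ∈ Submodule.span A (Set.range τ) :=
    fun w => Submodule.subset_span ⟨w, rfl⟩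
  induction hn : l y using Nat.strong_induction_on generalizing x y with
  | _ n ih =>
    by_cases h0 : l y = 0
    · rw [hτ.mul _ _ (by rw [h.length_mul_zero h0, h0, add_zero])]
      exact hmem _
    · obtain ⟨s, hs, hlt⟩ := h.exists_descent y h0
      have e1 := h.simple_mul s hs y
      have hy : τ y = τ s * τ (s * y) := by
        rw [hτ.mul, h.simple_mul_cancel hs]
        rw [h.simple_mul_cancel hs, h.length_simple hs]; omega
      rw [hy, ← mul_assoc]
      rcases h.mul_simple_lt_or_gt hs x with hx | hx
      · rw [hτ.mul_simple_of_lt h hs hx]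
        exact ih _ (by omega) _ _ rfl
      · rw [hτ.mul_simple_of_gt h hs hx, add_mul, smul_mul_assoc, smul_mul_assoc]
        exact add_mem (Submodule.smul_mem _ _ (ih _ (by omega) _ _ rfl))
          (Submodule.smul_mem _ _ (ih _ (by omega) _ _ rfl))

theorem mul_mem_span_range {x y : H} (hx : x ∈ Submodule.span A (Set.range τ))
    (hy : y ∈ Submodule.span A (Set.range τ)) : x * y ∈ Submodule.span A (Set.range τ) := by
  induction hx using Submodule.span_induction with
  | zero => rw [zero_mul]; exact zero_mem _
  | add u v _ _ hu hv => rw [add_mul]; exact add_mem hu hv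
  | smul a u _ hu => rw [smul_mul_assoc]; exact Submodule.smul_mem _ _ hu
  | mem u hu =>
    obtain ⟨u, rfl⟩ := hu
    induction hy using Submodule.span_induction with
    | zero => rw [mul_zero]; exact zero_mem _
    | add y z _ _ hy hz => rw [mul_add]; exact add_mem hy hz
    | smul a y _ hy => rw [mul_smul_comm]; exact Submodule.smul_mem _ _ hy
    | mem y hy =>
      obtain ⟨y, rfl⟩ := hy
      exact hτ.mul_mem_span h u y

end IsHeckeFamily

end HeckeBasis

/-! ### The standard basis of the presented Hecke algebra. -/

section HeckeBasisOfPresentation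

variable {ι V V' : Type*} [AddCommGroup V] [Module ℝ V] [AddCommGroup V'] [Module ℝ V']
  {R : RootPairing ι ℝ V V'} [R.IsCrystallographic] (b : R.Base) {A : Type*} [CommRing A] (q : A)

theorem T_one : T b q 1 = 1 := by
  rw [T, RingQuot.mkAlgHom_rel A (HeckeRel.one (b := b) (q := q)), map_one]

theorem T_mul {x y : ExtAffineWeyl R} (hxy : length b (x * y) = length b x + length b y) :
    T b q x * T b q y = T b q (x * y) := by
  rw [T, T, ← map_mul, RingQuot.mkAlgHom_rel A (HeckeRel.mul (b := b) (q := q) x y hxy), T]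

theorem T_quad {s : ExtAffineWeyl R} (hs : s ∈ simples b) :
    (T b q s - algebraMap A _ q) * (T b q s + 1) = 0 := by
  have := RingQuot.mkAlgHom_rel A (HeckeRel.quad (b := b) (q := q) s hs)
  rw [map_mul, map_sub, map_add, map_zero, map_one, AlgHom.commutes] at this
  exact this

theorem isHeckeFamily_T : IsHeckeFamily (simples b) (length b) q (T b q) where
  one := T_one b q
  mul _ _ := T_mul b q
  quad _ := T_quad b q

variable {b} {Tr : Set (ExtAffineWeyl R)}
  (h : IsLengthFn (simples b) Tr (length b))

/-- The left regular representation of the Hecke algebra. -/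
def regularRep : Hecke b q →ₐ[A] Module.End A (ExtAffineWeyl R →₀ A) :=
  RingQuot.liftAlgHom A ⟨FreeAlgebra.lift A (regularOp q h), by
    intro x y hxy
    induction hxy with
    | one => simp [regularOp_one]
    | mul x y hxy => simp [regularOp_mul q h hxy]
    | quad s hs =>
      rw [map_mul, map_sub, map_add, map_zero, map_one, AlgHom.commutes, FreeAlgebra.lift_ι_apply]
      exact regularOp_quad q h hs⟩

theorem regularRep_T (w : ExtAffineWeyl R) : regularRep q h (T b q w) = regularOp q h w := by
  rw [regularRep, T, RingQuot.liftAlgHom_mkAlgHom_apply, FreeAlgebra.lift_ι_apply]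

include h

/-- In the regular representation `T_w` sends the basis vector at `1` to the one at `w`. -/
theorem linearIndependent_T : LinearIndependent A (T b q) := by
  have h1 : LinearIndependent A
      (((LinearMap.applyₗ (Finsupp.single (1 : ExtAffineWeyl R) (1 : A))) ∘ₗ
        (regularRep q h).toLinearMap) ∘ T b q) := by
    have : (((LinearMap.applyₗ (Finsupp.single (1 : ExtAffineWeyl R) (1 : A))) ∘ₗ
        (regularRep q h).toLinearMap) ∘ T b q) =
        fun w => Finsupp.single w (1 : A) := by
      funext w
      simp only [Function.comp_apply, LinearMap.comp_apply, LinearMap.applyₗ_apply_apply,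
        AlgHom.toLinearMap_apply, regularRep_T, regularOp_single_one]
    rw [this]
    exact Finsupp.linearIndependent_single_one A _
  exact LinearIndependent.of_comp _ h1

theorem span_T : ⊤ ≤ Submodule.span A (Set.range (T b q)) := by
  rintro x -
  obtain ⟨x, rfl⟩ := RingQuot.mkAlgHom_surjective A (HeckeRel b q) x
  induction x using FreeAlgebra.induction with
  | grade0 r =>
    rw [AlgHom.commutes, Algebra.algebraMap_eq_smul_one, ← T_one b q]
    exact Submodule.smul_mem _ _ (Submodule.subset_span ⟨1, rfl⟩)
  | grade1 x => exact Submodule.subset_span ⟨x, rfl⟩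
  | mul x y hx hy =>
    rw [map_mul]
    exact (isHeckeFamily_T b q).mul_mem_span_range h hx hy
  | add x y hx hy => rw [map_add]; exact add_mem hx hy

theorem isHeckeBasis_T : IsHeckeBasis (simples b) (length b) q (T b q) where
  toIsHeckeFamily := isHeckeFamily_T b q
  linearIndependent := linearIndependent_T q h
  span := span_T q h

end HeckeBasisOfPresentation

/-! ### The Bruhat order and its lifting property. -/

section Bruhat

variable {W : Type*} [Group W] {S Tr : Set W} {l : W → ℕ}

/-- The Bruhat order attached to the length function `l` and the set of reflections `Tr`. -/
def AbstractBruhatLE (Tr : Set W) (l : W → ℕ) (y w : W) : Prop :=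
  Relation.ReflTransGen (fun x z => l x < l z ∧ ∃ t ∈ Tr, z = x * t) y w

theorem AbstractBruhatLE.eq_or_length_lt {y w : W} (hyw : AbstractBruhatLE Tr l y w) :
    y = w ∨ l y < l w := by
  induction hyw with
  | refl => exact Or.inl rfl
  | tail _ hbc ih =>
    rcases ih with rfl | ih
    · exact Or.inr hbc.1
    · exact Or.inr (ih.trans hbc.1)

theorem AbstractBruhatLE.length_lt {y w : W} (hyw : AbstractBruhatLE Tr l y w) (hne : y ≠ w) :
    l y < l w := hyw.eq_or_length_lt.resolve_left hne

variable (h : IsLengthFn S Tr l)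
include h

theorem bruhatLE_mul_simple {s w : W} (hs : s ∈ S) (hw : l w < l (w * s)) :
    AbstractBruhatLE Tr l w (w * s) :=
  .single ⟨hw, s, h.simple_subset hs, rfl⟩

/-- A step `x → x t` of a chain is conjugated by `s` into a step `x s → x t s` that still increases
length, unless `t = s`; in that case `x s` is already the next term of the chain. -/
theorem AbstractBruhatLE.mul_simple_or {s y w : W} (hs : s ∈ S)
    (hyw : AbstractBruhatLE Tr l y w) :
    AbstractBruhatLE Tr l (y * s) w ∨ AbstractBruhatLE Tr l (y * s) (w * s) := by
  induction hyw with
  | refl => exact Or.inr .refl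
  | @tail x z _ hxz ih =>
    rcases ih with ih | ih
    · exact Or.inl (ih.tail hxz)
    · obtain ⟨hlt, t, ht, rfl⟩ := hxz
      by_cases hts : t = s
      · exact Or.inl (hts ▸ ih)
      · refine Or.inr (ih.tail ⟨h.lift_right hs ht hts hlt, s⁻¹ * t * s, h.conj' ht s, ?_⟩)
        group

theorem AbstractBruhatLE.mul_simple {s y w : W} (hs : s ∈ S)
    (hyw : AbstractBruhatLE Tr l y w) (hw : l w < l (w * s)) :
    AbstractBruhatLE Tr l (y * s) (w * s) := by
  rcases AbstractBruhatLE.mul_simple_or h hs hyw with h1 | h1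
  · exact h1.trans (bruhatLE_mul_simple h hs hw)
  · exact h1

end Bruhat

/-! ### Laurent polynomials in `v` and the substitution `v ↦ v⁻¹`. -/

section LaurentLemmas

open LaurentPolynomial

theorem aeval_T_eq_toLaurent_expand (f : ℤ[X]) :
    Polynomial.aeval (LaurentPolynomial.T 2 : LaurentPolynomial ℤ) f =
      Polynomial.toLaurent (Polynomial.expand ℤ 2 f) := by
  have : (Polynomial.aeval (LaurentPolynomial.T 2 : LaurentPolynomial ℤ) : ℤ[X] →ₐ[ℤ] _) =
      Polynomial.toLaurentAlg.comp (Polynomial.expand ℤ 2) := by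
    ext
    simp [Polynomial.toLaurentAlg]
  rw [this]
  rfl

theorem aeval_T_neg_eq_invert (f : ℤ[X]) :
    Polynomial.aeval (LaurentPolynomial.T (-2) : LaurentPolynomial ℤ) f =
      invert (Polynomial.aeval (LaurentPolynomial.T 2 : LaurentPolynomial ℤ) f) := by
  have : (Polynomial.aeval (LaurentPolynomial.T (-2) : LaurentPolynomial ℤ) : ℤ[X] →ₐ[ℤ] _) =
      (invert (R := ℤ)).toAlgHom.comp
        (Polynomial.aeval (LaurentPolynomial.T 2 : LaurentPolynomial ℤ)) := by
    ext
    simp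
  rw [this]
  rfl

/-- Powers of `v` separate a polynomial in `v²` of bounded degree from its bar conjugate. -/
theorem eq_zero_of_T_mul_eq {f : ℤ[X]} {m n : ℤ}
    (hf : LaurentPolynomial.T m * Polynomial.aeval (LaurentPolynomial.T 2 : LaurentPolynomial ℤ) f
      = LaurentPolynomial.T n * Polynomial.aeval (LaurentPolynomial.T (-2)) f)
    (hmn : 4 * (f.natDegree : ℤ) < n - m) : f = 0 := by
  by_contra h0
  -- The exponents on the left lie in `[m, m + 2 deg f]`, those on the right in `[n - 2 deg f, n]`,
  -- and these ranges are disjoint. To compare degrees of ordinary polynomials, `g(v⁻¹)` is replaced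
  -- by the reverse of `g(v) = f(v²)`.
  set g := Polynomial.expand ℤ 2 f with hg
  have hg0 : g ≠ 0 := (Polynomial.expand_ne_zero (by norm_num)).2 h0
  have hdeg : g.natDegree = f.natDegree * 2 := Polynomial.natDegree_expand 2 f
  rw [aeval_T_neg_eq_invert, aeval_T_eq_toLaurent_expand, ← hg] at hf
  have hrev := LaurentPolynomial.toLaurent_reverse g
  obtain ⟨N, hN⟩ : ∃ N : ℕ, n - m = N := ⟨(n - m).toNat, by omega⟩
  have e1 : Polynomial.toLaurent (g * Polynomial.X ^ g.natDegree) =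
      Polynomial.toLaurent (Polynomial.X ^ N * g.reverse) := by
    rw [map_mul, map_mul, Polynomial.toLaurent_X_pow, Polynomial.toLaurent_X_pow, hrev, ← hN]
    calc _ = LaurentPolynomial.T (-m) * (LaurentPolynomial.T m * Polynomial.toLaurent g) *
        LaurentPolynomial.T g.natDegree := by
          rw [← mul_assoc (LaurentPolynomial.T (-m)), ← LaurentPolynomial.T_add, neg_add_cancel,
            LaurentPolynomial.T_zero, one_mul]
      _ = _ := by
          rw [hf, ← mul_assoc (LaurentPolynomial.T (-m)), ← LaurentPolynomial.T_add, mul_assoc]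
          congr 2
          ring
  have e2 := Polynomial.toLaurent_injective e1
  have e3 : (Polynomial.X ^ N * g.reverse).natDegree = 2 * g.natDegree := by
    rw [← e2, Polynomial.natDegree_mul hg0 (pow_ne_zero _ Polynomial.X_ne_zero),
      Polynomial.natDegree_X_pow, two_mul]
  have hr0 : g.reverse ≠ 0 := by rwa [ne_eq, Polynomial.reverse_eq_zero]
  rw [Polynomial.natDegree_mul (pow_ne_zero _ Polynomial.X_ne_zero) hr0,
    Polynomial.natDegree_X_pow] at e3
  omega

end LaurentLemmas

/-! ### Coefficient families, multiplication by `T_s + 1`, and the bar conjugate. -/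

section Generic

variable {W : Type*} [Group W] {S Tr : Set W} {l : W → ℕ}
  {H : Type*} [Ring H] [Algebra (LaurentPolynomial ℤ) H] {τ : W → H}

variable (τ) in
/-- The element `∑_y p_y(v²) T_y`. -/
def kLSum : (W →₀ ℤ[X]) →+ H :=
  Finsupp.liftAddHom fun y =>
    { toFun := fun f => Polynomial.aeval (LaurentPolynomial.T 2 : LaurentPolynomial ℤ) f • τ y
      map_zero' := by rw [map_zero, zero_smul]
      map_add' := fun f g => by rw [map_add, add_smul] }

variable (τ) in
/-- The bar conjugate `∑_y p_y(v⁻²) (T_{y⁻¹})⁻¹` of `∑_y p_y(v²) T_y`. -/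
def kLSumBar : (W →₀ ℤ[X]) →+ H :=
  Finsupp.liftAddHom fun y =>
    { toFun := fun f =>
        Polynomial.aeval (LaurentPolynomial.T (-2) : LaurentPolynomial ℤ) f • Ring.inverse (τ y⁻¹)
      map_zero' := by rw [map_zero, zero_smul]
      map_add' := fun f g => by rw [map_add, add_smul] }

omit [Group W] in
theorem kLSum_single (y : W) (f : ℤ[X]) : kLSum τ (Finsupp.single y f) =
    Polynomial.aeval (LaurentPolynomial.T 2 : LaurentPolynomial ℤ) f • τ y := by
  rw [kLSum, Finsupp.liftAddHom_apply_single]; rfl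

theorem kLSumBar_single (y : W) (f : ℤ[X]) : kLSumBar τ (Finsupp.single y f) =
    Polynomial.aeval (LaurentPolynomial.T (-2) : LaurentPolynomial ℤ) f •
      Ring.inverse (τ y⁻¹) := by
  rw [kLSumBar, Finsupp.liftAddHom_apply_single]; rfl

omit [Group W] in
theorem kLSum_smul (f : ℤ[X]) (p : W →₀ ℤ[X]) : kLSum τ (f • p) =
    Polynomial.aeval (LaurentPolynomial.T 2 : LaurentPolynomial ℤ) f • kLSum τ p := by
  induction p using Finsupp.induction_linear with
  | zero => simp
  | add p q hp hq => rw [smul_add, map_add, map_add, hp, hq, smul_add]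
  | single y g =>
    rw [Finsupp.smul_single, kLSum_single, kLSum_single, smul_eq_mul, map_mul, mul_smul]

theorem kLSumBar_smul (f : ℤ[X]) (p : W →₀ ℤ[X]) : kLSumBar τ (f • p) =
    Polynomial.aeval (LaurentPolynomial.T (-2) : LaurentPolynomial ℤ) f • kLSumBar τ p := by
  induction p using Finsupp.induction_linear with
  | zero => simp
  | add p q hp hq => rw [smul_add, map_add, map_add, hp, hq, smul_add]
  | single y g =>
    rw [Finsupp.smul_single, kLSumBar_single, kLSumBar_single, smul_eq_mul, map_mul, mul_smul]

variable (l) in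
open Classical in
/-- The operation on coefficient families induced by right multiplication by `T_s + 1`. -/
def mulSimpleAddOne (s : W) : (W →₀ ℤ[X]) →ₗ[ℤ[X]] (W →₀ ℤ[X]) :=
  Finsupp.linearCombination ℤ[X] fun y =>
    (if l y < l (y * s) then (1 : ℤ[X]) else Polynomial.X) •
      (Finsupp.single y 1 + Finsupp.single (y * s) 1)

theorem mulSimpleAddOne_single_of_lt {s y : W} (hy : l y < l (y * s)) :
    mulSimpleAddOne l s (Finsupp.single y 1) =
      Finsupp.single y 1 + Finsupp.single (y * s) 1 := by
  rw [mulSimpleAddOne, Finsupp.linearCombination_single, one_smul, if_pos hy, one_smul]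

theorem mulSimpleAddOne_single_of_gt {s y : W} (hy : l (y * s) < l y) :
    mulSimpleAddOne l s (Finsupp.single y 1) =
      (Polynomial.X : ℤ[X]) • (Finsupp.single y 1 + Finsupp.single (y * s) 1) := by
  rw [mulSimpleAddOne, Finsupp.linearCombination_single, one_smul, if_neg (by omega)]

omit [Group W] in
theorem finsupp_induction_single_one {M : (W →₀ ℤ[X]) → Prop}
    (h1 : ∀ y, M (Finsupp.single y 1)) (hadd : ∀ p q, M p → M q → M (p + q))
    (hsmul : ∀ (f : ℤ[X]) p, M p → M (f • p)) (h0 : M 0) (p : W →₀ ℤ[X]) : M p := by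
  induction p using Finsupp.induction_linear with
  | zero => exact h0
  | add p q hp hq => exact hadd p q hp hq
  | single y f =>
    have := hsmul f _ (h1 y)
    rwa [Finsupp.smul_single, smul_eq_mul, mul_one] at this

section Length

variable (h : IsLengthFn S Tr l)
include h

theorem mulSimpleAddOne_apply_of_gt {s y : W} (hs : s ∈ S) (hy : l (y * s) < l y)
    (p : W →₀ ℤ[X]) : mulSimpleAddOne l s p y = p (y * s) + Polynomial.X * p y := by
  induction p using finsupp_induction_single_one with
  | h0 => simp
  | hadd p q hp hq => rw [map_add, Finsupp.add_apply, hp, hq, Finsupp.add_apply,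
      Finsupp.add_apply]; ring
  | hsmul f p hp =>
    rw [map_smul, Finsupp.smul_apply, hp, Finsupp.smul_apply, Finsupp.smul_apply, smul_eq_mul,
      smul_eq_mul, smul_eq_mul]; ring
  | h1 x =>
    have hne : y * s ≠ y := fun h1 => by rw [h1] at hy; omega
    rcases h.mul_simple_lt_or_gt hs x with hx | hx
    · rw [mulSimpleAddOne_single_of_lt hx, Finsupp.add_apply]
      by_cases hxy : x = y * s
      · subst hxy
        rw [h.mul_simple_cancel hs]
        simp [Finsupp.single_eq_of_ne hne.symm]
      · have h1 : x * s ≠ y := fun h1 => hxy (by rw [← h1, h.mul_simple_cancel hs])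
        have h2 : x ≠ y := by rintro rfl; omega
        simp [h1, h2, hxy]
    · rw [mulSimpleAddOne_single_of_gt hx, Finsupp.smul_apply, Finsupp.add_apply]
      by_cases hxy : x = y
      · subst hxy
        simp [hne, hne.symm]
      · have h1 : x * s ≠ y := by
          rintro rfl
          rw [h.mul_simple_cancel hs] at hy; omega
        have h2 : x ≠ y * s := by
          rintro rfl
          rw [h.mul_simple_cancel hs] at hx; omega
        simp [h1, h2, hxy]

/-- This reflects `(T_s + 1) T_s = q (T_s + 1)`, and it is the source of the symmetry `P_{ys,w} =
P_{y,w}`. -/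
theorem mulSimpleAddOne_apply_mul {s : W} (hs : s ∈ S) (p : W →₀ ℤ[X]) (y : W) :
    mulSimpleAddOne l s p (y * s) = mulSimpleAddOne l s p y := by
  induction p using finsupp_induction_single_one with
  | h0 => simp
  | hadd p q hp hq => rw [map_add, Finsupp.add_apply, hp, hq, Finsupp.add_apply]
  | hsmul f p hp => rw [map_smul, Finsupp.smul_apply, hp, Finsupp.smul_apply]
  | h1 x =>
    have e : (Finsupp.single x 1 + Finsupp.single (x * s) 1 : W →₀ ℤ[X]) (y * s) =
        (Finsupp.single x 1 + Finsupp.single (x * s) 1 : W →₀ ℤ[X]) y := by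
      have h1 : x = y * s ↔ x * s = y := by
        constructor
        · rintro rfl; rw [h.mul_simple_cancel hs]
        · rintro rfl; rw [h.mul_simple_cancel hs]
      classical
      rw [Finsupp.add_apply, Finsupp.add_apply, Finsupp.single_apply, Finsupp.single_apply,
        Finsupp.single_apply, Finsupp.single_apply, mul_left_inj, add_comm]
      simp only [h1]
    rcases h.mul_simple_lt_or_gt hs x with hx | hx
    · rw [mulSimpleAddOne_single_of_lt hx, e]
    · rw [mulSimpleAddOne_single_of_gt hx, Finsupp.smul_apply, Finsupp.smul_apply, e]

end Length

variable (hτ : IsHeckeBasis S l (LaurentPolynomial.T 2 : LaurentPolynomial ℤ) τ)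
  (h : IsLengthFn S Tr l)
include hτ h

theorem kLSum_mulSimpleAddOne {s : W} (hs : s ∈ S) (p : W →₀ ℤ[X]) :
    kLSum τ (mulSimpleAddOne l s p) = kLSum τ p * (τ s + 1) := by
  induction p using finsupp_induction_single_one with
  | h0 => simp
  | hadd p q hp hq => rw [map_add, map_add, hp, hq, map_add, add_mul]
  | hsmul f p hp => rw [map_smul, kLSum_smul, kLSum_smul, hp, smul_mul_assoc]
  | h1 x =>
    rw [kLSum_single, map_one, one_smul, mul_add, mul_one]
    rcases h.mul_simple_lt_or_gt hs x with hx | hx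
    · rw [mulSimpleAddOne_single_of_lt hx, map_add, kLSum_single, kLSum_single, map_one, one_smul,
        one_smul, hτ.mul_simple_of_lt h hs hx, add_comm]
    · rw [mulSimpleAddOne_single_of_gt hx, kLSum_smul, map_add, kLSum_single, kLSum_single,
        map_one, one_smul, one_smul, hτ.mul_simple_of_gt h hs hx, Polynomial.aeval_X]
      module

omit h in
/-- The inverse of `T_s`. -/
theorem inverse_simple {s : W} (hs : s ∈ S) : IsUnit (τ s) ∧ Ring.inverse (τ s) =
    (LaurentPolynomial.T (-2) : LaurentPolynomial ℤ) • τ s +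
      (LaurentPolynomial.T (-2) - 1 : LaurentPolynomial ℤ) • 1 := by
  have hT : (LaurentPolynomial.T (-2) : LaurentPolynomial ℤ) * LaurentPolynomial.T 2 = 1 := by
    rw [← LaurentPolynomial.T_add]; simp
  have hss := hτ.simple_mul_simple hs
  set x : H := (LaurentPolynomial.T (-2) : LaurentPolynomial ℤ) • τ s +
      (LaurentPolynomial.T (-2) - 1 : LaurentPolynomial ℤ) • 1 with hx
  have h1 : τ s * x = 1 := by
    rw [hx, mul_add, mul_smul_comm, mul_smul_comm, mul_one, hss, smul_add, smul_smul, smul_smul,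
      mul_sub, hT, mul_one, one_smul]
    module
  have h2 : x * τ s = 1 := by
    rw [hx, add_mul, smul_mul_assoc, smul_mul_assoc, one_mul, hss, smul_add, smul_smul, smul_smul,
      mul_sub, hT, mul_one, one_smul]
    module
  let u : Hˣ := ⟨τ s, x, h1, h2⟩
  exact ⟨u.isUnit, Ring.inverse_unit u⟩

theorem isUnit_basis (w : W) : IsUnit (τ w) := by
  induction hn : l w using Nat.strong_induction_on generalizing w with
  | _ n ih =>
    by_cases h0 : l w = 0
    · have h1 : τ w * τ w⁻¹ = 1 := by
        rw [hτ.mul _ _ (by rw [mul_inv_cancel, h.one, h.inv, h0]), mul_inv_cancel, hτ.one]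
      have h2 : τ w⁻¹ * τ w = 1 := by
        rw [hτ.mul _ _ (by rw [inv_mul_cancel, h.one, h.inv, h0]), inv_mul_cancel, hτ.one]
      exact (⟨τ w, τ w⁻¹, h1, h2⟩ : Hˣ).isUnit
    · obtain ⟨s, hs, hlt⟩ := h.exists_right_descent w h0
      have : τ w = τ (w * s) * τ s := by
        rw [hτ.mul_simple_of_lt h hs (by rwa [h.mul_simple_cancel hs]), h.mul_simple_cancel hs]
      rw [this]
      exact (ih _ (by omega) _ rfl).mul (inverse_simple hτ hs).1

theorem inverse_mul_simple {s : W} (hs : s ∈ S) {y : W} (hy : l y < l (y * s)) :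
    Ring.inverse (τ (y * s)⁻¹) = Ring.inverse (τ y⁻¹) *
      ((LaurentPolynomial.T (-2) : LaurentPolynomial ℤ) • τ s +
      (LaurentPolynomial.T (-2) - 1 : LaurentPolynomial ℤ) • 1) := by
  have h1 : τ (y * s)⁻¹ = τ s * τ y⁻¹ := by
    rw [h.inv_mul_simple hs, hτ.mul]
    rw [h.length_simple hs, ← h.inv_mul_simple hs, h.inv, h.inv]
    have := h.mul_simple_of_lt hs hy
    omega
  obtain ⟨u, hu⟩ := isUnit_basis hτ h s
  obtain ⟨w, hw⟩ := isUnit_basis hτ h y⁻¹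
  rw [h1, ← (inverse_simple hτ hs).2, ← hu, ← hw, ← Units.val_mul, Ring.inverse_unit,
    Ring.inverse_unit, Ring.inverse_unit, mul_inv_rev, Units.val_mul]

/-- The bar conjugate of `T_s + 1` is `v⁻² (T_s + 1)`; equivalently, `v⁻¹ (T_s + 1)` is bar
invariant. This compatibility replaces the construction of the bar involution as a ring
homomorphism. -/
theorem kLSumBar_mulSimpleAddOne {s : W} (hs : s ∈ S) (p : W →₀ ℤ[X]) :
    kLSumBar τ (mulSimpleAddOne l s p) =
      (LaurentPolynomial.T (-2) : LaurentPolynomial ℤ) • (kLSumBar τ p * (τ s + 1)) := by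
  induction p using finsupp_induction_single_one with
  | h0 => simp
  | hadd p q hp hq => rw [map_add, map_add, hp, hq, map_add, add_mul, smul_add]
  | hsmul f p hp =>
    rw [map_smul, kLSumBar_smul, kLSumBar_smul, hp, smul_mul_assoc, smul_comm]
  | h1 x =>
    have hT : (LaurentPolynomial.T (-2) : LaurentPolynomial ℤ) * LaurentPolynomial.T 2 = 1 := by
      rw [← LaurentPolynomial.T_add]; simp
    rw [kLSumBar_single, map_one, one_smul]
    rcases h.mul_simple_lt_or_gt hs x with hx | hx
    · rw [mulSimpleAddOne_single_of_lt hx, map_add, kLSumBar_single, kLSumBar_single, map_one,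
        one_smul, one_smul, inverse_mul_simple hτ h hs hx, mul_add, mul_add, mul_smul_comm,
        mul_smul_comm, mul_one]
      module
    · have hx' := inverse_mul_simple hτ h hs (y := x * s) (by rwa [h.mul_simple_cancel hs])
      rw [h.mul_simple_cancel hs] at hx'
      rw [mulSimpleAddOne_single_of_gt hx, kLSumBar_smul, map_add, kLSumBar_single,
        kLSumBar_single, map_one, one_smul, one_smul, hx', Polynomial.aeval_X]
      have hss := hτ.simple_mul_simple hs
      generalize Ring.inverse (τ (x * s)⁻¹) = B
      -- With `q = v²`: `T_s⁻¹ (T_s + 1) = 1 + T_s⁻¹ = q⁻¹ (T_s + 1)`.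
      have key : ((LaurentPolynomial.T (-2) : LaurentPolynomial ℤ) • τ s +
          (LaurentPolynomial.T (-2) - 1 : LaurentPolynomial ℤ) • 1) * (τ s + 1) =
          (LaurentPolynomial.T (-2) : LaurentPolynomial ℤ) • (τ s + 1) := by
        rw [add_mul, mul_add, mul_one, smul_mul_assoc, hss, smul_add, smul_smul, smul_smul,
          mul_sub, hT, smul_mul_assoc, one_mul]
        module
      rw [mul_assoc B, key, mul_smul_comm, mul_add, mul_add, mul_smul_comm, mul_smul_comm, mul_one]
      module

end Generic

/-! ### Uniqueness, existence and symmetry of the Kazhdan–Lusztig polynomials. -/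

section KazhdanLusztig

variable {W : Type*} [Group W] {S Tr : Set W} {l : W → ℕ}
  {H : Type*} [Ring H] [Algebra (LaurentPolynomial ℤ) H] {τ : W → H}

/-- The family of Kazhdan-Lusztig polynomials `P_{y,w}` for `w`, in an arbitrary generic Hecke
algebra with standard basis `τ`. -/
structure IsAbstractKL (Tr : Set W) (l : W → ℕ) (τ : W → H) (w : W) (p : W →₀ ℤ[X]) : Prop where
  le_of_ne_zero : ∀ y, p y ≠ 0 → AbstractBruhatLE Tr l y w
  self : p w = 1
  degree : ∀ y, AbstractBruhatLE Tr l y w → y ≠ w → 2 * (p y).natDegree + 1 + l y ≤ l w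
  bar : (LaurentPolynomial.T (-(l w : ℤ)) : LaurentPolynomial ℤ) • kLSum τ p =
    (LaurentPolynomial.T (l w : ℤ) : LaurentPolynomial ℤ) • kLSumBar τ p

namespace IsHeckeBasis

variable {A : Type*} [CommRing A] {K : Type*} [Ring K] [Algebra A K] {q : A} {σ : W → K}
  (hσ : IsHeckeBasis S l q σ)
include hσ

/-- The standard basis as a basis. -/
def basis : Module.Basis W A K := Module.Basis.mk hσ.linearIndependent hσ.span

@[simp] theorem basis_apply (w : W) : hσ.basis w = σ w := Module.Basis.mk_apply _ _ w

theorem basis_repr (w : W) : hσ.basis.repr (σ w) = Finsupp.single w 1 := by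
  rw [← hσ.basis_apply, Module.Basis.repr_self]

end IsHeckeBasis

/-- The span of the standard basis elements of length less than `n`. -/
def lowerSpan (A : Type*) [CommRing A] {K : Type*} [Ring K] [Algebra A K] (l : W → ℕ) (σ : W → K)
    (n : ℕ) : Submodule A K := Submodule.span A (σ '' {z | l z < n})

section LowerSpan

variable {A : Type*} [CommRing A] {K : Type*} [Ring K] [Algebra A K] {q : A} {σ : W → K}

omit [Group W] in
theorem mem_lowerSpan {w : W} {n : ℕ} (hw : l w < n) : σ w ∈ lowerSpan A l σ n :=
  Submodule.subset_span ⟨w, hw, rfl⟩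

omit [Group W] in
theorem lowerSpan_mono {m n : ℕ} (hmn : m ≤ n) : lowerSpan A l σ m ≤ lowerSpan A l σ n :=
  Submodule.span_mono (Set.image_mono fun _ hz => lt_of_lt_of_le hz hmn)

theorem lowerSpan_mul_simple (hσ : IsHeckeBasis S l q σ) (h : IsLengthFn S Tr l) {s : W}
    (hs : s ∈ S) {n : ℕ} {x : K} (hx : x ∈ lowerSpan A l σ n) :
    x * σ s ∈ lowerSpan A l σ (n + 1) := by
  induction hx using Submodule.span_induction with
  | zero => rw [zero_mul]; exact zero_mem _
  | add u v _ _ hu hv => rw [add_mul]; exact add_mem hu hv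
  | smul a u _ hu => rw [smul_mul_assoc]; exact Submodule.smul_mem _ _ hu
  | mem u hu =>
    obtain ⟨w, hw, rfl⟩ := hu
    simp only [Set.mem_ofPred_eq] at hw
    rcases h.mul_simple_lt_or_gt hs w with h1 | h1
    · rw [hσ.mul_simple_of_lt h hs h1]
      have := h.mul_simple_of_lt hs h1
      exact mem_lowerSpan (by omega)
    · rw [hσ.mul_simple_of_gt h hs h1]
      exact add_mem (Submodule.smul_mem _ _ (mem_lowerSpan (by omega)))
        (Submodule.smul_mem _ _ (mem_lowerSpan (by omega)))

theorem repr_eq_zero_of_mem_lowerSpan (hσ : IsHeckeBasis S l q σ) {n : ℕ} {x : K}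
    (hx : x ∈ lowerSpan A l σ n) {y : W} (hy : n ≤ l y) : hσ.basis.repr x y = 0 := by
  induction hx using Submodule.span_induction with
  | zero => simp
  | add u v _ _ hu hv => rw [map_add, Finsupp.add_apply, hu, hv, add_zero]
  | smul a u _ hu => rw [map_smul, Finsupp.smul_apply, hu, smul_zero]
  | mem u hu =>
    obtain ⟨w, hw, rfl⟩ := hu
    simp only [Set.mem_ofPred_eq] at hw
    rw [hσ.basis_repr, Finsupp.single_eq_of_ne]
    rintro rfl
    omega

end LowerSpan

variable (hτ : IsHeckeBasis S l (LaurentPolynomial.T 2 : LaurentPolynomial ℤ) τ)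
  (h : IsLengthFn S Tr l)
include hτ h

/-- Each factor `T_s⁻¹ = q⁻¹ T_s + (q⁻¹ - 1)` contributes `q⁻¹ = v⁻²` to the leading term, and
everything else is shorter. -/
theorem inverse_sub_mem_lowerSpan (y : W) : Ring.inverse (τ y⁻¹) -
    (LaurentPolynomial.T (-(2 * (l y : ℤ))) : LaurentPolynomial ℤ) • τ y ∈
      lowerSpan (LaurentPolynomial ℤ) l τ (l y) := by
  induction hn : l y using Nat.strong_induction_on generalizing y with
  | _ n ih =>
    by_cases h0 : l y = 0
    · have h1 : τ y * τ y⁻¹ = 1 := by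
        rw [hτ.mul _ _ (by rw [mul_inv_cancel, h.one, h.inv, h0]), mul_inv_cancel, hτ.one]
      have h2 : τ y⁻¹ * τ y = 1 := by
        rw [hτ.mul _ _ (by rw [inv_mul_cancel, h.one, h.inv, h0]), inv_mul_cancel, hτ.one]
      let u : Hˣ := ⟨τ y⁻¹, τ y, h2, h1⟩
      have h3 : Ring.inverse (τ y⁻¹) = τ y := Ring.inverse_unit u
      have h4 : n = 0 := by omega
      rw [h3, h4]
      simp
    · obtain ⟨s, hs, hlt⟩ := h.exists_right_descent y h0
      obtain ⟨x, rfl⟩ : ∃ x, y = x * s := ⟨y * s, (h.mul_simple_cancel hs y).symm⟩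
      rw [h.mul_simple_cancel hs] at hlt
      have h1 := h.mul_simple_of_lt hs hlt
      have h2 := ih (l x) (by omega) x rfl
      rw [inverse_mul_simple hτ h hs hlt, ← hτ.mul_simple_of_lt h hs hlt]
      set B := Ring.inverse (τ x⁻¹)
      set D := B - (LaurentPolynomial.T (-(2 * (l x : ℤ))) : LaurentPolynomial ℤ) • τ x
      have hB : B = D + (LaurentPolynomial.T (-(2 * (l x : ℤ))) : LaurentPolynomial ℤ) • τ x := by
        simp [D]
      have hT : (LaurentPolynomial.T (-(2 * (n : ℤ))) : LaurentPolynomial ℤ) =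
          LaurentPolynomial.T (-2) * LaurentPolynomial.T (-(2 * (l x : ℤ))) := by
        rw [← LaurentPolynomial.T_add]
        congr 1
        have : (n : ℤ) = l x + 1 := by exact_mod_cast (by omega)
        rw [this]; ring
      have : B * ((LaurentPolynomial.T (-2) : LaurentPolynomial ℤ) • τ s +
          (LaurentPolynomial.T (-2) - 1 : LaurentPolynomial ℤ) • 1) -
          (LaurentPolynomial.T (-(2 * (n : ℤ))) : LaurentPolynomial ℤ) • (τ x * τ s) =
          (LaurentPolynomial.T (-2) : LaurentPolynomial ℤ) • (D * τ s) +
            (LaurentPolynomial.T (-2) - 1 : LaurentPolynomial ℤ) • (D +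
              (LaurentPolynomial.T (-(2 * (l x : ℤ))) : LaurentPolynomial ℤ) • τ x) := by
        rw [hT, hB, mul_add, mul_smul_comm, mul_smul_comm, mul_one, add_mul, smul_mul_assoc]
        module
      rw [this]
      refine add_mem (Submodule.smul_mem _ _ ?_) (Submodule.smul_mem _ _ (add_mem ?_
        (Submodule.smul_mem _ _ (mem_lowerSpan (by omega)))))
      · exact lowerSpan_mono (by omega) (lowerSpan_mul_simple hτ h hs h2)
      · exact lowerSpan_mono (by omega) h2

omit h in
theorem repr_kLSum (p : W →₀ ℤ[X]) (y : W) : hτ.basis.repr (kLSum τ p) y =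
    Polynomial.aeval (LaurentPolynomial.T 2 : LaurentPolynomial ℤ) (p y) := by
  induction p using Finsupp.induction_linear with
  | zero => simp
  | add p q hp hq => rw [map_add, map_add, Finsupp.add_apply, hp, hq, Finsupp.add_apply, map_add]
  | single z g =>
    rw [kLSum_single, map_smul, hτ.basis_repr, Finsupp.smul_apply]
    by_cases hzy : z = y
    · subst hzy; simp
    · simp [Finsupp.single_eq_of_ne (Ne.symm hzy)]

theorem repr_kLSumBar {p : W →₀ ℤ[X]} {y : W} (hp : ∀ z, p z ≠ 0 → l z ≤ l y) :
    hτ.basis.repr (kLSumBar τ p) y =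
      Polynomial.aeval (LaurentPolynomial.T (-2) : LaurentPolynomial ℤ) (p y) *
        LaurentPolynomial.T (-(2 * (l y : ℤ))) := by
  have key : ∀ z, l z ≤ l y → ∀ f : ℤ[X], hτ.basis.repr (kLSumBar τ (Finsupp.single z f)) y =
      Polynomial.aeval (LaurentPolynomial.T (-2) : LaurentPolynomial ℤ) (Finsupp.single z f y) *
        LaurentPolynomial.T (-(2 * (l y : ℤ))) := by
    intro z hz f
    have h1 := repr_eq_zero_of_mem_lowerSpan hτ (inverse_sub_mem_lowerSpan hτ h z) hz
    rw [map_sub, Finsupp.sub_apply, sub_eq_zero, map_smul, hτ.basis_repr, Finsupp.smul_apply] at h1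
    rw [kLSumBar_single, map_smul, Finsupp.smul_apply, h1]
    by_cases hzy : z = y
    · subst hzy; simp
    · simp [Finsupp.single_eq_of_ne (Ne.symm hzy)]
  have h2 : p = ∑ z ∈ p.support, Finsupp.single z (p z) := (Finsupp.sum_single p).symm
  have h3 : hτ.basis.repr (kLSumBar τ p) y =
      ∑ z ∈ p.support, hτ.basis.repr (kLSumBar τ (Finsupp.single z (p z))) y := by
    conv_lhs => rw [h2]
    rw [map_sum, map_sum, Finsupp.finsetSum_apply]
  rw [h3, Finset.sum_congr rfl fun z hz => key z (hp z (Finsupp.mem_support_iff.1 hz)) (p z),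
    ← Finset.sum_mul, ← map_sum]
  congr 2
  conv_rhs => rw [h2]
  rw [Finsupp.finsetSum_apply]

/-- At a longest `y` with `d y ≠ 0`, only `y` contributes to the coefficient on the bar side, so
`v^{-n} d_y(v²) = v^{n - 2 l(y)} d_y(v⁻²)`. The degree bound rules this out. Applied to a difference
of two solutions, it gives uniqueness. -/
theorem kLSum_ext {d : W →₀ ℤ[X]} {n : ℕ}
    (hbar : (LaurentPolynomial.T (-(n : ℤ)) : LaurentPolynomial ℤ) • kLSum τ d =
      (LaurentPolynomial.T (n : ℤ) : LaurentPolynomial ℤ) • kLSumBar τ d)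
    (hdeg : ∀ y, d y ≠ 0 → 2 * (d y).natDegree + 1 + l y ≤ n) : d = 0 := by
  by_contra hd
  obtain ⟨y, hy, hmax⟩ := Finset.exists_max_image d.support l
    (Finsupp.support_nonempty_iff.2 hd)
  rw [Finsupp.mem_support_iff] at hy
  have h1 := congrArg (fun x => hτ.basis.repr x y) hbar
  simp only [map_smul, Finsupp.smul_apply] at h1
  rw [repr_kLSum hτ, repr_kLSumBar hτ h fun z hz => hmax z (Finsupp.mem_support_iff.2 hz),
    smul_eq_mul, smul_eq_mul, mul_left_comm, mul_comm (Polynomial.aeval _ _),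
    ← LaurentPolynomial.T_add] at h1
  refine hy (eq_zero_of_T_mul_eq h1 ?_)
  have := hdeg y hy
  omega

theorem IsAbstractKL.unique {w : W} {p p' : W →₀ ℤ[X]} (hp : IsAbstractKL Tr l τ w p)
    (hp' : IsAbstractKL Tr l τ w p') : p = p' := by
  rw [← sub_eq_zero]
  refine kLSum_ext hτ h (n := l w) ?_ ?_
  · rw [map_sub, map_sub, smul_sub, smul_sub, hp.bar, hp'.bar]
  · intro y hy
    rw [Finsupp.sub_apply] at hy ⊢
    have hyw : y ≠ w := by
      rintro rfl
      rw [hp.self, hp'.self, sub_self] at hy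
      exact hy rfl
    have hle : AbstractBruhatLE Tr l y w := by
      by_cases h0 : p y = 0
      · refine hp'.le_of_ne_zero y fun h1 => hy ?_
        rw [h0, h1, sub_zero]
      · exact hp.le_of_ne_zero y h0
    have h1 := hp.degree y hle hyw
    have h2 := hp'.degree y hle hyw
    have h3 := Polynomial.natDegree_sub_le (p y) (p' y)
    rcases max_choice (p y).natDegree (p' y).natDegree with h4 | h4 <;> rw [h4] at h3 <;> omega

theorem isAbstractKL_of_length_eq_zero {w : W} (hw : l w = 0) :
    IsAbstractKL Tr l τ w (Finsupp.single w 1) where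
  le_of_ne_zero y hy := by
    by_cases hyw : y = w
    · subst hyw; exact .refl
    · exact absurd (Finsupp.single_eq_of_ne hyw) hy
  self := Finsupp.single_eq_same
  degree y hy hne := by have := hy.length_lt hne; omega
  bar := by
    have h1 : τ w * τ w⁻¹ = 1 := by
      rw [hτ.mul _ _ (by rw [mul_inv_cancel, h.one, h.inv, hw]), mul_inv_cancel, hτ.one]
    have h2 : τ w⁻¹ * τ w = 1 := by
      rw [hτ.mul _ _ (by rw [inv_mul_cancel, h.one, h.inv, hw]), inv_mul_cancel, hτ.one]
    let u : Hˣ := ⟨τ w⁻¹, τ w, h2, h1⟩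
    have h3 : Ring.inverse (τ w⁻¹) = τ w := Ring.inverse_unit u
    rw [kLSum_single, kLSumBar_single, hw, h3]
    simp

omit hτ h in
/-- The coefficient `μ(z, u)`, as a function of the lengths and of the polynomial `P_{z,u}`. -/
def muCoeff (l : W → ℕ) (p : W →₀ ℤ[X]) (u z : W) : ℤ :=
  -- With truncated operations, the test says that `l u - l z` is positive and odd; the index read
  -- off is then `(l u - l z - 1) / 2`, the largest degree allowed to `P_{z,u}`.
  if 2 * ((l u - l z) / 2) + 1 + l z = l u then (p z).coeff ((l u - l z) / 2) else 0

open Classical in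
omit hτ h in
/-- The recursive construction of the Kazhdan-Lusztig polynomials for `u s` from those for `u` and
the shorter elements. -/
def kLStep (l : W → ℕ) (K : W → W →₀ ℤ[X]) (u s : W) : W →₀ ℤ[X] :=
  mulSimpleAddOne l s (K u) - ∑ z ∈ (K u).support.filter fun z => l (z * s) < l z,
    -- For odd `l u - l z` the exponent is `(l u + 1 - l z) / 2`, which converts the bar
    -- normalisation of `z` into that of `u s`.
    (Polynomial.C (muCoeff l (K u) u z) * Polynomial.X ^ ((l u - l z) / 2 + 1)) • K z

section Step

variable {K : W → W →₀ ℤ[X]} {u s : W} (hs : s ∈ S) (hus : l u < l (u * s))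
  (hK : ∀ z, l z ≤ l u → IsAbstractKL Tr l τ z (K z))
include hs hus hK

omit hτ h hs in
theorem le_and_ne_of_mem_support {z : W} (hz : z ∈ (K u).support) (hzs : l (z * s) < l z) :
    AbstractBruhatLE Tr l z u ∧ l z < l u := by
  have h1 := (hK u le_rfl).le_of_ne_zero z (Finsupp.mem_support_iff.1 hz)
  refine ⟨h1, h1.length_lt ?_⟩
  rintro rfl
  omega

omit hτ in
-- In the degrees forbidden to `P_{y,us}`, the product with `T_s + 1` can only have the coefficient
-- `μ(y, u)` of `q P_{y,u}`. The corrections with `z ≠ y` vanish in these degrees, and the one with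
-- `z = y` cancels it.
theorem kLStep_coeff_eq_zero {y : W} (hy : l (y * s) < l y) (hne : y ≠ u * s) {j : ℕ}
    (hj : l u + 1 ≤ 2 * j + l y) : (kLStep l K u s y).coeff j = 0 := by
  classical
  have hyu : y ≠ u := by rintro rfl; omega
  have hysu : y * s ≠ u := by
    rintro rfl
    exact hne (h.mul_simple_cancel hs y).symm
  have hl := h.mul_simple_of_gt hs hy
  have hKu := hK u le_rfl
  have c1 : (K u (y * s)).coeff j = 0 := by
    by_cases h0 : K u (y * s) = 0
    · rw [h0, Polynomial.coeff_zero]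
    · apply Polynomial.coeff_eq_zero_of_natDegree_lt
      have := hKu.degree _ (hKu.le_of_ne_zero _ h0) hysu
      omega
  have c2 : (Polynomial.X * K u y).coeff j =
      if j = (l u - l y) / 2 + 1 then muCoeff l (K u) u y else 0 := by
    cases j with
    | zero => simp
    | succ j =>
      rw [Polynomial.coeff_X_mul]
      by_cases h0 : K u y = 0
      · simp [muCoeff, h0]
      · have h1 := hKu.degree _ (hKu.le_of_ne_zero _ h0) hyu
        by_cases hjd : (K u y).natDegree < j
        · rw [Polynomial.coeff_eq_zero_of_natDegree_lt hjd]
          split_ifs with h2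
          · rw [muCoeff, ← Nat.succ_injective h2,
              Polynomial.coeff_eq_zero_of_natDegree_lt hjd, ite_self]
          · rfl
        · have h2 : j = (l u - l y) / 2 := by omega
          rw [if_pos (by omega), muCoeff, if_pos (by omega), h2]
  have c3 : ∀ z ∈ (K u).support.filter (fun z => l (z * s) < l z), z ≠ y →
      ((Polynomial.C (muCoeff l (K u) u z) * Polynomial.X ^ ((l u - l z) / 2 + 1)) *
        K z y).coeff j = 0 := by
    intro z hz hzy
    rw [Finset.mem_filter] at hz
    have hzu := le_and_ne_of_mem_support hus hK hz.1 hz.2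
    by_cases h0 : K z y = 0
    · rw [h0, mul_zero, Polynomial.coeff_zero]
    · have hKz := hK z hzu.2.le
      have h1 := hKz.degree y (hKz.le_of_ne_zero _ h0) (Ne.symm hzy)
      rw [mul_assoc, Polynomial.coeff_C_mul, Polynomial.coeff_X_pow_mul']
      by_cases h2 : 2 * ((l u - l z) / 2) + 1 + l z = l u
      · split_ifs with h3
        · rw [Polynomial.coeff_eq_zero_of_natDegree_lt (by omega), mul_zero]
        · rw [mul_zero]
      · rw [muCoeff, if_neg h2, zero_mul]
  have c4 : (∑ z ∈ (K u).support.filter (fun z => l (z * s) < l z),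
      ((Polynomial.C (muCoeff l (K u) u z) * Polynomial.X ^ ((l u - l z) / 2 + 1)) *
        K z y).coeff j) = if j = (l u - l y) / 2 + 1 then muCoeff l (K u) u y else 0 := by
    by_cases hyZ : y ∈ (K u).support.filter (fun z => l (z * s) < l z)
    · rw [Finset.sum_eq_single_of_mem y hyZ fun z hz hzy => c3 z hz hzy]
      rw [Finset.mem_filter] at hyZ
      have hyu' := le_and_ne_of_mem_support hus hK hyZ.1 hyZ.2
      rw [(hK y hyu'.2.le).self, mul_one, Polynomial.coeff_C_mul, Polynomial.coeff_X_pow]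
      split_ifs <;> simp
    · rw [Finset.sum_eq_zero fun z hz => c3 z hz (by rintro rfl; exact hyZ hz)]
      have h0 : K u y = 0 := by
        by_contra h0
        exact hyZ (Finset.mem_filter.2 ⟨Finsupp.mem_support_iff.2 h0, hy⟩)
      simp [muCoeff, h0]
  rw [kLStep, Finsupp.sub_apply, Finsupp.finsetSum_apply, Polynomial.coeff_sub,
    mulSimpleAddOne_apply_of_gt h hs hy, Polynomial.coeff_add, c1, c2, Polynomial.finsetSum_coeff]
  simp only [Finsupp.smul_apply, smul_eq_mul]
  rw [c4, zero_add, sub_self]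

omit hτ in
theorem kLStep_le_of_ne_zero {y : W} (hy : kLStep l K u s y ≠ 0) :
    AbstractBruhatLE Tr l y (u * s) := by
  classical
  have hu := bruhatLE_mul_simple h hs hus
  have hKu := hK u le_rfl
  have key : ∀ y, K u y ≠ 0 → AbstractBruhatLE Tr l y (u * s) ∧
      AbstractBruhatLE Tr l (y * s) (u * s) := fun y hy =>
    ⟨(hKu.le_of_ne_zero y hy).trans hu, (hKu.le_of_ne_zero y hy).mul_simple h hs hus⟩
  by_cases h1 : mulSimpleAddOne l s (K u) y = 0
  · rw [kLStep, Finsupp.sub_apply, h1, Finsupp.finsetSum_apply, zero_sub, neg_ne_zero] at hy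
    obtain ⟨z, hz, hzy⟩ := Finset.exists_ne_zero_of_sum_ne_zero hy
    rw [Finset.mem_filter] at hz
    have hzu := le_and_ne_of_mem_support hus hK hz.1 hz.2
    rw [Finsupp.smul_apply] at hzy
    have h2 : K z y ≠ 0 := fun h2 => hzy (by rw [h2, smul_zero])
    exact (((hK z hzu.2.le).le_of_ne_zero y h2).trans hzu.1).trans hu
  · by_contra hcon
    have h2 : K u y = 0 := by
      by_contra h2
      exact hcon (key y h2).1
    have h3 : K u (y * s) = 0 := by
      by_contra h3
      have := (key _ h3).2
      rw [h.mul_simple_cancel hs] at this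
      exact hcon this
    apply h1
    rcases h.mul_simple_lt_or_gt hs y with h4 | h4
    · rw [← mulSimpleAddOne_apply_mul h hs, mulSimpleAddOne_apply_of_gt h hs
        (by rwa [h.mul_simple_cancel hs]), h.mul_simple_cancel hs, h2, h3, mul_zero, add_zero]
    · rw [mulSimpleAddOne_apply_of_gt h hs h4, h2, h3, mul_zero, add_zero]

omit hτ in
theorem kLStep_apply_mul
    (hKs : ∀ z, l z ≤ l u → l (z * s) < l z → ∀ y, K z (y * s) = K z y) (y : W) :
    kLStep l K u s (y * s) = kLStep l K u s y := by
  classical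
  rw [kLStep, Finsupp.sub_apply, Finsupp.sub_apply, mulSimpleAddOne_apply_mul h hs,
    Finsupp.finsetSum_apply, Finsupp.finsetSum_apply]
  congr 1
  refine Finset.sum_congr rfl fun z hz => ?_
  rw [Finset.mem_filter] at hz
  have hzu := le_and_ne_of_mem_support hus hK hz.1 hz.2
  rw [Finsupp.smul_apply, Finsupp.smul_apply, hKs z hzu.2.le hz.2]

omit hτ in
theorem kLStep_self : kLStep l K u s (u * s) = 1 := by
  classical
  have hlt : ∀ z, l z ≤ l u → K z (u * s) = 0 := by
    intro z hz
    by_contra h0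
    have := ((hK z hz).le_of_ne_zero _ h0).eq_or_length_lt
    rcases this with h1 | h1
    · rw [h1] at hus; omega
    · omega
  rw [kLStep, Finsupp.sub_apply, mulSimpleAddOne_apply_of_gt h hs
    (by rwa [h.mul_simple_cancel hs]), h.mul_simple_cancel hs, (hK u le_rfl).self,
    hlt u le_rfl, mul_zero, add_zero, Finsupp.finsetSum_apply, Finset.sum_eq_zero, sub_zero]
  intro z hz
  rw [Finset.mem_filter] at hz
  have hzu := le_and_ne_of_mem_support hus hK hz.1 hz.2
  rw [Finsupp.smul_apply, hlt z hzu.2.le, smul_zero]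

/-- Both `v⁻¹ (T_s + 1)` and the normalised elements of the `z` are bar invariant, and `v^{-l(us)}
q^{(l(u) + 1 - l(z))/2} = v^{-l(z)}`. -/
theorem kLStep_bar :
    (LaurentPolynomial.T (-(l (u * s) : ℤ)) : LaurentPolynomial ℤ) • kLSum τ (kLStep l K u s) =
    (LaurentPolynomial.T (l (u * s) : ℤ) : LaurentPolynomial ℤ) • kLSumBar τ (kLStep l K u s) := by
  classical
  have hl := h.mul_simple_of_lt hs hus
  rw [kLStep, map_sub, map_sub, smul_sub, smul_sub, kLSum_mulSimpleAddOne hτ h hs,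
    kLSumBar_mulSimpleAddOne hτ h hs, map_sum, map_sum, Finset.smul_sum, Finset.smul_sum]
  congr 1
  · rw [smul_smul, ← LaurentPolynomial.T_add, ← smul_mul_assoc, ← smul_mul_assoc]
    have e1 : (LaurentPolynomial.T (-(l (u * s) : ℤ)) : LaurentPolynomial ℤ) • kLSum τ (K u) =
        (LaurentPolynomial.T (-1) : LaurentPolynomial ℤ) •
          (LaurentPolynomial.T (-(l u : ℤ)) : LaurentPolynomial ℤ) • kLSum τ (K u) := by
      rw [smul_smul, ← LaurentPolynomial.T_add, hl]
      congr 2; push_cast; ring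
    rw [e1, (hK u le_rfl).bar, smul_smul, ← LaurentPolynomial.T_add, hl]
    congr 3; push_cast; ring
  · refine Finset.sum_congr rfl fun z hz => ?_
    rw [Finset.mem_filter] at hz
    have hzu := le_and_ne_of_mem_support hus hK hz.1 hz.2
    rw [kLSum_smul, kLSumBar_smul]
    by_cases h0 : 2 * ((l u - l z) / 2) + 1 + l z = l u
    · have h1 : (l (u * s) : ℤ) = l z + 2 * ((l u - l z) / 2 + 1 : ℕ) := by
        rw [hl]; push_cast; omega
      generalize (l u - l z) / 2 + 1 = e at h1
      simp only [map_mul, Polynomial.aeval_C, map_pow, Polynomial.aeval_X, LaurentPolynomial.T_pow]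
      have e1 : -(l (u * s) : ℤ) + e * 2 = -(l z : ℤ) := by rw [h1]; ring
      have e2 : (l (u * s) : ℤ) + e * (-2) = l z := by rw [h1]; ring
      rw [smul_smul, smul_smul, mul_left_comm, mul_left_comm (LaurentPolynomial.T (l (u * s) : ℤ)),
        ← LaurentPolynomial.T_add, ← LaurentPolynomial.T_add, e1, e2, mul_smul, mul_smul,
        (hK z hzu.2.le).bar]
    · rw [muCoeff, if_neg h0]
      simp

/-- The cancellation of top coefficients bounds the degree when `y s < y`. For other `y` the
symmetry passes to the longer element `y s`, where the bound is stronger; the exception `y s = u s`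
has polynomial `1`. -/
theorem isAbstractKL_kLStep
    (hKs : ∀ z, l z ≤ l u → l (z * s) < l z → ∀ y, K z (y * s) = K z y) :
    IsAbstractKL Tr l τ (u * s) (kLStep l K u s) where
  le_of_ne_zero y hy := kLStep_le_of_ne_zero h hs hus hK hy
  self := kLStep_self h hs hus hK
  bar := kLStep_bar hτ h hs hus hK
  degree y hy hne := by
    have hl := h.mul_simple_of_lt hs hus
    have hlt := hy.length_lt hne
    have key : ∀ y, l (y * s) < l y → y ≠ u * s → kLStep l K u s y ≠ 0 →
        2 * (kLStep l K u s y).natDegree + 1 + l y ≤ l (u * s) := by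
      intro y hy hne h0
      by_contra hcon
      refine h0 (Polynomial.leadingCoeff_eq_zero.1
        (kLStep_coeff_eq_zero h hs hus hK hy hne ?_))
      omega
    by_cases h0 : kLStep l K u s y = 0
    · rw [h0, Polynomial.natDegree_zero]; omega
    rcases h.mul_simple_lt_or_gt hs y with h1 | h1
    · have h2 := kLStep_apply_mul h hs hus hK hKs y
      by_cases h3 : y * s = u * s
      · rw [← h2, h3, kLStep_self h hs hus hK, Polynomial.natDegree_one]; omega
      · have h4 := key (y * s) (by rwa [h.mul_simple_cancel hs]) h3 (by rwa [h2])
        rw [h2] at h4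
        omega
    · exact key y h1 hne h0

end Step

/-- The recursion through a descent `s` yields a family symmetric under that `s`. By uniqueness all
descents of `w` yield the same family, so it is symmetric under each of them. The symmetry must be
part of the induction because the degree bound uses it. -/
theorem exists_isAbstractKL (w : W) : ∃ p, IsAbstractKL Tr l τ w p ∧
    ∀ s ∈ S, l (w * s) < l w → ∀ y, p (y * s) = p y := by
  induction hn : l w using Nat.strong_induction_on generalizing w with
  | _ n ih =>
    -- The recursion takes a total function `K`; elements of length at least `n` get the value `0`,
    -- which plays no role.
    have ih' : ∀ z, ∃ p, l z < n → IsAbstractKL Tr l τ z p ∧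
        ∀ s ∈ S, l (z * s) < l z → ∀ y, p (y * s) = p y := by
      intro z
      by_cases hz : l z < n
      · obtain ⟨p, hp⟩ := ih _ hz z rfl
        exact ⟨p, fun _ => hp⟩
      · exact ⟨0, fun h1 => absurd h1 hz⟩
    choose K hK using ih'
    have step : ∀ s ∈ S, l (w * s) < l w → ∃ p, IsAbstractKL Tr l τ w p ∧
        ∀ y, p (y * s) = p y := by
      intro s hs hws
      have hus : l (w * s) < l (w * s * s) := by rwa [h.mul_simple_cancel hs]
      have h1 : ∀ z, l z ≤ l (w * s) → IsAbstractKL Tr l τ z (K z) :=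
        fun z hz => (hK z (by omega)).1
      have h2 : ∀ z, l z ≤ l (w * s) → l (z * s) < l z → ∀ y, K z (y * s) = K z y :=
        fun z hz hzs => (hK z (by omega)).2 s hs hzs
      have h3 := isAbstractKL_kLStep hτ h hs hus h1 h2
      rw [h.mul_simple_cancel hs] at h3
      exact ⟨_, h3, kLStep_apply_mul h hs hus h1 h2⟩
    by_cases h0 : l w = 0
    · exact ⟨_, isAbstractKL_of_length_eq_zero hτ h h0, fun s _ hws => by omega⟩
    · obtain ⟨s, hs, hws⟩ := h.exists_right_descent w h0
      obtain ⟨p, hp, -⟩ := step s hs hws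
      refine ⟨p, hp, fun t ht hwt => ?_⟩
      obtain ⟨p', hp', hp's⟩ := step t ht (hn ▸ hwt)
      rw [hp.unique hτ h hp']
      exact hp's

end KazhdanLusztig

/-! ### Coefficients of products with `T_s` on either side. -/

section Multiplication

variable {W : Type*} [Group W] {S Tr S₀ : Set W} {l : W → ℕ} {A : Type*} [CommRing A]
  {H : Type*} [Ring H] [Algebra A H] {q : A} {τ : W → H}

theorem IsHeckeFamily.simple_mul_of_lt (hτ : IsHeckeFamily S l q τ) (h : IsLengthFn S Tr l)
    {s : W} (hs : s ∈ S) {x : W} (hx : l x < l (s * x)) : τ s * τ x = τ (s * x) :=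
  hτ.mul _ _ (by rw [h.length_simple hs]; have := h.simple_mul s hs x; omega)

theorem IsHeckeFamily.simple_mul_of_gt (hτ : IsHeckeFamily S l q τ) (h : IsLengthFn S Tr l)
    {s : W} (hs : s ∈ S) {x : W} (hx : l (s * x) < l x) :
    τ s * τ x = (q - 1) • τ x + q • τ (s * x) := by
  have hx' : τ x = τ s * τ (s * x) := by
    rw [hτ.simple_mul_of_lt h hs (by rwa [h.simple_mul_cancel hs]), h.simple_mul_cancel hs]
  rw [hx', ← mul_assoc, hτ.simple_mul_simple hs, add_mul, smul_mul_assoc, smul_mul_assoc, one_mul]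

namespace IsHeckeBasis

variable (hτ : IsHeckeBasis S l q τ) (h : IsLengthFn S Tr l)

theorem induction_on {M : H → Prop} (h1 : ∀ w, M (τ w)) (h0 : M 0)
    (hadd : ∀ x y, M x → M y → M (x + y)) (hsmul : ∀ (a : A) x, M x → M (a • x))
    (hτ : IsHeckeBasis S l q τ) (x : H) : M x := by
  have hx : x ∈ Submodule.span A (Set.range τ) := hτ.span trivial
  induction hx using Submodule.span_induction with
  | zero => exact h0
  | add u v _ _ hu hv => exact hadd u v hu hv
  | smul a u _ hu => exact hsmul a u hu
  | mem u hu => obtain ⟨w, rfl⟩ := hu; exact h1 w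

theorem ext_repr {x y : H} (hxy : ∀ w, hτ.basis.repr x w = hτ.basis.repr y w) : x = y :=
  hτ.basis.repr.injective (Finsupp.ext hxy)

include h

theorem repr_mul_simple_of_lt {s : W} (hs : s ∈ S) {y : W} (hy : l y < l (y * s)) (x : H) :
    hτ.basis.repr (x * τ s) y = q * hτ.basis.repr x (y * s) := by
  classical
  induction x using induction_on (hτ := hτ) with
  | h0 => simp
  | hadd u v hu hv => simp only [add_mul, map_add, Finsupp.add_apply, hu, hv, mul_add]
  | hsmul a u hu =>
    simp only [smul_mul_assoc, map_smul, Finsupp.smul_apply, hu, smul_eq_mul]; ring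
  | h1 w =>
    rcases h.mul_simple_lt_or_gt hs w with hw | hw
    · rw [hτ.mul_simple_of_lt h hs hw, hτ.basis_repr, hτ.basis_repr, Finsupp.single_eq_of_ne,
        Finsupp.single_eq_of_ne, mul_zero]
      · rintro rfl; rw [h.mul_simple_cancel hs] at hw; omega
      · rintro rfl; rw [h.mul_simple_cancel hs] at hy; omega
    · rw [hτ.mul_simple_of_gt h hs hw, map_add, map_smul, map_smul, hτ.basis_repr, hτ.basis_repr,
        Finsupp.add_apply, Finsupp.smul_apply, Finsupp.smul_apply, Finsupp.single_eq_of_ne (by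
          rintro rfl; omega), smul_zero, zero_add, smul_eq_mul]
      congr 1
      by_cases hyw : y = w * s
      · subst hyw; simp [h.mul_simple_cancel hs]
      · rw [Finsupp.single_eq_of_ne hyw, Finsupp.single_eq_of_ne]
        rintro rfl; exact hyw (h.mul_simple_cancel hs y).symm

theorem repr_mul_simple_of_gt {s : W} (hs : s ∈ S) {y : W} (hy : l (y * s) < l y) (x : H) :
    hτ.basis.repr (x * τ s) y =
      hτ.basis.repr x (y * s) + (q - 1) * hτ.basis.repr x y := by
  classical
  induction x using induction_on (hτ := hτ) with
  | h0 => simp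
  | hadd u v hu hv => simp only [add_mul, map_add, Finsupp.add_apply, hu, hv, mul_add]; ring
  | hsmul a u hu =>
    simp only [smul_mul_assoc, map_smul, Finsupp.smul_apply, hu, smul_eq_mul]; ring
  | h1 w =>
    rcases h.mul_simple_lt_or_gt hs w with hw | hw
    · rw [hτ.mul_simple_of_lt h hs hw, hτ.basis_repr, hτ.basis_repr,
        Finsupp.single_eq_of_ne (a := w) (a' := y) (by rintro rfl; omega), mul_zero, add_zero]
      by_cases hyw : y = w * s
      · subst hyw; simp [h.mul_simple_cancel hs]
      · rw [Finsupp.single_eq_of_ne hyw, Finsupp.single_eq_of_ne]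
        rintro rfl; exact hyw (h.mul_simple_cancel hs y).symm
    · rw [hτ.mul_simple_of_gt h hs hw, map_add, map_smul, map_smul, hτ.basis_repr, hτ.basis_repr,
        Finsupp.add_apply, Finsupp.smul_apply, Finsupp.smul_apply,
        Finsupp.single_eq_of_ne (a := w * s) (by
          rintro rfl; rw [h.mul_simple_cancel hs] at hy; omega), smul_zero, add_zero,
        Finsupp.single_eq_of_ne (a := w) (a' := y * s) (by
          rintro rfl; rw [h.mul_simple_cancel hs] at hw; omega), zero_add, smul_eq_mul]

theorem repr_simple_mul_of_lt {s : W} (hs : s ∈ S) {y : W} (hy : l y < l (s * y)) (x : H) :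
    hτ.basis.repr (τ s * x) y = q * hτ.basis.repr x (s * y) := by
  classical
  induction x using induction_on (hτ := hτ) with
  | h0 => simp
  | hadd u v hu hv => simp only [mul_add, map_add, Finsupp.add_apply, hu, hv]
  | hsmul a u hu =>
    simp only [mul_smul_comm, map_smul, Finsupp.smul_apply, hu, smul_eq_mul]; ring
  | h1 w =>
    rcases h.simple_mul_lt_or_gt hs w with hw | hw
    · rw [hτ.simple_mul_of_lt h hs hw, hτ.basis_repr, hτ.basis_repr, Finsupp.single_eq_of_ne,
        Finsupp.single_eq_of_ne, mul_zero]
      · rintro rfl; rw [h.simple_mul_cancel hs] at hw; omega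
      · rintro rfl; rw [h.simple_mul_cancel hs] at hy; omega
    · rw [hτ.simple_mul_of_gt h hs hw, map_add, map_smul, map_smul, hτ.basis_repr, hτ.basis_repr,
        Finsupp.add_apply, Finsupp.smul_apply, Finsupp.smul_apply, Finsupp.single_eq_of_ne (by
          rintro rfl; omega), smul_zero, zero_add, smul_eq_mul]
      congr 1
      by_cases hyw : y = s * w
      · subst hyw; simp [h.simple_mul_cancel hs]
      · rw [Finsupp.single_eq_of_ne hyw, Finsupp.single_eq_of_ne]
        rintro rfl; exact hyw (h.simple_mul_cancel hs y).symm

theorem repr_simple_mul_of_gt {s : W} (hs : s ∈ S) {y : W} (hy : l (s * y) < l y) (x : H) :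
    hτ.basis.repr (τ s * x) y =
      hτ.basis.repr x (s * y) + (q - 1) * hτ.basis.repr x y := by
  classical
  induction x using induction_on (hτ := hτ) with
  | h0 => simp
  | hadd u v hu hv => simp only [mul_add, map_add, Finsupp.add_apply, hu, hv]; ring
  | hsmul a u hu =>
    simp only [mul_smul_comm, map_smul, Finsupp.smul_apply, hu, smul_eq_mul]; ring
  | h1 w =>
    rcases h.simple_mul_lt_or_gt hs w with hw | hw
    · rw [hτ.simple_mul_of_lt h hs hw, hτ.basis_repr, hτ.basis_repr,
        Finsupp.single_eq_of_ne (a := w) (a' := y) (by rintro rfl; omega), mul_zero, add_zero]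
      by_cases hyw : y = s * w
      · subst hyw; simp [h.simple_mul_cancel hs]
      · rw [Finsupp.single_eq_of_ne hyw, Finsupp.single_eq_of_ne]
        rintro rfl; exact hyw (h.simple_mul_cancel hs y).symm
    · rw [hτ.simple_mul_of_gt h hs hw, map_add, map_smul, map_smul, hτ.basis_repr, hτ.basis_repr,
        Finsupp.add_apply, Finsupp.smul_apply, Finsupp.smul_apply,
        Finsupp.single_eq_of_ne (a := s * w) (by
          rintro rfl; rw [h.simple_mul_cancel hs] at hy; omega), smul_zero, add_zero,
        Finsupp.single_eq_of_ne (a := w) (a' := s * y) (by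
          rintro rfl; rw [h.simple_mul_cancel hs] at hw; omega), zero_add, smul_eq_mul]

end IsHeckeBasis

end Multiplication

/-! ### Symmetric families, eigenideals, and the annihilator of the longest element. -/

section Ideals

variable {W : Type*} [Group W] {S Tr S₀ : Set W} {l : W → ℕ} {k : Type*} [Field k]
  {H : Type*} [Ring H] [Algebra k H] {q r r' : k} {τ : W → H}

/-- A family `D` of elements of a Hecke algebra which is unitriangular up to scalars with respect to
the standard basis and satisfies `D_w T_s = q r D_w` for `w s < w`. -/
structure IsSymmetricFamily (hτ : IsHeckeBasis S l q τ) (r : k) (D : W → H) : Prop where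
  self_ne_zero : ∀ w, hτ.basis.repr (D w) w ≠ 0
  eq_or_lt : ∀ w y, hτ.basis.repr (D w) y ≠ 0 → y = w ∨ l y < l w
  mul_simple : ∀ w, ∀ s ∈ S, l (w * s) < l w → ∀ y, l y < l (y * s) →
    hτ.basis.repr (D w) (y * s) = r * hτ.basis.repr (D w) y

/-- The left ideal of elements `x` with `x T_s = q r x`. -/
def eigenIdeal (q : k) (τ : W → H) (r : k) (s : W) : Submodule H H where
  carrier := {x | x * τ s = (q * r) • x}
  zero_mem' := by simp
  add_mem' {x y} hx hy := by
    change x * τ s = (q * r) • x at hx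
    change y * τ s = (q * r) • y at hy
    change (x + y) * τ s = (q * r) • (x + y)
    rw [add_mul, hx, hy, smul_add]
  smul_mem' c x hx := by
    change x * τ s = (q * r) • x at hx
    change (c * x) * τ s = (q * r) • (c * x)
    rw [mul_assoc, hx, mul_smul_comm]

omit [Group W] in
theorem mem_eigenIdeal {s : W} {x : H} : x ∈ eigenIdeal q τ r s ↔ x * τ s = (q * r) • x := Iff.rfl

variable (hτ : IsHeckeBasis S l q τ) (h : IsLengthFn S Tr l)

/-- A set of basis elements is spanned triangularly. -/
theorem le_span_of_triangular {D : W → H} (hne : ∀ w, hτ.basis.repr (D w) w ≠ 0)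
    (hlt : ∀ w y, hτ.basis.repr (D w) y ≠ 0 → y = w ∨ l y < l w)
    {X : Set W} {E : Submodule k H} (hDE : ∀ w ∈ X, D w ∈ E)
    (hX : ∀ x ∈ E, ∀ y, hτ.basis.repr x y ≠ 0 →
      (∀ z, hτ.basis.repr x z ≠ 0 → l z ≤ l y) → y ∈ X) :
    E ≤ Submodule.span k (D '' X) := by
  have key : ∀ n : ℕ, ∀ x ∈ E, (∀ z, hτ.basis.repr x z ≠ 0 → l z < n) →
      x ∈ Submodule.span k (D '' X) := by
    intro n
    induction n with
    | zero =>
      intro x _ hx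
      have : x = 0 := hτ.ext_repr fun w => by
        rw [map_zero, Finsupp.zero_apply]
        by_contra h0
        exact absurd (hx w h0) (Nat.not_lt_zero _)
      rw [this]
      exact zero_mem _
    | succ n ih =>
      intro x hxE hx
      -- Subtracting multiples of the `D y` cancels the terms of the top length `n`; the difference
      -- stays in `E` and has only shorter terms.
      let F := (hτ.basis.repr x).support.filter fun y => l y = n
      have hF : ∀ y ∈ F, y ∈ X := by
        intro y hy
        rw [Finset.mem_filter, Finsupp.mem_support_iff] at hy
        refine hX x hxE y hy.1 fun z hz => ?_
        have := hx z hz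
        omega
      let a : W → k := fun y => hτ.basis.repr x y / hτ.basis.repr (D y) y
      have hsumE : ∑ y ∈ F, a y • D y ∈ E :=
        Submodule.sum_mem _ fun y hy => E.smul_mem _ (hDE y (hF y hy))
      have hsumS : ∑ y ∈ F, a y • D y ∈ Submodule.span k (D '' X) :=
        Submodule.sum_mem _ fun y hy =>
          Submodule.smul_mem _ _ (Submodule.subset_span ⟨y, hF y hy, rfl⟩)
      have h1 := ih (x - ∑ y ∈ F, a y • D y) (sub_mem hxE hsumE) (by
        intro z hz
        by_contra hzn
        apply hz
        rw [map_sub, Finsupp.sub_apply, map_sum, Finsupp.finsetSum_apply]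
        have h2 : ∀ y ∈ F, y ≠ z → hτ.basis.repr (a y • D y) z = 0 := by
          intro y hy hyz
          rw [Finset.mem_filter] at hy
          rw [map_smul, Finsupp.smul_apply]
          by_cases h0 : hτ.basis.repr (D y) z = 0
          · rw [h0, smul_zero]
          · rcases hlt y z h0 with h3 | h3
            · exact absurd h3.symm hyz
            · omega
        by_cases hzF : z ∈ F
        · rw [Finset.sum_eq_single_of_mem z hzF h2, map_smul, Finsupp.smul_apply, smul_eq_mul,
            div_mul_cancel₀ _ (hne z), sub_self]
        · rw [Finset.sum_eq_zero fun y hy => h2 y hy (by rintro rfl; exact hzF hy), sub_zero]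
          by_contra h0
          have := hx z h0
          exact hzF (Finset.mem_filter.2 ⟨Finsupp.mem_support_iff.2 h0, by omega⟩))
      have := add_mem h1 hsumS
      rwa [sub_add_cancel] at this
  intro x hx
  refine key ((hτ.basis.repr x).support.sup l + 1) x hx fun z hz => ?_
  exact Nat.lt_succ_of_le (Finset.le_sup (f := l) (Finsupp.mem_support_iff.2 hz))

include h

/-- Comparing coefficients at the shorter element of a pair `y < y s` gives the ratio `r`; at the
longer one the comparison reduces to the quadratic relation for `q r`. -/
theorem mem_eigenIdeal_iff (hq : q ≠ 0) (hr : (q * r + 1) * (r - 1) = 0) {s : W} (hs : s ∈ S)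
    {x : H} : x ∈ eigenIdeal q τ r s ↔
      ∀ y, l y < l (y * s) → hτ.basis.repr x (y * s) = r * hτ.basis.repr x y := by
  rw [mem_eigenIdeal]
  constructor
  · intro hx y hy
    have := congrArg (fun z => hτ.basis.repr z y) hx
    simp only [map_smul, Finsupp.smul_apply, smul_eq_mul,
      hτ.repr_mul_simple_of_lt h hs hy, mul_assoc] at this
    exact mul_left_cancel₀ hq this
  · intro hx
    refine hτ.ext_repr fun y => ?_
    rw [map_smul, Finsupp.smul_apply, smul_eq_mul]
    rcases h.mul_simple_lt_or_gt hs y with hy | hy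
    · rw [hτ.repr_mul_simple_of_lt h hs hy, hx y hy, mul_assoc]
    · have h1 := hx (y * s) (by rwa [h.mul_simple_cancel hs])
      rw [h.mul_simple_cancel hs] at h1
      rw [hτ.repr_mul_simple_of_gt h hs hy, h1]
      linear_combination (-hτ.basis.repr x (y * s)) * hr

/-- On a pair `y < y s` the element `x` is a multiple of `T_y + r T_{ys}`, which equals `r T_y (T_s
- q r')` because `q r r' = -1`. This also covers the case of equal roots, where an argument by
diagonalisation would fail. -/
theorem exists_mul_sub_eq (hrr' : q * r * r' = -1) {s : W} (hs : s ∈ S) {x : H}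
    (hx : ∀ y, l y < l (y * s) → hτ.basis.repr x (y * s) = r * hτ.basis.repr x y) :
    ∃ g : H, x = g * (τ s - (q * r') • 1) := by
  classical
  refine ⟨hτ.basis.repr.symm ((r • hτ.basis.repr x).filter fun y => l y < l (y * s)),
    hτ.ext_repr fun y => ?_⟩
  rw [mul_sub, mul_smul_comm, mul_one, map_sub, map_smul, Finsupp.sub_apply, Finsupp.smul_apply]
  rcases h.mul_simple_lt_or_gt hs y with hy | hy
  · rw [hτ.repr_mul_simple_of_lt h hs hy, LinearEquiv.apply_symm_apply,
      Finsupp.filter_apply_neg _ _ (by rw [h.mul_simple_cancel hs]; omega),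
      Finsupp.filter_apply_pos (fun y => l y < l (y * s)) _ hy, Finsupp.smul_apply, smul_eq_mul,
      smul_eq_mul]
    linear_combination (hτ.basis.repr x y) * hrr'
  · have h1 := hx (y * s) (by rwa [h.mul_simple_cancel hs])
    rw [h.mul_simple_cancel hs] at h1
    rw [hτ.repr_mul_simple_of_gt h hs hy, LinearEquiv.apply_symm_apply,
      Finsupp.filter_apply_neg (a := y) _ _ (by omega),
      Finsupp.filter_apply_pos _ _ (by rwa [h.mul_simple_cancel hs]), Finsupp.smul_apply, h1]
    simp

section Family

variable {D : W → H} (hD : IsSymmetricFamily hτ r D)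
include hD

theorem IsSymmetricFamily.mem_eigenIdeal (hq : q ≠ 0) (hr : (q * r + 1) * (r - 1) = 0) {s w : W}
    (hs : s ∈ S) (hw : l (w * s) < l w) : D w ∈ eigenIdeal q τ r s :=
  (mem_eigenIdeal_iff hτ h hq hr hs).2 (hD.mul_simple w s hs hw)

/-- The simultaneous eigenspace of a set of simple reflections is spanned by the `D_w` it
contains. -/
theorem IsSymmetricFamily.le_span (hq : q ≠ 0) (hr : (q * r + 1) * (r - 1) = 0) (hr0 : r ≠ 0)
    {J : Set W} (hJ : J ⊆ S) {x : H} (hx : ∀ s ∈ J, x ∈ eigenIdeal q τ r s) :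
    x ∈ Submodule.span k (D '' {w | ∀ s ∈ J, l (w * s) < l w}) := by
  let E : Submodule k H := ⨅ s ∈ J, (eigenIdeal q τ r s).restrictScalars k
  have hE : ∀ x, x ∈ E ↔ ∀ s ∈ J, x ∈ eigenIdeal q τ r s := by
    intro x
    simp [E, Submodule.mem_iInf]
  refine le_span_of_triangular (E := E) hτ hD.self_ne_zero hD.eq_or_lt ?_ ?_ ((hE x).2 hx)
  · intro w hw
    exact (hE _).2 fun s hs => hD.mem_eigenIdeal hτ h hq hr (hJ hs) (hw s hs)
  · intro x hx y hy hmax s hs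
    -- At a longest element `y` of the support every `s ∈ J` is a descent: otherwise the coefficient
    -- at the longer `y s` would be `r` times a nonzero one.
    rcases h.mul_simple_lt_or_gt (hJ hs) y with h1 | h1
    · have h2 := (mem_eigenIdeal_iff hτ h hq hr (hJ hs)).1 ((hE x).1 hx s hs) y h1
      have := hmax (y * s) (by rw [h2]; exact mul_ne_zero hr0 hy)
      omega
    · exact h1

theorem IsSymmetricFamily.mul_mem_span_forall (hq : q ≠ 0) (hr : (q * r + 1) * (r - 1) = 0)
    (hr0 : r ≠ 0) (hS₀ : S₀ ⊆ S) (c : H) {x : H}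
    (hx : x ∈ Submodule.span k (D '' {w | ∀ s ∈ S₀, l (w * s) < l w})) :
    c * x ∈ Submodule.span k (D '' {w | ∀ s ∈ S₀, l (w * s) < l w}) := by
  induction hx using Submodule.span_induction with
  | zero => rw [mul_zero]; exact zero_mem _
  | add u v _ _ hu hv => rw [mul_add]; exact add_mem hu hv
  | smul a u _ hu => rw [mul_smul_comm]; exact Submodule.smul_mem _ _ hu
  | mem u hu =>
    obtain ⟨w, hw, rfl⟩ := hu
    exact hD.le_span hτ h hq hr hr0 hS₀ fun s hs =>
      Submodule.smul_mem _ c (hD.mem_eigenIdeal hτ h hq hr (hS₀ hs) (hw s hs))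

theorem IsSymmetricFamily.mem_span_exists (hq : q ≠ 0) (hr : (q * r + 1) * (r - 1) = 0)
    (hr0 : r ≠ 0) (hS₀ : S₀ ⊆ S) {s : W} (hs : s ∈ S₀) {x : H}
    (hx : x ∈ eigenIdeal q τ r s) :
    x ∈ Submodule.span k (D '' {w | ∃ s ∈ S₀, l (w * s) < l w}) := by
  have := hD.le_span hτ h hq hr hr0 (J := {s}) (Set.singleton_subset_iff.2 (hS₀ hs)) (x := x)
    (fun t ht => by rw [Set.mem_singleton_iff.1 ht]; exact hx)
  exact Submodule.span_mono (Set.image_mono (t := {w | ∃ s ∈ S₀, l (w * s) < l w})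
    fun w (hw : ∀ t ∈ ({s} : Set W), l (w * t) < l w) => ⟨s, hs, hw s rfl⟩) this

/-- Each generator lies in the eigenideal of some `s ∈ S₀`, and that left ideal is contained in the
span. -/
theorem IsSymmetricFamily.mul_mem_span_exists (hq : q ≠ 0) (hr : (q * r + 1) * (r - 1) = 0)
    (hr0 : r ≠ 0) (hS₀ : S₀ ⊆ S) (c : H) {x : H}
    (hx : x ∈ Submodule.span k (D '' {w | ∃ s ∈ S₀, l (w * s) < l w})) :
    c * x ∈ Submodule.span k (D '' {w | ∃ s ∈ S₀, l (w * s) < l w}) := by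
  induction hx using Submodule.span_induction with
  | zero => rw [mul_zero]; exact zero_mem _
  | add u v _ _ hu hv => rw [mul_add]; exact add_mem hu hv
  | smul a u _ hu => rw [mul_smul_comm]; exact Submodule.smul_mem _ _ hu
  | mem u hu =>
    obtain ⟨w, ⟨s, hs, hw⟩, rfl⟩ := hu
    exact hD.mem_span_exists hτ h hq hr hr0 hS₀ hs
      (Submodule.smul_mem _ c (hD.mem_eigenIdeal hτ h hq hr (hS₀ hs) hw))

/-- The left ideal spanned by the `D_w` having some right descent in `S₀`. -/
def IsSymmetricFamily.descentIdeal (hq : q ≠ 0) (hr : (q * r + 1) * (r - 1) = 0)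
    (hr0 : r ≠ 0) (hS₀ : S₀ ⊆ S) : Submodule H H :=
  { Submodule.span k (D '' {w | ∃ s ∈ S₀, l (w * s) < l w}) with
    smul_mem' := fun c _ hx => hD.mul_mem_span_exists hτ h hq hr hr0 hS₀ c hx }

/-- The left ideal spanned by the `D_w` having all of `S₀` as right descents. -/
def IsSymmetricFamily.fullDescentIdeal (hq : q ≠ 0) (hr : (q * r + 1) * (r - 1) = 0)
    (hr0 : r ≠ 0) (hS₀ : S₀ ⊆ S) : Submodule H H :=
  { Submodule.span k (D '' {w | ∀ s ∈ S₀, l (w * s) < l w}) with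
    smul_mem' := fun c _ hx => hD.mul_mem_span_forall hτ h hq hr hr0 hS₀ c hx }

end Family

section Longest

variable (hS₀ : S₀ ⊆ S) {w₀ : W} (hw₀ : w₀ ∈ Subgroup.closure S₀)
  (hmax : ∀ u ∈ Subgroup.closure S₀, l u ≤ l w₀)

include hmax hw₀ hS₀ in
theorem longest_mul_simple_lt {s : W} (hs : s ∈ S₀) : l (w₀ * s) < l w₀ := by
  have h1 := hmax _ (mul_mem hw₀ (Subgroup.subset_closure hs))
  have := h.mul_simple (hS₀ hs) w₀
  omega

/-- Coefficients along a coset of the parabolic subgroup differ by powers of the nonzero `r`. -/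
theorem repr_ne_zero_mul (hr0 : r ≠ 0) {x : H}
    (hx : ∀ s ∈ S₀, ∀ y, l y < l (y * s) → hτ.basis.repr x (y * s) = r * hτ.basis.repr x y)
    (hS₀ : S₀ ⊆ S) (y : W) {u : W} (hu : u ∈ Subgroup.closure S₀) :
    hτ.basis.repr x (y * u) ≠ 0 ↔ hτ.basis.repr x y ≠ 0 := by
  have step : ∀ y, ∀ s ∈ S₀, (hτ.basis.repr x (y * s) ≠ 0 ↔ hτ.basis.repr x y ≠ 0) := by
    intro y s hs
    rcases h.mul_simple_lt_or_gt (hS₀ hs) y with h1 | h1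
    · rw [hx s hs y h1]
      simp [hr0]
    · have h2 := hx s hs (y * s) (by rwa [h.mul_simple_cancel (hS₀ hs)])
      rw [h.mul_simple_cancel (hS₀ hs)] at h2
      rw [h2]
      simp [hr0]
  induction hu using Subgroup.closure_induction_right with
  | one => rw [mul_one]
  | mul_right a ha s hs ih => rw [← mul_assoc]; exact (step _ s hs).trans ih
  | mul_inv_cancel a ha s hs ih => 
    rw [h.simple_inv (hS₀ hs), ← mul_assoc]; exact (step _ s hs).trans ih

/-- The symmetry expresses the coefficient at a non-minimal element as `r` times one at a shorter
element of the same coset. -/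
theorem eq_zero_of_repr_min_eq_zero {x : H}
    (hx : ∀ s ∈ S₀, ∀ y, l y < l (y * s) → hτ.basis.repr x (y * s) = r * hτ.basis.repr x y)
    (hS₀ : S₀ ⊆ S)
    (hmin : ∀ d, (∀ s ∈ S₀, l d < l (d * s)) → hτ.basis.repr x d = 0) : x = 0 := by
  refine hτ.ext_repr fun y => ?_
  rw [map_zero, Finsupp.zero_apply]
  induction hn : l y using Nat.strong_induction_on generalizing y with
  | _ n ih =>
    by_cases hy : ∀ s ∈ S₀, l y < l (y * s)
    · exact hmin y hy
    · push Not at hy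
      obtain ⟨s, hs, hle⟩ := hy
      have h1 := h.mul_simple (hS₀ hs) y
      have h2 := hx s hs (y * s) (by rw [h.mul_simple_cancel (hS₀ hs)]; omega)
      rw [h.mul_simple_cancel (hS₀ hs)] at h2
      rw [h2, ih (l (y * s)) (by omega) _ rfl, mul_zero]

variable {D : W → H} (hD : IsSymmetricFamily hτ r D)
include hS₀ hw₀ hmax hD

theorem repr_longest_mul_simple : ∀ s ∈ S₀, ∀ y, l y < l (y * s) →
    hτ.basis.repr (D w₀) (y * s) = r * hτ.basis.repr (D w₀) y :=
  fun s hs => hD.mul_simple w₀ s (hS₀ hs) (longest_mul_simple_lt h hS₀ hw₀ hmax hs)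

/-- A nonzero coefficient on the coset of a minimal `d` forces one at `d w₀`, of length `l d + l
w₀`. Triangularity allows this only if `d w₀ = w₀`. -/
theorem mem_closure_of_repr_longest_ne_zero (hr0 : r ≠ 0) {y : W}
    (hy : hτ.basis.repr (D w₀) y ≠ 0) : y ∈ Subgroup.closure S₀ := by
  obtain ⟨d, u, hd, hu, rfl⟩ := h.exists_min_mul hS₀ y
  have hsym := repr_longest_mul_simple hτ h hS₀ hw₀ hmax hD
  rw [repr_ne_zero_mul hτ h hr0 hsym hS₀ d hu,
    ← repr_ne_zero_mul hτ h hr0 hsym hS₀ d hw₀] at hy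
  have h1 := hD.eq_or_lt _ _ hy
  have h2 := h.length_mul_of_min hS₀ hd hw₀
  rcases h1 with h1 | h1
  · rw [mul_eq_right] at h1
    rwa [h1, one_mul]
  · omega

theorem repr_longest_one_ne_zero (hr0 : r ≠ 0) : hτ.basis.repr (D w₀) 1 ≠ 0 := by
  have hsym := repr_longest_mul_simple hτ h hS₀ hw₀ hmax hD
  rw [← repr_ne_zero_mul hτ h hr0 hsym hS₀ 1 hw₀, one_mul]
  exact hD.self_ne_zero w₀

theorem repr_longest_eq_pow {u : W} (hu : u ∈ Subgroup.closure S₀) :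
    hτ.basis.repr (D w₀) u = r ^ l u * hτ.basis.repr (D w₀) 1 := by
  have hsym := repr_longest_mul_simple hτ h hS₀ hw₀ hmax hD
  induction hn : l u using Nat.strong_induction_on generalizing u with
  | _ n ih =>
    by_cases hu1 : u = 1
    · subst hu1
      rw [h.one] at hn
      rw [← hn, pow_zero, one_mul]
    · obtain ⟨s, hs, hlt⟩ := h.exists_right_descent_of_mem_closure hS₀ hu hu1
      have h1 := h.mul_simple_of_gt (hS₀ hs) hlt
      have h2 := hsym s hs (u * s) (by rwa [h.mul_simple_cancel (hS₀ hs)])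
      rw [h.mul_simple_cancel (hS₀ hs)] at h2
      rw [h2, ih _ (by omega) (mul_mem hu (Subgroup.subset_closure hs)) rfl, ← hn, ← h1, pow_succ]
      ring

/-- On the parabolic subgroup the coefficients `r ^ l u`, up to a common scalar, depend only on the
length. They therefore have the same symmetry on the left, and the right eigenvector is also a left
one. -/
theorem simple_mul_longest (hr0 : r ≠ 0) (hr : (q * r + 1) * (r - 1) = 0) {s : W}
    (hs : s ∈ S₀) : τ s * D w₀ = (q * r) • D w₀ := by
  have hs' := Subgroup.subset_closure hs
  refine hτ.ext_repr fun y => ?_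
  rw [map_smul, Finsupp.smul_apply, smul_eq_mul]
  by_cases hy : y ∈ Subgroup.closure S₀
  · have e1 := repr_longest_eq_pow hτ h hS₀ hw₀ hmax hD hy
    have e2 := repr_longest_eq_pow hτ h hS₀ hw₀ hmax hD (mul_mem hs' hy)
    rcases h.simple_mul_lt_or_gt (hS₀ hs) y with h1 | h1
    · have h2 : l (s * y) = l y + 1 := by have := h.simple_mul s (hS₀ hs) y; omega
      rw [hτ.repr_simple_mul_of_lt h (hS₀ hs) h1, e1, e2, h2, pow_succ]
      ring
    · have h2 : l y = l (s * y) + 1 := by have := h.simple_mul s (hS₀ hs) y; omega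
      rw [hτ.repr_simple_mul_of_gt h (hS₀ hs) h1, e1, e2, h2, pow_succ]
      linear_combination (-r ^ l (s * y) * hτ.basis.repr (D w₀) 1) * hr
  · have e0 : ∀ z, z ∉ Subgroup.closure S₀ → hτ.basis.repr (D w₀) z = 0 := by
      intro z hz
      by_contra h0
      exact hz (mem_closure_of_repr_longest_ne_zero hτ h hS₀ hw₀ hmax hD hr0 h0)
    have hsy : s * y ∉ Subgroup.closure S₀ := by
      rwa [Subgroup.mul_mem_cancel_left _ hs']
    rcases h.simple_mul_lt_or_gt (hS₀ hs) y with h1 | h1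
    · rw [hτ.repr_simple_mul_of_lt h (hS₀ hs) h1, e0 _ hy, e0 _ hsy, mul_zero, mul_zero]
    · rw [hτ.repr_simple_mul_of_gt h (hS₀ hs) h1, e0 _ hy, e0 _ hsy]
      ring

/-- The product is supported on the coset of `d'`, whose only minimal representative is `d'`. -/
theorem repr_min_mul_longest (hr0 : r ≠ 0) {d d' : W} (hd : ∀ s ∈ S₀, l d < l (d * s))
    (hd' : ∀ s ∈ S₀, l d' < l (d' * s)) : hτ.basis.repr (τ d' * D w₀) d =
      Finsupp.single d' 1 d * hτ.basis.repr (D w₀) 1 := by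
  classical
  have e1 : D w₀ = ∑ u ∈ (hτ.basis.repr (D w₀)).support, hτ.basis.repr (D w₀) u • τ u := by
    conv_lhs => rw [← hτ.basis.linearCombination_repr (D w₀)]
    rw [Finsupp.linearCombination_apply, Finsupp.sum]
    simp only [hτ.basis_apply]
  have e2 : τ d' * D w₀ =
      ∑ u ∈ (hτ.basis.repr (D w₀)).support, hτ.basis.repr (D w₀) u • τ (d' * u) := by
    conv_lhs => rw [e1]
    rw [Finset.mul_sum]
    refine Finset.sum_congr rfl fun u hu => ?_
    rw [mul_smul_comm, hτ.mul]
    exact h.length_mul_of_min hS₀ hd' (mem_closure_of_repr_longest_ne_zero hτ h hS₀ hw₀ hmax hD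
      hr0 (Finsupp.mem_support_iff.1 hu))
  have h1 := repr_longest_one_ne_zero hτ h hS₀ hw₀ hmax hD hr0
  rw [e2, map_sum, Finsupp.finsetSum_apply, Finset.sum_eq_single 1]
  · rw [map_smul, Finsupp.smul_apply, mul_one, hτ.basis_repr, smul_eq_mul, mul_comm]
  · intro u hu hu1
    rw [map_smul, Finsupp.smul_apply, hτ.basis_repr, Finsupp.single_eq_of_ne, smul_zero]
    intro hdu
    have := h.min_mul_unique hS₀ hd hd' (one_mem _) (mem_closure_of_repr_longest_ne_zero hτ h hS₀
      hw₀ hmax hD hr0 (Finsupp.mem_support_iff.1 hu)) (by rw [mul_one]; exact hdu)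
    exact hu1 this.2.symm
  · intro hu
    exact absurd (Finsupp.mem_support_iff.2 h1) hu

/-- The coefficients of `g D_{w₀}` at minimal coset representatives, if `g` is supported on
these. -/
theorem repr_sum_mul_longest (hr0 : r ≠ 0) {f : W →₀ k}
    (hf : ∀ d, f d ≠ 0 → ∀ s ∈ S₀, l d < l (d * s)) {d : W} (hd : ∀ s ∈ S₀, l d < l (d * s)) :
    hτ.basis.repr (hτ.basis.repr.symm f * D w₀) d = f d * hτ.basis.repr (D w₀) 1 := by
  have e1 : hτ.basis.repr.symm f = ∑ u ∈ f.support, f u • τ u := by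
    rw [Module.Basis.repr_symm_apply, Finsupp.linearCombination_apply, Finsupp.sum]
    simp only [hτ.basis_apply]
  rw [e1, Finset.sum_mul, map_sum, Finsupp.finsetSum_apply,
    Finset.sum_congr rfl fun u hu => by
      rw [smul_mul_assoc, map_smul, Finsupp.smul_apply, repr_min_mul_longest hτ h hS₀ hw₀ hmax hD
        hr0 hd (hf u (Finsupp.mem_support_iff.1 hu)), smul_eq_mul, ← mul_assoc],
    ← Finset.sum_mul]
  congr 1
  classical
  simp only [Finsupp.single_apply, mul_ite, mul_one, mul_zero, Finset.sum_ite_eq',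
    Finsupp.mem_support_iff]
  split_ifs with h1
  · rfl
  · exact (not_not.1 h1).symm

theorem exists_eq_mul_longest (hq : q ≠ 0) (hr0 : r ≠ 0) (hr : (q * r + 1) * (r - 1) = 0) {x : H}
    (hx : ∀ s ∈ S₀, x ∈ eigenIdeal q τ r s) : ∃ g, x = g * D w₀ := by
  classical
  have h1 := repr_longest_one_ne_zero hτ h hS₀ hw₀ hmax hD hr0
  -- The coefficients of `x` at minimal representatives, divided by that of `D w₀` at `1`: then `x -
  -- g * D w₀` vanishes at all minimal representatives.
  let f : W →₀ k := ((hτ.basis.repr (D w₀) 1)⁻¹ • hτ.basis.repr x).filter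
    fun d => ∀ s ∈ S₀, l d < l (d * s)
  have hf : ∀ d, f d ≠ 0 → ∀ s ∈ S₀, l d < l (d * s) := by
    intro d h0
    by_contra hd
    exact h0 (Finsupp.filter_apply_neg _ _ hd)
  refine ⟨hτ.basis.repr.symm f, ?_⟩
  rw [← sub_eq_zero]
  refine eq_zero_of_repr_min_eq_zero (r := r) (S₀ := S₀) hτ h (fun s hs => ?_) hS₀ fun d hd => ?_
  · rw [← mem_eigenIdeal_iff hτ h hq hr (hS₀ hs)]
    exact sub_mem (hx s hs) (Submodule.smul_mem _ _ (hD.mem_eigenIdeal hτ h hq hr (hS₀ hs)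
      (longest_mul_simple_lt h hS₀ hw₀ hmax hs)))
  · rw [map_sub, Finsupp.sub_apply, repr_sum_mul_longest hτ h hS₀ hw₀ hmax hD hr0 hf hd,
      Finsupp.filter_apply_pos _ _ hd, Finsupp.smul_apply, smul_eq_mul, mul_comm _⁻¹,
      inv_mul_cancel_right₀ h1, sub_self]

omit hw₀ hmax in
/-- Modulo the left ideal of elements with a descent in `S₀`, the Hecke algebra is spanned by the
minimal coset representatives. -/
theorem exists_sub_mem_span (hq : q ≠ 0) (hr : (q * r + 1) * (r - 1) = 0)
    (hr0 : r ≠ 0) (x : H) :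
    ∃ f : W →₀ k, (∀ d, f d ≠ 0 → ∀ s ∈ S₀, l d < l (d * s)) ∧
      x - hτ.basis.repr.symm f ∈ Submodule.span k (D '' {w | ∃ s ∈ S₀, l (w * s) < l w}) := by
  classical
  induction x using IsHeckeBasis.induction_on (hτ := hτ) with
  | h0 => exact ⟨0, by simp, by simp⟩
  | hadd x y hx hy =>
    obtain ⟨f, hf, hf'⟩ := hx
    obtain ⟨g, hg, hg'⟩ := hy
    refine ⟨f + g, fun d hd => ?_, ?_⟩
    · by_cases h0 : f d = 0
      · refine hg d fun h1 => hd ?_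
        rw [Finsupp.add_apply, h0, h1, add_zero]
      · exact hf d h0
    · rw [map_add, add_sub_add_comm]
      exact add_mem hf' hg'
  | hsmul a x hx =>
    obtain ⟨f, hf, hf'⟩ := hx
    refine ⟨a • f, fun d hd => hf d fun h1 => hd ?_, ?_⟩
    · rw [Finsupp.smul_apply, h1, smul_zero]
    · rw [map_smul, ← smul_sub]
      exact Submodule.smul_mem _ _ hf'
  | h1 w =>
    induction hn : l w using Nat.strong_induction_on generalizing w with
    | _ n ih =>
      by_cases hw : ∀ s ∈ S₀, l w < l (w * s)
      · refine ⟨Finsupp.single w 1, fun d hd => ?_, ?_⟩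
        · by_cases hdw : d = w
          · rwa [hdw]
          · exact absurd (Finsupp.single_eq_of_ne hdw) hd
        · rw [← hτ.basis_repr, LinearEquiv.symm_apply_apply, sub_self]
          exact zero_mem _
      · push Not at hw
        obtain ⟨s, hs, hle⟩ := hw
        have hm := h.mul_simple (hS₀ hs) w
        obtain ⟨f, hf, hf'⟩ := ih (l (w * s)) (by omega) (w * s) rfl
        refine ⟨(-r⁻¹) • f, fun d hd => hf d fun h1 => hd ?_, ?_⟩
        · rw [Finsupp.smul_apply, h1, smul_zero]
        · have hmem : τ (w * s) + r • τ w ∈ eigenIdeal q τ r s := by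
            have e1 : τ (w * s) * τ s = τ w := by
              rw [hτ.mul_simple_of_lt h (hS₀ hs) (by rw [h.mul_simple_cancel (hS₀ hs)]; omega),
                h.mul_simple_cancel (hS₀ hs)]
            have e2 := hτ.mul_simple_of_gt h (hS₀ hs) (x := w) (by omega)
            rw [mem_eigenIdeal, add_mul, smul_mul_assoc, e1, e2]
            have e3 : (1 + r * (q - 1)) = q * r * r := by linear_combination -hr
            have e4 : τ w + r • ((q - 1) • τ w + q • τ (w * s)) =
                (1 + r * (q - 1)) • τ w + (r * q) • τ (w * s) := by module
            rw [e4, e3]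
            module
          have h2 := hD.mem_span_exists hτ h hq hr hr0 hS₀ hs hmem
          have h3 : τ w - hτ.basis.repr.symm ((-r⁻¹) • f) =
              r⁻¹ • (τ (w * s) + r • τ w) + (-r⁻¹) • (τ (w * s) - hτ.basis.repr.symm f) := by
            rw [map_smul, smul_add, smul_smul, inv_mul_cancel₀ hr0]
            module
          rw [h3]
          exact add_mem (Submodule.smul_mem _ _ h2) (Submodule.smul_mem _ _ hf')

end Longest

section Duality

variable {D D' : W → H} (hD : IsSymmetricFamily hτ r D) (hD' : IsSymmetricFamily hτ r' D')
  (hq : q ≠ 0) (hr : (q * r + 1) * (r - 1) = 0) (hr' : (q * r' + 1) * (r' - 1) = 0)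
  (hrr' : q * r * r' = -1)
  (hS₀ : S₀ ⊆ S) {w₀ : W} (hw₀ : w₀ ∈ Subgroup.closure S₀)
  (hmax : ∀ u ∈ Subgroup.closure S₀, l u ≤ l w₀)
include hD hD' hq hr hr' hrr' hS₀ hw₀ hmax

/-- A generator with descent `s` factors as `g (T_s - q r')`, and the second factor kills the left
eigenvector `D' w₀`. Conversely, modulo the span `x` is a combination of `T_d` with `d` minimal; the
coefficient of its product with `D' w₀` at each `d` is a nonzero multiple of that of `T_d`, so the
combination is zero. -/
theorem mul_longest_eq_zero_iff (x : H) : x * D' w₀ = 0 ↔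
    x ∈ Submodule.span k (D '' {w | ∃ s ∈ S₀, l (w * s) < l w}) := by
  have hr0 : r ≠ 0 := by rintro rfl; simp at hrr'
  have hr0' : r' ≠ 0 := by rintro rfl; simp at hrr'
  have hker : ∀ x ∈ Submodule.span k (D '' {w | ∃ s ∈ S₀, l (w * s) < l w}), x * D' w₀ = 0 := by
    intro x hx
    induction hx using Submodule.span_induction with
    | zero => rw [zero_mul]
    | add u v _ _ hu hv => rw [add_mul, hu, hv, add_zero]
    | smul a u _ hu => rw [smul_mul_assoc, hu, smul_zero]
    | mem u hu =>
      obtain ⟨w, ⟨s, hs, hw⟩, rfl⟩ := hu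
      obtain ⟨g, hg⟩ := exists_mul_sub_eq hτ h hrr' (hS₀ hs) (hD.mul_simple w s (hS₀ hs) hw)
      rw [hg, mul_assoc, sub_mul, simple_mul_longest hτ h hS₀ hw₀ hmax hD' hr0' hr' hs,
        smul_mul_assoc, one_mul, sub_self, mul_zero]
  refine ⟨fun hx => ?_, hker x⟩
  obtain ⟨f, hf, hmem⟩ := exists_sub_mem_span hτ h hS₀ hD hq hr hr0 x
  have h1 := hker _ hmem
  rw [sub_mul, hx, zero_sub, neg_eq_zero] at h1
  have h2 : f = 0 := by
    ext d
    rw [Finsupp.zero_apply]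
    by_contra h0
    have h3 := repr_sum_mul_longest hτ h hS₀ hw₀ hmax hD' hr0' hf (hf d h0)
    rw [h1, map_zero, Finsupp.zero_apply] at h3
    exact mul_ne_zero h0 (repr_longest_one_ne_zero hτ h hS₀ hw₀ hmax hD' hr0') h3.symm
  rwa [h2, map_zero, sub_zero] at hmem

/-- Right multiplication by `D'_{w₀}` identifies the quotient of `H` by the span of the `D_w` with
some descent in `S₀` with the left ideal generated by `D'_{w₀}`, which is the span of the `D'_w`
with all descents in `S₀`. -/
theorem exists_ideals : ∃ I M' : Submodule H H,
    I.restrictScalars k = Submodule.span k (D '' {w | ∃ s ∈ S₀, l (w * s) < l w}) ∧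
    M'.restrictScalars k = Submodule.span k (D' '' {w | ∀ s ∈ S₀, l (w * s) < l w}) ∧
    M' = Submodule.span H {D' w₀} ∧
    ∃ e : (H ⧸ I) ≃ₗ[H] M', ∀ x : H, (e (Submodule.Quotient.mk x) : H) = x * D' w₀ := by
  have hr0 : r ≠ 0 := by rintro rfl; simp at hrr'
  have hr0' : r' ≠ 0 := by rintro rfl; simp at hrr'
  let I := hD.descentIdeal hτ h hq hr hr0 hS₀
  let M' := hD'.fullDescentIdeal hτ h hq hr' hr0' hS₀
  have hM' : M' = Submodule.span H {D' w₀} := by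
    apply le_antisymm
    · intro x hx
      have hx' : ∀ s ∈ S₀, x ∈ eigenIdeal q τ r' s := by
        intro s hs
        have : x ∈ Submodule.span k (D' '' {w | ∀ s ∈ S₀, l (w * s) < l w}) := hx
        refine (Submodule.span_le (p := (eigenIdeal q τ r' s).restrictScalars k)).2 ?_ this
        rintro _ ⟨w, hw, rfl⟩
        exact hD'.mem_eigenIdeal hτ h hq hr' (hS₀ hs) (hw s hs)
      obtain ⟨g, hg⟩ := exists_eq_mul_longest hτ h hS₀ hw₀ hmax hD' hq hr0' hr' hx'
      exact Submodule.mem_span_singleton.2 ⟨g, hg.symm⟩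
    · rw [Submodule.span_singleton_le_iff_mem]
      exact Submodule.subset_span ⟨w₀, fun s hs => longest_mul_simple_lt h hS₀ hw₀ hmax hs, rfl⟩
  have hker : I = LinearMap.ker (LinearMap.toSpanSingleton H H (D' w₀)) := by
    ext x
    rw [LinearMap.mem_ker, LinearMap.toSpanSingleton_apply, smul_eq_mul]
    exact (mul_longest_eq_zero_iff hτ h hD hD' hq hr hr' hrr' hS₀ hw₀ hmax x).symm
  have hrange : LinearMap.range (LinearMap.toSpanSingleton H H (D' w₀)) = M' := by
    rw [hM', LinearMap.range_toSpanSingleton]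
  refine ⟨I, M', rfl, rfl, hM', (Submodule.quotEquivOfEq _ _ hker).trans
    ((LinearMap.quotKerEquivRange _).trans (LinearEquiv.ofEq _ _ hrange)), fun x => ?_⟩
  rfl

end Duality

end Ideals

/-! ### Positivity of coroots and existence of the highest root. -/

section RootSystem

variable {ι M N : Type*} [AddCommGroup M] [Module ℝ M] [AddCommGroup N] [Module ℝ N]
  {P : RootPairing ι ℝ M N} (b : P.Base)

/-- The positive cone of the root lattice. -/
abbrev rootCone : AddSubmonoid M := AddSubmonoid.closure (P.root '' b.support)

theorem root_mem_rootCone_of_isPos {i : ι} (hi : b.IsPos i) : P.root i ∈ rootCone b := by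
  obtain ⟨f, -, h | h⟩ := b.exists_root_eq_sum_nat_or_neg i
  · rw [h]
    exact sum_mem fun j hj => nsmul_mem (AddSubmonoid.subset_closure (Set.mem_image_of_mem _ hj)) _
  · have : b.height i = ∑ j ∈ b.support, -(f j : ℤ) :=
      RootPairing.Base.height_eq_sum (by rw [h]; simp)
    rw [RootPairing.Base.isPos_iff, this] at hi
    have : ∑ j ∈ b.support, -(f j : ℤ) ≤ 0 := Finset.sum_nonpos fun j _ => by simp
    omega

section Finite

variable [Finite ι] [P.IsCrystallographic] [P.IsReduced]

/-- Positive roots are reached from simple ones through simple reflections that stay among positive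
roots, and the same moves preserve positivity for the dual base. -/
theorem isPos_flip_of_isPos {i : ι} (hi : b.IsPos i) : b.flip.IsPos i := by
  have key : b.IsPos i → b.flip.IsPos i := by
    refine hi.induction_on_reflect (p := fun i => b.IsPos i → b.flip.IsPos i)
      (fun i hi _ => RootPairing.Base.isPos_of_mem_support (b := b.flip) hi) ?_
    intro i j ih hj hpos
    by_cases hij : i = j
    · subst hij
      let := P.indexNeg
      exact absurd hpos ((RootPairing.Base.IsPos.neg_iff_not b i).not.2 (by
        simpa using RootPairing.Base.isPos_of_mem_support hj))
    · by_cases hij' : P.reflectionPerm j i = j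
      · rw [hij']; exact RootPairing.Base.isPos_of_mem_support (b := b.flip) hj
      · have h1 := hpos.reflectionPerm hj hij'
        rw [RootPairing.reflectionPerm_self] at h1
        exact (ih h1).reflectionPerm (b := b.flip) hj hij
  exact key hi

theorem coroot_mem_closure_of_isPos {i : ι} (hi : b.IsPos i) :
    P.coroot i ∈ AddSubmonoid.closure (P.coroot '' b.support) :=
  root_mem_rootCone_of_isPos b.flip (isPos_flip_of_isPos b hi)

end Finite

section HighestRoot

variable [P.IsRootSystem]

/-- The linear functional taking the value one on all simple roots. -/
def heightFunctional : M →ₗ[ℝ] ℝ := b.toWeightBasis.constr ℝ fun _ => (1 : ℝ)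

theorem heightFunctional_root {i : ι} (hi : i ∈ b.support) :
    heightFunctional b (P.root i) = 1 := by
  have := b.toWeightBasis.constr_basis ℝ (fun _ => (1 : ℝ)) ⟨i, hi⟩
  simpa [heightFunctional] using this

theorem eq_zero_or_one_le_heightFunctional {x : M} (hx : x ∈ rootCone b) :
    x = 0 ∨ 1 ≤ heightFunctional b x := by
  refine AddSubmonoid.closure_induction ?_ (Or.inl rfl) ?_ hx
  · rintro _ ⟨i, hi, rfl⟩
    exact Or.inr (heightFunctional_root b hi).ge
  · rintro x y - - (rfl | hx) (rfl | hy)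
    · simp
    · simpa using Or.inr hy
    · simpa using Or.inr hx
    · right; rw [map_add]; linarith

theorem eq_zero_of_mem_rootCone_of_neg_mem {x : M} (hx : x ∈ rootCone b)
    (hx' : -x ∈ rootCone b) : x = 0 := by
  rcases eq_zero_or_one_le_heightFunctional b hx with h | h
  · exact h
  rcases eq_zero_or_one_le_heightFunctional b hx' with h' | h'
  · simpa using h'
  · rw [map_neg] at h'; linarith

theorem repr_nonneg_of_mem_rootCone {x : M} (hx : x ∈ rootCone b) (i : b.support) :
    0 ≤ b.toWeightBasis.repr x i := by
  classical
  refine AddSubmonoid.closure_induction ?_ (by simp) ?_ hx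
  · rintro _ ⟨j, hj, rfl⟩
    have := b.toWeightBasis_repr_root ⟨j, hj⟩
    simp only at this
    rw [this, Finsupp.single_apply]
    split <;> norm_num
  · intro x y _ _ hx hy
    simpa using add_nonneg hx hy

/-- The root of index `i` is maximal for the dominance order. -/
def IsMaximalRoot (i : ι) : Prop := ∀ k, P.root k - P.root i ∈ rootCone b → k = i

theorem exists_isMaximalRoot [Finite ι] (j : ι) :
    ∃ i, IsMaximalRoot b i ∧ P.root i - P.root j ∈ rootCone b := by
  obtain ⟨i, hi, hmax⟩ := Set.exists_max_image {i | P.root i - P.root j ∈ rootCone b}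
    (fun i => heightFunctional b (P.root i)) (Set.toFinite _) ⟨j, by simp⟩
  refine ⟨i, fun k hk => ?_, hi⟩
  have h1 := hmax k (by
    have := add_mem hk hi
    simpa using this)
  rcases eq_zero_or_one_le_heightFunctional b hk with h | h
  · exact P.root.injective (sub_eq_zero.1 h)
  · rw [map_sub] at h; linarith

variable {b} in
omit [P.IsRootSystem] in
-- If `-α` were in the cone, `-α` would exceed `α` by `-2α`, and maximality would give `-α = α`.
theorem IsMaximalRoot.root_mem [Finite ι] {i : ι} (hi : IsMaximalRoot b i) :
    P.root i ∈ rootCone b := by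
  refine (b.root_mem_or_neg_mem i).resolve_right fun h => ?_
  have h2 := hi (P.reflectionPerm i i) (by
    have := add_mem h h
    simpa [sub_eq_add_neg] using this)
  have h3 := congrArg P.root h2
  have : P.root i = 0 := by
    rw [RootPairing.root_reflectionPerm, RootPairing.reflection_apply_self] at h3
    have h4 : (2 : ℝ) • P.root i = 0 := by
      rw [two_smul]; nth_rewrite 1 [← h3]; exact neg_add_cancel _
    simpa using h4
  exact P.ne_zero i this

variable {b} in
theorem IsMaximalRoot.pairingIn_nonneg [Finite ι] [P.IsCrystallographic] {i : ι}
    (hi : IsMaximalRoot b i) {j : ι} (hj : j ∈ b.support) : 0 ≤ P.pairingIn ℤ i j := by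
  by_contra! h
  by_cases h' : P.root i = -P.root j
  · have h1 := hi.root_mem
    rw [h'] at h1
    exact P.ne_zero j (eq_zero_of_mem_rootCone_of_neg_mem b
      (AddSubmonoid.subset_closure ⟨j, hj, rfl⟩) h1)
  · obtain ⟨k, hk⟩ := P.root_add_root_mem_of_pairingIn_neg h h'
    have := hi k (by rw [hk, add_sub_cancel_left]; exact AddSubmonoid.subset_closure ⟨j, hj, rfl⟩)
    rw [this] at hk
    exact P.ne_zero j (by simpa using hk)

variable {b} in
-- The span of the simple roots occurring in a maximal root is stable under simple reflections. If
-- `α_k` does not occur, the pairing with its coroot is a sum of nonpositive terms, yet nonnegative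
-- by dominance, so all occurring simple roots are orthogonal to `α_k`. By irreducibility this span
-- is everything.
theorem IsMaximalRoot.repr_pos [Finite ι] [P.IsCrystallographic] [P.IsReduced] [P.IsIrreducible] {i : ι}
    (hi : IsMaximalRoot b i) (j : b.support) : 0 < b.toWeightBasis.repr (P.root i) j := by
  classical
  set c := b.toWeightBasis.repr (P.root i) with hc
  have hc0 : ∀ j, 0 ≤ c j := repr_nonneg_of_mem_rootCone b hi.root_mem
  have hsum : P.root i = ∑ k : b.support, c k • P.root k := by
    conv_lhs => rw [← b.toWeightBasis.sum_repr (P.root i)]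
    simp [hc]
  set q : Submodule ℝ M := Submodule.span ℝ (b.toWeightBasis '' {k | c k ≠ 0}) with hq
  have hmem : P.root i ∈ q := by
    rw [hsum]
    refine sum_mem fun k _ => ?_
    by_cases hk : c k = 0
    · simp [hk]
    · exact q.smul_mem _ (Submodule.subset_span ⟨k, hk, by simp⟩)
  have hinv : ∀ k ∈ b.support, q ∈ Module.End.invtSubmodule (P.reflection k) := by
    intro k hk
    by_cases hck : c ⟨k, hk⟩ = 0
    · have hterm : ∀ m : b.support, c m * P.pairing m k ≤ 0 := by
        intro m
        by_cases hm : m = ⟨k, hk⟩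
        · rw [hm, hck, zero_mul]
        · refine mul_nonpos_of_nonneg_of_nonpos (hc0 m) ?_
          have h1 := b.pairingIn_le_zero_of_ne (i := m) (j := k)
            (fun h => hm (Subtype.ext h)) m.2 hk
          rw [← P.algebraMap_pairingIn ℤ]
          simpa using h1
      have hge : 0 ≤ ∑ m : b.support, c m * P.pairing m k := by
        have h1 := hi.pairingIn_nonneg hk
        have h2 : P.pairing i k = ∑ m : b.support, c m * P.pairing m k := by
          rw [← P.root_coroot'_eq_pairing, hsum, map_sum]
          simp
        rw [← h2, ← P.algebraMap_pairingIn ℤ]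
        simpa using h1
      have hzero := (Finset.sum_eq_zero_iff_of_nonpos fun m _ => hterm m).1
        (le_antisymm (Finset.sum_nonpos fun m _ => hterm m) hge)
      rw [Module.End.mem_invtSubmodule, hq, Submodule.span_le]
      rintro _ ⟨m, hm, rfl⟩
      have h3 := (mul_eq_zero.1 (hzero m (Finset.mem_univ _))).resolve_left hm
      simp only [RootPairing.Base.toWeightBasis_apply, SetLike.mem_coe, Submodule.mem_comap]
      rw [LinearEquiv.coe_coe, RootPairing.reflection_apply_root, h3, zero_smul, sub_zero]
      exact Submodule.subset_span ⟨m, hm, by simp⟩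
    · exact Submodule.mem_invtSubmodule_reflection_of_mem _ _
        (Submodule.subset_span ⟨⟨k, hk⟩, hck, by simp⟩)
  have htop := RootPairing.IsIrreducible.eq_top_of_invtSubmodule_reflection (P := P) q
    ((b.forall_mem_support_invtSubmodule_iff q).1 hinv)
    (fun h => P.ne_zero i (by simpa [h] using hmem))
  have hj : b.toWeightBasis j ∈ q := htop ▸ Submodule.mem_top
  exact lt_of_le_of_ne (hc0 j) (Ne.symm (by
    rwa [hq, b.toWeightBasis.mem_span_image, b.toWeightBasis.repr_self,
      Finsupp.support_single _ one_ne_zero, Finset.coe_singleton,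
      Set.singleton_subset_iff] at hj))

/-- Two distinct maximal roots pair positively, because one has only positive coefficients and the
other is dominant. Their difference is then a root, in the cone up to sign, against maximality. The
unique maximal root lies above every root. -/
theorem exists_highestRoot [Finite ι] [P.IsCrystallographic] [P.IsReduced] [P.IsIrreducible] [Nonempty ι] :
    ∃ i, ∀ j, P.root i - P.root j ∈ rootCone b := by
  classical
  have huniq : ∀ i j, IsMaximalRoot b i → IsMaximalRoot b j → i = j := by
    intro i j hi hj
    by_contra hij
    have hpos : 0 < P.pairingIn ℤ i j := by
      set c := b.toWeightBasis.repr (P.root i) with hc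
      have hsum : ∀ k, P.root k = ∑ m : b.support, b.toWeightBasis.repr (P.root k) m • P.root m := by
        intro k
        conv_lhs => rw [← b.toWeightBasis.sum_repr (P.root k)]
        simp
      have hnn : ∀ m : b.support, 0 ≤ P.pairing m j := by
        intro m
        have h1 := hj.pairingIn_nonneg m.2
        rw [← not_lt, P.pairingIn_lt_zero_iff, not_lt] at h1
        rw [← P.algebraMap_pairingIn ℤ]
        simpa using h1
      have hp : ∀ k, P.pairing k j = ∑ m : b.support, b.toWeightBasis.repr (P.root k) m * P.pairing m j := by
        intro k
        conv_lhs => rw [← P.root_coroot'_eq_pairing, hsum k, map_sum]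
        simp
      obtain ⟨m, hm⟩ : ∃ m : b.support, P.pairing m j ≠ 0 := by
        by_contra! h
        have := hp j
        simp [h] at this
      have : 0 < P.pairing i j := by
        rw [hp i]
        exact Finset.sum_pos' (fun m _ => mul_nonneg (hi.repr_pos m).le (hnn m))
          ⟨m, Finset.mem_univ _, mul_pos (hi.repr_pos m) (lt_of_le_of_ne (hnn m) hm.symm)⟩
      rw [← P.algebraMap_pairingIn ℤ] at this
      simpa using this
    obtain ⟨k, hk⟩ := P.root_sub_root_mem_of_pairingIn_pos hpos hij
    rcases b.root_mem_or_neg_mem k with h | h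
    · exact hij (hj i (hk ▸ h))
    · exact hij (hi j (by rw [hk, neg_sub] at h; exact h)).symm
  obtain ⟨i, hi, -⟩ := exists_isMaximalRoot b (Classical.arbitrary ι)
  refine ⟨i, fun j => ?_⟩
  obtain ⟨i', hi', h⟩ := exists_isMaximalRoot b j
  rwa [huniq i i' hi hi']

theorem exists_isHighestCoroot [Finite ι] [P.IsCrystallographic] [P.IsReduced] [P.IsIrreducible] [Nonempty ι] :
    ∃ i, IsHighestCoroot b i :=
  exists_highestRoot b.flip

end HighestRoot

end RootSystem

/-! ### The affine action, its reflections and the inversions of an element. -/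

/-- The cocycle rule `IsInversionSystem.mul` for a single hyperplane and three points off it. -/
theorem mul_neg_iff_not_iff {a b c : ℝ} (ha : a ≠ 0) (hb : b ≠ 0) (hc : c ≠ 0) :
    a * c < 0 ↔ ¬ (a * b < 0 ↔ b * c < 0) := by
  simp only [mul_neg_iff]
  rcases lt_or_gt_of_ne ha with ha | ha <;> rcases lt_or_gt_of_ne hb with hb | hb <;>
    rcases lt_or_gt_of_ne hc with hc | hc <;> simp [ha, hb, hc, ha.not_gt, hb.not_gt, hc.not_gt]

section AffineAction

variable {ι V V' : Type*} [AddCommGroup V] [Module ℝ V] [AddCommGroup V'] [Module ℝ V']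
  {R : RootPairing ι ℝ V V'}

theorem affAct_one (x : V) : affAct (1 : ExtAffineWeyl R) x = x := by
  simp [affAct]

theorem affAct_mul (g h : ExtAffineWeyl R) (x : V) :
    affAct (g * h) x = affAct g (affAct h x) := by
  change (g.right * h.right) • x + ((g.left.toAdd : V) + g.right • (h.left.toAdd : V)) =
    g.right • (h.right • x + (h.left.toAdd : V)) + (g.left.toAdd : V)
  rw [smul_add, mul_smul]
  abel

theorem affAct_inv_self (g : ExtAffineWeyl R) (x : V) : affAct g⁻¹ (affAct g x) = x := by
  rw [← affAct_mul, inv_mul_cancel, affAct_one]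

theorem affAct_self_inv (g : ExtAffineWeyl R) (x : V) : affAct g (affAct g⁻¹ x) = x := by
  rw [← affAct_mul, mul_inv_cancel, affAct_one]

theorem affAct_injective {g h : ExtAffineWeyl R} (hgh : ∀ x : V, affAct g x = affAct h x) :
    g = h := by
  have hl : g.left = h.left := by
    apply Multiplicative.toAdd.injective
    apply Subtype.ext
    simpa [affAct] using hgh 0
  refine SemidirectProduct.ext hl (Subtype.ext (RootPairing.Equiv.weightHom_injective R ?_))
  refine LinearEquiv.ext fun x => ?_
  have := hgh x
  simp only [affAct, hl, add_left_inj] at this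
  exact this

theorem exists_weyl_smul_root (w : R.weylGroup) (i : ι) :
    ∃ j, w • R.root i = R.root j ∧ ∀ x : V, R.coroot' j (w • x) = R.coroot' i x := by
  obtain ⟨w, hw⟩ := w
  change ∃ j, w • R.root i = R.root j ∧ ∀ x : V, R.coroot' j (w • x) = R.coroot' i x
  induction hw using RootPairing.weylGroup.induction generalizing i with
  | mem k =>
    refine ⟨R.reflectionPerm k i, ?_, fun x => ?_⟩
    · rw [RootPairing.root_reflectionPerm]; rfl
    · change R.coroot' (R.reflectionPerm k i) (R.reflection k x) = _
      rw [R.coroot'_reflection, RootPairing.reflectionPerm_self]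
  | one => exact ⟨i, one_smul _ _, fun x => by rw [one_smul]⟩
  | mul g h _ _ hg hh =>
    obtain ⟨j, h1, h2⟩ := hh i
    obtain ⟨m, h3, h4⟩ := hg j
    exact ⟨m, by rw [mul_smul, h1, h3], fun x => by rw [mul_smul, h4, h2]⟩

variable [R.IsCrystallographic]

theorem affAct_affRefl (i : ι) (n : ℤ) (x : V) :
    affAct (affRefl (R := R) i n) x = x - (R.coroot' i x - n) • R.root i := by
  change R.reflection i x + ((n • ⟨R.root i, root_mem_weightLattice R i⟩ : weightLattice R) : V) = _
  rw [R.reflection_apply, AddSubgroup.coe_zsmul, sub_smul, Int.cast_smul_eq_zsmul]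
  abel

theorem coroot'_affAct_affRefl_self (i : ι) (n : ℤ) (x : V) :
    R.coroot' i (affAct (affRefl (R := R) i n) x) - n = -(R.coroot' i x - n) := by
  rw [affAct_affRefl, map_sub, map_smul, R.root_coroot'_eq_pairing, R.pairing_same, smul_eq_mul]
  ring

theorem affRefl_mul_self (i : ι) (n : ℤ) : affRefl (R := R) i n * affRefl i n = 1 := by
  refine affAct_injective fun x => ?_
  rw [affAct_mul, affAct_one, affAct_affRefl i n (affAct _ x), coroot'_affAct_affRefl_self,
    affAct_affRefl]
  module

theorem exists_conj_affRefl (g : ExtAffineWeyl R) (i : ι) (n : ℤ) :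
    ∃ j m, (∀ x : V, R.coroot' j (affAct g x) - (m : ℤ) = R.coroot' i x - n) ∧
      g * affRefl i n * g⁻¹ = affRefl j m := by
  obtain ⟨j, h1, h2⟩ := exists_weyl_smul_root g.right i
  obtain ⟨c, hc⟩ := g.left.toAdd.2 j
  have h3 : ∀ x : V, R.coroot' j (affAct g x) - ((n + c : ℤ) : ℝ) = R.coroot' i x - n := by
    intro x
    rw [affAct, map_add, h2, hc]
    push_cast
    ring
  refine ⟨j, n + c, h3, affAct_injective fun x => ?_⟩
  obtain ⟨y, rfl⟩ : ∃ y, x = affAct g y := ⟨affAct g⁻¹ x, (affAct_self_inv g x).symm⟩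
  rw [affAct_affRefl j, h3, affAct_mul, affAct_inv_self, affAct_mul, affAct_affRefl, ← h1]
  simp only [affAct]
  rw [smul_sub, sub_add_eq_add_sub]
  congr 1
  exact (RootPairing.Equiv.weightHom R g.right.1).map_smul _ _

theorem exists_conj_inv_affRefl (g : ExtAffineWeyl R) (i : ι) (n : ℤ) :
    ∃ j m, (∀ x : V, R.coroot' j x - (m : ℤ) = R.coroot' i (affAct g x) - n) ∧
      g⁻¹ * affRefl i n * g = affRefl j m := by
  obtain ⟨j, m, h1, h2⟩ := exists_conj_affRefl g⁻¹ i n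
  refine ⟨j, m, fun x => ?_, by simpa using h2⟩
  rw [← h1, affAct_inv_self]

/-- A reflection determines its affine functional up to sign, so the product of two values that
defines `inversions` depends only on the reflection. -/
theorem coroot'_sub_eq_or_eq_neg [R.IsReduced] {i j : ι} {n m : ℤ}
    (h : affRefl (R := R) i n = affRefl j m) :
    (∀ x : V, R.coroot' i x - n = R.coroot' j x - m) ∨
      ∀ x : V, R.coroot' i x - n = -(R.coroot' j x - m) := by
  have key : ∀ x : V, (R.coroot' i x - n) • R.root i = (R.coroot' j x - m) • R.root j := by
    intro x
    have := congrArg (fun g => affAct g x) h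
    simpa [affAct_affRefl] using this
  have hdep : ¬ LinearIndependent ℝ ![R.root i, R.root j] := by
    intro hli
    -- At `((n + 1) / 2) α_i` the functional `⟨x, α_i^∨⟩ - n` takes the value `1`, so `key` becomes
    -- a nontrivial linear relation.
    have h1 := LinearIndependent.pair_iff.1 hli 1
      (-(R.coroot' j (((n + 1) / 2 : ℝ) • R.root i) - m)) (by
        rw [neg_smul, ← key, map_smul, R.root_coroot'_eq_pairing, R.pairing_same, smul_eq_mul,
          div_mul_cancel₀ _ two_ne_zero, add_sub_cancel_left]
        module)
    exact one_ne_zero h1.1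
  have hi := R.ne_zero i
  rcases RootPairing.IsReduced.eq_or_eq_neg (P := R) i j hdep with h1 | h1
  · left
    intro x
    have := key x
    rw [← h1] at this
    exact smul_left_injective ℝ hi this
  · right
    intro x
    have := key x
    rw [eq_neg_iff_add_eq_zero, add_comm, ← eq_neg_iff_add_eq_zero] at h1
    rw [h1, smul_neg, ← neg_smul] at this
    exact smul_left_injective ℝ hi this

variable (R) in
/-- The set of reflections of the affine Weyl group. -/
def affReflections : Set (ExtAffineWeyl R) := {t | ∃ i n, t = affRefl i n}

/-- The reflections whose mirror separates `x` from `g x`. -/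
def inversions (x : V) (g : ExtAffineWeyl R) : Set (ExtAffineWeyl R) :=
  {t | ∃ i n, t = affRefl i n ∧ (R.coroot' i x - n) * (R.coroot' i (affAct g x) - n) < 0}

theorem affRefl_mem_inversions [R.IsReduced] (x : V) (g : ExtAffineWeyl R) (i : ι) (n : ℤ) :
    affRefl i n ∈ inversions x g ↔
      (R.coroot' i x - n) * (R.coroot' i (affAct g x) - n) < 0 := by
  refine ⟨?_, fun h => ⟨i, n, rfl, h⟩⟩
  rintro ⟨j, m, h1, h2⟩
  rcases coroot'_sub_eq_or_eq_neg h1 with h | h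
  · rwa [h, h]
  · rwa [h, h, neg_mul_neg]

theorem inversions_finite [Finite ι] (x : V) (g : ExtAffineWeyl R) : (inversions x g).Finite := by
  have : inversions x g ⊆ ⋃ i, affRefl i '' Set.Icc
      ⌊min (R.coroot' i x) (R.coroot' i (affAct g x))⌋
      ⌈max (R.coroot' i x) (R.coroot' i (affAct g x))⌉ := by
    rintro _ ⟨i, n, rfl, h⟩
    refine Set.mem_iUnion.2 ⟨i, n, ?_, rfl⟩
    rw [Set.mem_Icc, Int.floor_le_iff, Int.le_ceil_iff, min_lt_iff, lt_max_iff]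
    rcases mul_neg_iff.1 h with ⟨h1, h2⟩ | ⟨h1, h2⟩
    · exact ⟨Or.inr (by linarith), Or.inl (by linarith)⟩
    · exact ⟨Or.inl (by linarith), Or.inr (by linarith)⟩
  exact (Set.finite_iUnion fun i => (Set.finite_Icc _ _).image _).subset this

/-- The point `x` lies on no reflection hyperplane. -/
def IsRegularPoint (R : RootPairing ι ℝ V V') (x : V) : Prop := ∀ i, ∀ n : ℤ, R.coroot' i x ≠ n

omit [R.IsCrystallographic] in
theorem IsRegularPoint.sub_ne {x : V} (hx : IsRegularPoint R x) (i : ι) (n : ℤ) :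
    R.coroot' i x - n ≠ 0 := sub_ne_zero.2 (hx i n)

theorem IsRegularPoint.affAct {x : V} (hx : IsRegularPoint R x) (g : ExtAffineWeyl R) :
    IsRegularPoint R (affAct g x) := by
  intro i n h
  obtain ⟨j, m, h1, -⟩ := exists_conj_inv_affRefl g i n
  exact hx.sub_ne j m (by rw [h1, h, sub_self])

theorem mem_inversions_mul [R.IsReduced] {x : V} (hx : IsRegularPoint R x)
    (g h t : ExtAffineWeyl R) (ht : t ∈ affReflections R) :
    t ∈ inversions x (g * h) ↔ ¬ (t ∈ inversions x g ↔ g⁻¹ * t * g ∈ inversions x h) := by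
  obtain ⟨i, n, rfl⟩ := ht
  obtain ⟨j, m, h1, h2⟩ := exists_conj_inv_affRefl g i n
  rw [h2, affRefl_mem_inversions, affRefl_mem_inversions, affRefl_mem_inversions, h1, h1,
    affAct_mul]
  have ha := hx.sub_ne i n
  have hb := (hx.affAct g).sub_ne i n
  have hc := ((hx.affAct h).affAct g).sub_ne i n
  exact mul_neg_iff_not_iff ha hb hc

theorem affRefl_mem_inversions_self [R.IsReduced] {x : V} (hx : IsRegularPoint R x) (i : ι)
    (n : ℤ) : affRefl i n ∈ inversions x (affRefl (R := R) i n) := by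
  rw [affRefl_mem_inversions, coroot'_affAct_affRefl_self, mul_neg, neg_lt_zero]
  exact mul_self_pos.2 (hx.sub_ne i n)

end AffineAction

/-! ### The fundamental alcove, its walls, and the length function. -/

section Alcove

variable {ι V V' : Type*} [AddCommGroup V] [Module ℝ V] [AddCommGroup V'] [Module ℝ V']
  {R : RootPairing ι ℝ V V'} {b : R.Base}

theorem eq_zero_or_pos_of_mem_closure {x : V} (hx : ∀ i ∈ b.support, 0 < R.coroot' i x) {c : V'}
    (hc : c ∈ AddSubmonoid.closure (R.coroot '' b.support)) :
    c = 0 ∨ 0 < R.toLinearMap x c := by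
  refine AddSubmonoid.closure_induction ?_ (Or.inl rfl) ?_ hc
  · rintro _ ⟨i, hi, rfl⟩
    exact Or.inr (hx i hi)
  · rintro x y - - (rfl | hx) (rfl | hy)
    · simp
    · simpa using Or.inr hy
    · simpa using Or.inr hx
    · right; rw [map_add]; exact add_pos hx hy

theorem nonneg_of_mem_closure {x : V} (hx : ∀ i ∈ b.support, 0 < R.coroot' i x) {c : V'}
    (hc : c ∈ AddSubmonoid.closure (R.coroot '' b.support)) : 0 ≤ R.toLinearMap x c := by
  rcases eq_zero_or_pos_of_mem_closure hx hc with rfl | h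
  · simp
  · exact h.le

theorem pos_of_mem_alcove {x : V} (hx : x ∈ alcove b) : ∀ i ∈ b.support, 0 < R.coroot' i x :=
  fun i hi => (hx i (RootPairing.Base.isPos_of_mem_support hi)).1

theorem coroot'_indexNeg (i : ι) (x : V) :
    letI := R.indexNeg
    R.coroot' (-i) x = -R.coroot' i x := by
  simp

theorem isRegularPoint_of_mem_alcove {x : V} (hx : x ∈ alcove b) : IsRegularPoint R x := by
  have key : ∀ i, b.IsPos i → ∀ n : ℤ, R.coroot' i x ≠ n := by
    intro i hi n h
    have h1 := hx i hi
    rw [h] at h1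
    have h2 : 0 < n := by exact_mod_cast h1.1
    have h3 : n < 1 := by exact_mod_cast h1.2
    omega
  intro i n h
  let := R.indexNeg
  rcases RootPairing.Base.IsPos.or_neg b i with hi | hi
  · exact key i hi n h
  · exact key _ hi (-n) (by rw [coroot'_indexNeg, h]; push_cast; rfl)

theorem sign_const_on_alcove (b : R.Base) (i : ι) (n : ℤ) :
    (∀ x ∈ alcove b, R.coroot' i x - n < 0) ∨ ∀ x ∈ alcove b, 0 < R.coroot' i x - n := by
  have key : ∀ i, b.IsPos i → ∀ n : ℤ,
      (∀ x ∈ alcove b, R.coroot' i x - n < 0) ∨ ∀ x ∈ alcove b, 0 < R.coroot' i x - n := by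
    intro i hi n
    rcases le_or_gt n 0 with hn | hn
    · right
      intro x hx
      have h1 := (hx i hi).1
      have h2 : (n : ℝ) ≤ 0 := by exact_mod_cast hn
      linarith
    · left
      intro x hx
      have h1 := (hx i hi).2
      have h2 : (1 : ℝ) ≤ n := by exact_mod_cast hn
      linarith
  let := R.indexNeg
  rcases RootPairing.Base.IsPos.or_neg b i with hi | hi
  · exact key i hi n
  · rcases key _ hi (-n) with h | h
    · right
      intro x hx
      have := h x hx
      rw [coroot'_indexNeg] at this
      push_cast at this
      linarith
    · left
      intro x hx
      have := h x hx
      rw [coroot'_indexNeg] at this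
      push_cast at this
      linarith

theorem isHighestCoroot_sub {θ : ι} (hθ : IsHighestCoroot b θ) {x : V}
    (hx : ∀ i ∈ b.support, 0 < R.coroot' i x) (j : ι) : R.coroot' j x ≤ R.coroot' θ x := by
  have := nonneg_of_mem_closure hx (hθ j)
  rw [map_sub] at this
  exact sub_nonneg.1 this

variable [Finite ι] [R.IsCrystallographic] [R.IsReduced]

theorem coroot'_pos_of_isPos {x : V} (hx : ∀ i ∈ b.support, 0 < R.coroot' i x) {i : ι}
    (hi : b.IsPos i) : 0 < R.coroot' i x :=
  (eq_zero_or_pos_of_mem_closure hx (coroot_mem_closure_of_isPos b hi)).resolve_left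
    (R.flip.ne_zero i)

/-- Positive coroots are sums of simple ones and are dominated by the highest one, so the simple
walls and one affine wall suffice. -/
theorem mem_alcove_iff {θ : ι} (hθ : IsHighestCoroot b θ) (hpos : b.IsPos θ) {x : V} :
    x ∈ alcove b ↔ (∀ i ∈ b.support, 0 < R.coroot' i x) ∧ R.coroot' θ x < 1 := by
  refine ⟨fun hx => ⟨pos_of_mem_alcove hx, (hx θ hpos).2⟩, fun hx i hi => ?_⟩
  exact ⟨coroot'_pos_of_isPos hx.1 hi, (isHighestCoroot_sub hθ hx.1 i).trans_lt hx.2⟩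

theorem IsHighestCoroot.isPos [R.IsRootSystem] {θ : ι} (hθ : IsHighestCoroot b θ) : b.IsPos θ := by
  let := R.indexNeg
  by_contra h
  rw [← RootPairing.Base.IsPos.neg_iff_not] at h
  have h1 := coroot_mem_closure_of_isPos b h
  have h2 : R.coroot (-θ) = -R.coroot θ := by simp
  have h3 := hθ (-θ)
  rw [h2, sub_neg_eq_add] at h3
  rw [h2] at h1
  have h4 : R.coroot θ + R.coroot θ = 0 :=
    eq_zero_of_mem_rootCone_of_neg_mem b.flip h3 (by
      rw [neg_add]; exact add_mem h1 h1)
  rw [← two_smul ℝ] at h4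
  exact R.flip.ne_zero θ ((smul_eq_zero_iff_right two_ne_zero).1 h4)

theorem IsHighestCoroot.unique [R.IsRootSystem] {θ θ' : ι} (hθ : IsHighestCoroot b θ)
    (hθ' : IsHighestCoroot b θ') : θ = θ' := by
  apply R.coroot.injective
  rw [← sub_eq_zero]
  exact eq_zero_of_mem_rootCone_of_neg_mem b.flip (hθ θ') (by rw [neg_sub]; exact hθ' θ)

theorem alcove_nonempty [R.IsRootSystem] [R.IsIrreducible] [Nonempty ι] :
    (alcove b).Nonempty := by
  obtain ⟨θ, hθ⟩ := exists_isHighestCoroot b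
  set f : V' →ₗ[ℝ] ℝ := heightFunctional b.flip with hf
  -- The point where all simple coroots take the value `1`; scaling by `(1 + ⟨y, θ^∨⟩)⁻¹` brings it
  -- below the affine wall.
  set y : V := R.toPerfPair.symm f with hy
  have hyc : ∀ i, R.coroot' i y = f (R.coroot i) := fun i =>
    LinearMap.congr_fun (R.toPerfPair.apply_symm_apply f) (R.coroot i)
  have hys : ∀ i ∈ b.support, R.coroot' i y = 1 := fun i hi => by
    rw [hyc]; exact heightFunctional_root b.flip hi
  have ha : 0 < R.coroot' θ y :=
    coroot'_pos_of_isPos (fun i hi => by rw [hys i hi]; exact one_pos) hθ.isPos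
  refine ⟨(1 + R.coroot' θ y)⁻¹ • y, (mem_alcove_iff hθ hθ.isPos).2 ⟨fun i hi => ?_, ?_⟩⟩
  · rw [map_smul, hys i hi, smul_eq_mul, mul_one]
    positivity
  · rw [map_smul, smul_eq_mul, inv_mul_lt_iff₀ (by positivity)]
    linarith

theorem affRefl_indexNeg (i : ι) (n : ℤ) :
    letI := R.indexNeg
    affRefl (R := R) (-i) (-n) = affRefl i n := by
  let := R.indexNeg
  refine affAct_injective fun x => ?_
  rw [affAct_affRefl, affAct_affRefl, coroot'_indexNeg]
  have : R.root (-i) = -R.root i := by simp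
  rw [this]
  push_cast
  module

theorem exists_isPos_affRefl (b : R.Base) (i : ι) (n : ℤ) :
    ∃ j m, b.IsPos j ∧ affRefl (R := R) i n = affRefl j m := by
  let := R.indexNeg
  rcases RootPairing.Base.IsPos.or_neg b i with hi | hi
  · exact ⟨i, n, hi, rfl⟩
  · exact ⟨-i, -n, hi, (affRefl_indexNeg i n).symm⟩

/-- A reflection comes from two pairs, `(i, n)` and `(-i, -n)`; positivity selects one, so counting
hyperplanes is counting reflections. -/
theorem affRefl_injOn : Set.InjOn (fun h : ι × ℤ => affRefl (R := R) h.1 h.2)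
    {h | b.IsPos h.1} := by
  rintro ⟨i, n⟩ hi ⟨j, m⟩ hj h
  simp only [Set.mem_ofPred_eq] at hi hj h
  have key : ∀ x : V, (R.coroot' i x - n) • R.root i = (R.coroot' j x - m) • R.root j := by
    intro x
    have := congrArg (fun g => affAct g x) h
    simpa [affAct_affRefl] using this
  have hne := R.ne_zero j
  rcases coroot'_sub_eq_or_eq_neg h with h1 | h1
  · have hnm : n = m := by
      have := h1 0
      simpa using this
    subst hnm
    have h2 : R.root i = R.root j := by
      have h5 := key ((((n : ℝ) + 1) / 2) • R.root i)
      rw [← h1, map_smul, R.root_coroot'_eq_pairing, R.pairing_same, smul_eq_mul,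
        div_mul_cancel₀ _ two_ne_zero, add_sub_cancel_left, one_smul, one_smul] at h5
      exact h5
    rw [R.root.injective h2]
  · exfalso
    have h5 := key ((((n : ℝ) + 1) / 2) • R.root i)
    have h6 := h1 ((((n : ℝ) + 1) / 2) • R.root i)
    rw [map_smul (R.coroot' i), R.root_coroot'_eq_pairing, R.pairing_same, smul_eq_mul,
      div_mul_cancel₀ _ two_ne_zero, add_sub_cancel_left] at h5 h6
    rw [← neg_eq_iff_eq_neg.2 h6, one_smul, neg_smul, one_smul] at h5
    have h7 : i = R.reflectionPerm j j := by
      apply R.root.injective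
      rw [h5, RootPairing.root_reflectionPerm, RootPairing.reflection_apply_self]
    let := R.indexNeg
    exact (RootPairing.Base.IsPos.neg_iff_not b j).1 (by rw [h7] at hi; exact hi) hj

theorem separates_iff {x : V} (hx : x ∈ alcove b) (g : ExtAffineWeyl R) (i : ι) (n : ℤ) :
    Separates (R := R) i n (alcove b) (affAct g '' alcove b) ↔
      (R.coroot' i x - n) * (R.coroot' i (affAct g x) - n) < 0 := by
  obtain ⟨j, m, h1, -⟩ := exists_conj_inv_affRefl g i n
  constructor
  · rintro (⟨h2, h3⟩ | ⟨h2, h3⟩)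
    · exact mul_neg_of_neg_of_pos (sub_neg.2 (h2 x hx)) (sub_pos.2 (h3 _ ⟨x, hx, rfl⟩))
    · exact mul_neg_of_pos_of_neg (sub_pos.2 (h2 x hx)) (sub_neg.2 (h3 _ ⟨x, hx, rfl⟩))
  · intro h
    rcases mul_neg_iff.1 h with ⟨h2, h3⟩ | ⟨h2, h3⟩
    · right
      constructor
      · rcases sign_const_on_alcove b i n with h4 | h4
        · exact absurd (h4 x hx) h2.not_gt
        · exact fun y hy => sub_pos.1 (h4 y hy)
      · rintro _ ⟨y, hy, rfl⟩
        rcases sign_const_on_alcove b j m with h4 | h4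
        · have := h4 y hy
          rw [h1] at this
          exact sub_neg.1 this
        · have := h4 x hx
          rw [h1] at this
          exact absurd this h3.not_gt
    · left
      constructor
      · rcases sign_const_on_alcove b i n with h4 | h4
        · exact fun y hy => sub_neg.1 (h4 y hy)
        · exact absurd (h4 x hx) h2.not_gt
      · rintro _ ⟨y, hy, rfl⟩
        rcases sign_const_on_alcove b j m with h4 | h4
        · have := h4 x hx
          rw [h1] at this
          exact absurd this h3.not_gt
        · have := h4 y hy
          rw [h1] at this
          exact sub_pos.1 this

theorem length_eq_ncard_inversions {x : V} (hx : x ∈ alcove b) (g : ExtAffineWeyl R) :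
    length b g = (inversions x g).ncard := by
  have : inversions x g = (fun h : ι × ℤ => affRefl (R := R) h.1 h.2) '' {h : ι × ℤ | b.IsPos h.1 ∧
      Separates (R := R) h.1 h.2 (alcove b) (affAct g '' alcove b)} := by
    ext t
    constructor
    · intro ht
      obtain ⟨i, n, rfl, -⟩ := id ht
      obtain ⟨j, m, hj, h⟩ := exists_isPos_affRefl b i n
      rw [h] at ht ⊢
      exact ⟨(j, m), ⟨hj, (separates_iff hx g j m).2 ((affRefl_mem_inversions x g j m).1 ht)⟩, rfl⟩
    · rintro ⟨⟨i, n⟩, ⟨-, h⟩, rfl⟩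
      exact (affRefl_mem_inversions x g i n).2 ((separates_iff hx g i n).1 h)
  rw [this, (affRefl_injOn.mono fun h hh => hh.1).ncard_image]
  rfl

/-- A simple reflection permutes the positive coroots other than its own, so these keep values in
`(0, 1)` at the image of `x`. -/
theorem inversions_affRefl_simple {x : V} (hx : x ∈ alcove b) {i : ι} (hi : i ∈ b.support) :
    inversions x (affRefl (R := R) i 0) = {affRefl i 0} := by
  refine subset_antisymm ?_ (Set.singleton_subset_iff.2
    (affRefl_mem_inversions_self (isRegularPoint_of_mem_alcove hx) i 0))
  intro t ht
  obtain ⟨j, n, rfl, -⟩ := id ht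
  obtain ⟨j, m, hj, h⟩ := exists_isPos_affRefl b j n
  rw [h] at ht ⊢
  rw [affRefl_mem_inversions] at ht
  have h1 := hx j hj
  by_cases hij : j = i
  · subst hij
    have h2 : R.coroot' j (affAct (affRefl (R := R) j 0) x) = -R.coroot' j x := by
      simpa using coroot'_affAct_affRefl_self (R := R) j 0 x
    rw [h2] at ht
    have hm : m = 0 := by
      rcases mul_neg_iff.1 ht with ⟨h3, h4⟩ | ⟨h3, h4⟩
      · have h5 : (m : ℝ) < 1 := by linarith
        have h6 : (-1 : ℝ) < m := by linarith
        have h7 : m < 1 := by exact_mod_cast h5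
        have h8 : -1 < m := by exact_mod_cast h6
        omega
      · linarith
    rw [hm]; rfl
  · exfalso
    have h2 : R.coroot' j (affAct (affRefl (R := R) i 0) x) = R.coroot' (R.reflectionPerm i j) x := by
      rw [← R.coroot'_reflection, affAct_affRefl, R.reflection_apply]
      simp
    have h3 := hx _ (hj.reflectionPerm hi hij)
    rw [h2] at ht
    rcases mul_neg_iff.1 ht with ⟨h4, h5⟩ | ⟨h4, h5⟩
    · have h6 : (m : ℝ) < 1 := by linarith
      have h7 : (0 : ℝ) < m := by linarith
      have h8 : m < 1 := by exact_mod_cast h6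
      have h9 : 0 < m := by exact_mod_cast h7
      omega
    · have h6 : (m : ℝ) < 1 := by linarith
      have h7 : (0 : ℝ) < m := by linarith
      have h8 : m < 1 := by exact_mod_cast h6
      have h9 : 0 < m := by exact_mod_cast h7
      omega

/-- With `p` the pairing, `j^∨ - p θ^∨` is again a coroot, so its value at `x` lies between those of
`-θ^∨` and `θ^∨`. Together with `0 < ⟨x, j^∨⟩ < ⟨x, θ^∨⟩` this leaves `p = 0` and `p = 1`. -/
theorem pairingIn_highestCoroot [R.IsRootSystem] {x : V} (hx : x ∈ alcove b) {θ : ι}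
    (hθ : IsHighestCoroot b θ) {j : ι} (hj : b.IsPos j) (hjθ : j ≠ θ) :
    R.pairingIn ℤ θ j = 0 ∨ R.pairingIn ℤ θ j = 1 := by
  have hxs := pos_of_mem_alcove hx
  have hθx := coroot'_pos_of_isPos hxs hθ.isPos
  have hjx := coroot'_pos_of_isPos hxs hj
  have hle := isHighestCoroot_sub hθ hxs j
  have hp : (R.pairingIn ℤ θ j : ℝ) = R.pairing θ j := by
    simpa using R.algebraMap_pairingIn ℤ θ j
  have hc : R.coroot' (R.reflectionPerm θ j) x =
      R.coroot' j x - R.pairing θ j * R.coroot' θ x := by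
    rw [← R.coroot'_reflection, R.reflection_apply, map_sub, map_smul, R.root_coroot'_eq_pairing,
      smul_eq_mul, mul_comm]
  have h1 := isHighestCoroot_sub hθ hxs (R.reflectionPerm θ j)
  have h2 : -R.coroot' (R.reflectionPerm θ j) x ≤ R.coroot' θ x := by
    let := R.indexNeg
    rw [← coroot'_indexNeg]
    exact isHighestCoroot_sub hθ hxs _
  have hlt : R.coroot' j x < R.coroot' θ x := by
    rcases eq_zero_or_pos_of_mem_closure hxs (hθ j) with h | h
    · exact absurd (R.coroot.injective (sub_eq_zero.1 h)).symm hjθ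
    · rw [map_sub] at h
      exact sub_pos.1 h
  rw [hc, ← hp] at h1 h2
  set p := R.pairingIn ℤ θ j
  have h3 : -1 < p := by
    by_contra! h
    have : (p : ℝ) ≤ -1 := by exact_mod_cast h
    nlinarith
  have h4 : p < 2 := by
    by_contra! h
    have : (2 : ℝ) ≤ p := by exact_mod_cast h
    nlinarith
  omega

/-- At the image of `x`, a positive coroot `j ≠ θ` keeps its value or takes the value `1 - (⟨x, θ^∨⟩
- ⟨x, j^∨⟩)`, according to the pairing. Both lie in `(0, 1)`. -/
theorem inversions_affRefl_highest [R.IsRootSystem] {x : V} (hx : x ∈ alcove b) {θ : ι}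
    (hθ : IsHighestCoroot b θ) : inversions x (affRefl (R := R) θ 1) = {affRefl θ 1} := by
  refine subset_antisymm ?_ (Set.singleton_subset_iff.2
    (affRefl_mem_inversions_self (isRegularPoint_of_mem_alcove hx) θ 1))
  intro t ht
  obtain ⟨j, n, rfl, -⟩ := id ht
  obtain ⟨j, m, hj, h⟩ := exists_isPos_affRefl b j n
  rw [h] at ht ⊢
  rw [affRefl_mem_inversions] at ht
  have h1 := hx j hj
  have hθx := hx θ hθ.isPos
  by_cases hij : j = θ
  · subst hij
    have h2 := coroot'_affAct_affRefl_self (R := R) j 1 x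
    push_cast at h2
    have h2' : R.coroot' j (affAct (affRefl (R := R) j 1) x) = 2 - R.coroot' j x := by linarith
    rw [h2'] at ht
    have hm : m = 1 := by
      rcases mul_neg_iff.1 ht with ⟨h3, h4⟩ | ⟨h3, h4⟩
      · linarith
      · have h5 : (m : ℝ) < 2 := by linarith
        have h6 : (0 : ℝ) < m := by linarith
        have h7 : m < 2 := by exact_mod_cast h5
        have h8 : 0 < m := by exact_mod_cast h6
        omega
    rw [hm]; rfl
  · exfalso
    have hp : (R.pairingIn ℤ θ j : ℝ) = R.pairing θ j := by
      simpa using R.algebraMap_pairingIn ℤ θ j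
    have h2 : R.coroot' j (affAct (affRefl (R := R) θ 1) x) =
        R.coroot' j x - (R.coroot' θ x - 1) * R.pairing θ j := by
      rw [affAct_affRefl, map_sub, map_smul, R.root_coroot'_eq_pairing, smul_eq_mul]
      simp
    have hlt : R.coroot' j x < R.coroot' θ x := by
      rcases eq_zero_or_pos_of_mem_closure (pos_of_mem_alcove hx) (hθ j) with h | h
      · exact absurd (R.coroot.injective (sub_eq_zero.1 h)).symm hij
      · rw [map_sub] at h
        exact sub_pos.1 h
    have h3 : 0 < R.coroot' j (affAct (affRefl (R := R) θ 1) x) ∧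
        R.coroot' j (affAct (affRefl (R := R) θ 1) x) < 1 := by
      rw [h2, ← hp]
      rcases pairingIn_highestCoroot hx hθ hj hij with h | h <;> rw [h] <;> push_cast
      · constructor <;> linarith
      · constructor <;> linarith
    generalize R.coroot' j (affAct (affRefl (R := R) θ 1) x) = z at ht h3
    rcases mul_neg_iff.1 ht with ⟨h4, h5⟩ | ⟨h4, h5⟩
    · have h6 : (m : ℝ) < 1 := by linarith
      have h7 : (0 : ℝ) < m := by linarith
      have h8 : m < 1 := by exact_mod_cast h6
      have h9 : 0 < m := by exact_mod_cast h7
      omega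
    · have h6 : (m : ℝ) < 1 := by linarith
      have h7 : (0 : ℝ) < m := by linarith
      have h8 : m < 1 := by exact_mod_cast h6
      have h9 : 0 < m := by exact_mod_cast h7
      omega

theorem inversions_eq_empty_of_mem_alcove {x : V} (hx : x ∈ alcove b) {g : ExtAffineWeyl R}
    (hg : affAct g x ∈ alcove b) : inversions x g = ∅ := by
  rw [Set.eq_empty_iff_forall_notMem]
  rintro _ ⟨i, n, -, h⟩
  rcases sign_const_on_alcove b i n with h1 | h1
  · exact (mul_pos_of_neg_of_neg (h1 _ hx) (h1 _ hg)).not_gt h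
  · exact (mul_pos (h1 _ hx) (h1 _ hg)).not_gt h

theorem affRefl_simple_mem_inversions {x : V} (hx : x ∈ alcove b) (g : ExtAffineWeyl R) {i : ι}
    (hi : i ∈ b.support) : affRefl i 0 ∈ inversions x g ↔ R.coroot' i (affAct g x) < 0 := by
  have h1 := pos_of_mem_alcove hx i hi
  rw [affRefl_mem_inversions, Int.cast_zero, sub_zero, sub_zero]
  exact ⟨fun h => by nlinarith, fun h => mul_neg_of_pos_of_neg h1 h⟩

theorem affRefl_highest_mem_inversions [R.IsRootSystem] {x : V} (hx : x ∈ alcove b)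
    (g : ExtAffineWeyl R) {θ : ι} (hθ : IsHighestCoroot b θ) :
    affRefl θ 1 ∈ inversions x g ↔ 1 < R.coroot' θ (affAct g x) := by
  have h1 := (hx θ hθ.isPos).2
  rw [affRefl_mem_inversions, Int.cast_one]
  exact ⟨fun h => by nlinarith,
    fun h => mul_neg_of_neg_of_pos (sub_neg.2 h1) (sub_pos.2 h)⟩

theorem isInversionSystem_inversions [R.IsRootSystem] [R.IsIrreducible] [Nonempty ι] {x : V}
    (hx : x ∈ alcove b) : IsInversionSystem (simples b) (affReflections R) (inversions x) where
  finite := inversions_finite x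
  subset := by
    rintro g _ ⟨i, n, rfl, -⟩
    exact ⟨i, n, rfl⟩
  mul := mem_inversions_mul (isRegularPoint_of_mem_alcove hx)
  simple_subset := by
    rintro _ (⟨i, -, rfl⟩ | ⟨i, -, rfl⟩)
    · exact ⟨i, 0, rfl⟩
    · exact ⟨i, 1, rfl⟩
  sq := by
    rintro _ ⟨i, n, rfl⟩
    exact affRefl_mul_self i n
  conj := by
    rintro _ ⟨i, n, rfl⟩ g
    obtain ⟨j, m, -, h⟩ := exists_conj_affRefl g i n
    exact ⟨j, m, h⟩
  self_mem := by
    rintro _ ⟨i, n, rfl⟩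
    exact affRefl_mem_inversions_self (isRegularPoint_of_mem_alcove hx) i n
  simple := by
    rintro _ (⟨i, hi, rfl⟩ | ⟨i, hi, rfl⟩)
    · exact inversions_affRefl_simple hx hi
    · exact inversions_affRefl_highest hx hi
  exists_simple := by
    intro g hg
    -- If no wall of the alcove separates `x` from `g x`, then `g x` lies in the alcove and `g` has
    -- no inversions.
    by_contra! h
    obtain ⟨θ, hθ⟩ := exists_isHighestCoroot b
    have hreg := (isRegularPoint_of_mem_alcove hx).affAct g
    refine hg.ne_empty (inversions_eq_empty_of_mem_alcove hx
      ((mem_alcove_iff hθ hθ.isPos).2 ⟨fun i hi => ?_, ?_⟩))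
    · have h1 := h (affRefl i 0) (Or.inl ⟨i, hi, rfl⟩)
      rw [affRefl_simple_mem_inversions hx g hi, not_lt] at h1
      exact lt_of_le_of_ne h1 (by simpa using (hreg i 0).symm)
    · have h1 := h (affRefl θ 1) (Or.inr ⟨θ, hθ, rfl⟩)
      rw [affRefl_highest_mem_inversions hx g hθ, not_lt] at h1
      exact lt_of_le_of_ne h1 (by simpa using hreg θ 1)

theorem isLengthFn_length (b : R.Base) [R.IsRootSystem] [R.IsIrreducible] [Nonempty ι] :
    IsLengthFn (simples b) (affReflections R) (length b) := by
  obtain ⟨x, hx⟩ := alcove_nonempty (b := b)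
  have := (isInversionSystem_inversions hx).isLengthFn
  rwa [← funext (length_eq_ncard_inversions hx)] at this

/-- Otherwise `w⁻¹ x` would be negative on all simple coroots, yet greater than `1` on the highest
coroot, a sum of simple ones. -/
theorem exists_not_right_descent (b : R.Base) [R.IsRootSystem] [R.IsIrreducible] [Nonempty ι]
    (w : ExtAffineWeyl R) : ∃ s ∈ simples b, ¬ length b (w * s) < length b w := by
  by_contra! h
  obtain ⟨x, hx⟩ := alcove_nonempty (b := b)
  obtain ⟨θ, hθ⟩ := exists_isHighestCoroot b
  have hl := isLengthFn_length b
  have hN := isInversionSystem_inversions hx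
  have key : ∀ s ∈ simples b, s ∈ inversions x w⁻¹ := by
    intro s hs
    rw [hN.mem_iff_ncard_lt (hl.simple_subset hs), ← length_eq_ncard_inversions hx,
      ← length_eq_ncard_inversions hx, ← hl.length_mul_simple hs, hl.inv]
    exact h s hs
  have h1 := (affRefl_highest_mem_inversions hx w⁻¹ hθ).1 (key _ (Or.inr ⟨θ, hθ, rfl⟩))
  have h2 : ∀ i ∈ b.support, 0 < R.coroot' i (-affAct w⁻¹ x) := by
    intro i hi
    have := (affRefl_simple_mem_inversions hx w⁻¹ hi).1 (key _ (Or.inl ⟨i, hi, rfl⟩))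
    rw [map_neg]
    exact neg_pos.2 this
  have h3 := coroot'_pos_of_isPos h2 hθ.isPos
  rw [map_neg] at h3
  linarith

end Alcove

/-! ### Descent sets, and the Kazhdan–Lusztig elements as symmetric families. -/

section Descents

variable {ι V V' : Type*} [AddCommGroup V] [Module ℝ V] [AddCommGroup V'] [Module ℝ V']
  {R : RootPairing ι ℝ V V'} [R.IsCrystallographic] (b : R.Base)

theorem inr_ofIdx (i : ι) :
    (SemidirectProduct.inr (RootPairing.weylGroup.ofIdx R i) : ExtAffineWeyl R) = affRefl i 0 := by
  refine SemidirectProduct.ext ?_ rfl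
  rw [SemidirectProduct.left_inr, affRefl, zero_smul]
  rfl

theorem affRefl_zero_mem_finiteWeyl (i : ι) : affRefl i 0 ∈ finiteWeyl R :=
  ⟨_, inr_ofIdx i⟩

theorem affRefl_one_notMem_finiteWeyl (i : ι) : affRefl i 1 ∉ finiteWeyl R := by
  rintro ⟨w, hw⟩
  have h1 := congrArg (fun g : ExtAffineWeyl R => ((g.left.toAdd : weightLattice R) : V)) hw
  simp [affRefl] at h1
  exact R.ne_zero i h1.symm

theorem affRefl_zero_mem_finiteSimples {i : ι} (hi : i ∈ b.support) :
    affRefl i 0 ∈ finiteSimples b :=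
  ⟨Or.inl ⟨i, hi, rfl⟩, affRefl_zero_mem_finiteWeyl i⟩

theorem mem_simples_iff (s : ExtAffineWeyl R) :
    s ∈ simples b ↔ s ∈ finiteSimples b ∨ s ∈ affineSimple b := by
  constructor
  · rintro (⟨i, hi, rfl⟩ | h)
    · exact Or.inl (affRefl_zero_mem_finiteSimples b hi)
    · exact Or.inr h
  · rintro (h | h)
    · exact h.1
    · exact Or.inr h

theorem notMem_affineSimple_of_mem_finiteSimples {s : ExtAffineWeyl R} (hs : s ∈ finiteSimples b) :
    s ∉ affineSimple b := by
  rintro ⟨i, -, rfl⟩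
  exact affRefl_one_notMem_finiteWeyl i hs.2

theorem bruhatLE_eq : BruhatLE b = AbstractBruhatLE (affReflections R) (length b) := by
  have : (fun x z : ExtAffineWeyl R =>
      length b x < length b z ∧ ∃ (i : ι) (n : ℤ), z = x * affRefl i n) =
      fun x z => length b x < length b z ∧ ∃ t ∈ affReflections R, z = x * t := by
    ext x z
    refine and_congr_right fun _ => ⟨?_, ?_⟩
    · rintro ⟨i, n, h⟩
      exact ⟨_, ⟨i, n, rfl⟩, h⟩
    · rintro ⟨_, ⟨i, n, rfl⟩, h⟩
      exact ⟨i, n, h⟩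
  unfold BruhatLE AbstractBruhatLE
  rw [this]

theorem isKL_iff (w : ExtAffineWeyl R) (p : ExtAffineWeyl R →₀ ℤ[X]) :
    IsKL b w p ↔ IsAbstractKL (affReflections R) (length b) (T b genericParam) w p := by
  constructor
  · rintro ⟨h1, h2, h3, h4⟩
    rw [bruhatLE_eq] at h1 h3
    exact ⟨h1, h2, h3, h4⟩
  · rintro ⟨h1, h2, h3, h4⟩
    rw [← bruhatLE_eq] at h1 h3
    exact ⟨h1, h2, h3, h4⟩

variable [Finite ι] [R.IsReduced]

theorem finiteWeyl_eq_closure : finiteWeyl R = Subgroup.closure (finiteSimples b) := by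
  apply le_antisymm
  · rintro _ ⟨⟨w, hw⟩, rfl⟩
    induction hw using RootPairing.weylGroup.induction with
    | mem i =>
      change SemidirectProduct.inr (RootPairing.weylGroup.ofIdx R i) ∈ _
      rw [inr_ofIdx]
      refine b.induction_reflect i
        (p := fun i => affRefl i 0 ∈ Subgroup.closure (finiteSimples b)) (fun i hi => ?_)
        (fun i hi => Subgroup.subset_closure (affRefl_zero_mem_finiteSimples b hi))
        fun i j hi hj => ?_
      · have h := affRefl_indexNeg (R := R) i 0
        rw [neg_zero] at h
        exact h.symm ▸ hi
      · have h : affRefl (R := R) (R.reflectionPerm j i) 0 =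
            affRefl j 0 * affRefl i 0 * affRefl j 0 := by
          refine affAct_injective fun x => ?_
          have key : ∀ k y, affAct (affRefl (R := R) k 0) y = R.reflection k y := fun k y => by
            rw [affAct_affRefl, R.reflection_apply, Int.cast_zero, sub_zero]
          rw [affAct_mul, affAct_mul, key, key, key, key, R.reflection_reflectionPerm]
          rfl
        have hj' := Subgroup.subset_closure (affRefl_zero_mem_finiteSimples b hj)
        exact h ▸ mul_mem (mul_mem hj' hi) hj'
    | one => exact one_mem _
    | mul g h hg hh ihg ihh =>
      have := mul_mem ihg ihh
      rw [← map_mul] at this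
      exact this
  · rw [Subgroup.closure_le]
    exact fun s hs => hs.2

variable [R.IsRootSystem] [R.IsIrreducible] [Nonempty ι]

theorem mem_rightDescents_iff (w s : ExtAffineWeyl R) :
    s ∈ rightDescents b w ↔ s ∈ simples b ∧ length b (w * s) < length b w := by
  have h := isLengthFn_length b
  unfold rightDescents
  rw [bruhatLE_eq, Set.mem_ofPred_eq]
  refine and_congr_right fun hs => ⟨fun hle => ?_, fun hlt => ?_⟩
  · rcases hle.eq_or_length_lt with h1 | h1
    · have := h.mul_simple hs w
      rw [h1] at this
      omega
    · exact h1
  · exact Relation.ReflTransGen.single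
      ⟨hlt, s, h.simple_subset hs, (h.mul_simple_cancel hs w).symm⟩

theorem compl_Y₀_eq :
    (Y₀ b)ᶜ = {w | ∃ s ∈ finiteSimples b, length b (w * s) < length b w} := by
  ext w
  rw [Set.mem_compl_iff, Y₀, Set.mem_ofPred_eq, Set.mem_ofPred_eq, Set.not_subset]
  constructor
  · rintro ⟨s, hs, hs'⟩
    rw [mem_rightDescents_iff, mem_simples_iff] at hs
    exact ⟨s, hs.1.resolve_right hs', hs.2⟩
  · rintro ⟨s, hs, hlt⟩
    exact ⟨s, (mem_rightDescents_iff b w s).2 ⟨hs.1, hlt⟩,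
      notMem_affineSimple_of_mem_finiteSimples b hs⟩

theorem Γ₀_eq : Γ₀ b = {w | ∀ s ∈ finiteSimples b, length b (w * s) < length b w} := by
  ext w
  rw [Γ₀, Set.mem_ofPred_eq, Set.mem_ofPred_eq]
  constructor
  · intro h s hs
    rw [← h, mem_rightDescents_iff] at hs
    exact hs.2
  · intro h
    refine subset_antisymm (fun s hs => ?_) fun s hs => (mem_rightDescents_iff b w s).2 ⟨hs.1, h s hs⟩
    rw [mem_rightDescents_iff, mem_simples_iff] at hs
    refine hs.1.resolve_right fun ⟨θ, hθ, hsθ⟩ => ?_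
    -- The missing descent `t` is not finite, so it is `s₀`; uniqueness of the highest coroot
    -- identifies it with the descent `s`.
    obtain ⟨t, ht, hlt⟩ := exists_not_right_descent b w
    rcases (mem_simples_iff b t).1 ht with ht | ⟨θ', hθ', rfl⟩
    · exact hlt (h t ht)
    · rw [hθ'.unique hθ, ← hsθ] at hlt
      exact hlt hs.2

theorem isKL_klPoly_and_symm (w : ExtAffineWeyl R) :
    IsKL b w (klPoly b w) ∧ ∀ s ∈ simples b, length b (w * s) < length b w →
      ∀ y, klPoly b w (y * s) = klPoly b w y := by
  have h := isLengthFn_length b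
  have hτ := isHeckeBasis_T (genericParam : LaurentPolynomial ℤ) h
  obtain ⟨p, hp, hsymm⟩ := exists_isAbstractKL hτ h w
  have hex : ∃ p, IsKL b w p := ⟨p, (isKL_iff b w p).2 hp⟩
  have hkl : IsKL b w (klPoly b w) := by
    rw [klPoly, dif_pos hex]
    exact hex.choose_spec
  have : klPoly b w = p := IsAbstractKL.unique hτ h ((isKL_iff b w _).1 hkl) hp
  exact ⟨hkl, this ▸ hsymm⟩

theorem eq_or_lt_of_klPoly_ne_zero {w y : ExtAffineWeyl R} (hy : klPoly b w y ≠ 0) :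
    y = w ∨ length b y < length b w :=
  ((isKL_iff b w _).1 (isKL_klPoly_and_symm b w).1).le_of_ne_zero y hy |>.eq_or_length_lt

variable {k : Type*} [Field k]

theorem IsHeckeBasis.repr_sum {H W : Type*} [Group W] [Ring H] [Algebra k H] {S : Set W}
    {l : W → ℕ} {q : k} {τ : W → H} (hτ : IsHeckeBasis S l q τ) (p : W →₀ ℤ[X])
    (c : W → ℤ[X] → k) (hc : ∀ y, c y 0 = 0) (y : W) :
    hτ.basis.repr (p.sum fun y f => c y f • τ y) y = c y (p y) := by
  classical
  rw [Finsupp.sum, map_sum, Finsupp.finsetSum_apply]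
  simp only [map_smul, hτ.basis_repr, Finsupp.smul_apply, Finsupp.single_apply, smul_eq_mul,
    mul_ite, mul_one, mul_zero, Finset.sum_ite_eq', Finsupp.mem_support_iff]
  split_ifs with h
  · rfl
  · rw [not_not] at h
    rw [h, hc]

theorem repr_C (q v : k) (w y : ExtAffineWeyl R) :
    (isHeckeBasis_T q (isLengthFn_length b)).basis.repr (C b q v w) y =
      v⁻¹ ^ length b w * Polynomial.aeval q (klPoly b w y) := by
  rw [C, map_smul, Finsupp.smul_apply, smul_eq_mul,
    (isHeckeBasis_T q (isLengthFn_length b)).repr_sum _ (fun _ f => Polynomial.aeval q f)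
      (fun _ => map_zero _)]

theorem repr_C' (q v : k) (w y : ExtAffineWeyl R) :
    (isHeckeBasis_T q (isLengthFn_length b)).basis.repr (C' b q v w) y =
      v ^ length b w * ((-1) ^ (length b w - length b y) * q⁻¹ ^ length b y *
        Polynomial.aeval q⁻¹ (klPoly b w y)) := by
  rw [C', map_smul, Finsupp.smul_apply, smul_eq_mul,
    (isHeckeBasis_T q (isLengthFn_length b)).repr_sum _
      (fun y f => (-1) ^ (length b w - length b y) * q⁻¹ ^ length b y * Polynomial.aeval q⁻¹ f)
      (fun _ => by rw [map_zero, mul_zero])]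

theorem isSymmetricFamily_C {q v : k} (hv : v ≠ 0) :
    IsSymmetricFamily (isHeckeBasis_T q (isLengthFn_length b)) 1 (C b q v) where
  self_ne_zero w := by
    rw [repr_C, (isKL_klPoly_and_symm b w).1.self, map_one, mul_one]
    exact pow_ne_zero _ (inv_ne_zero hv)
  eq_or_lt w y hy := by
    rw [repr_C] at hy
    exact eq_or_lt_of_klPoly_ne_zero b fun h => hy (by rw [h, map_zero, mul_zero])
  mul_simple w s hs hw y _ := by
    rw [repr_C, repr_C, one_mul, (isKL_klPoly_and_symm b w).2 s hs hw y]

theorem isSymmetricFamily_C' {q v : k} (hq : q ≠ 0) (hv : v ≠ 0) :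
    IsSymmetricFamily (isHeckeBasis_T q (isLengthFn_length b)) (-q⁻¹) (C' b q v) where
  self_ne_zero w := by
    rw [repr_C', (isKL_klPoly_and_symm b w).1.self, map_one, mul_one, Nat.sub_self, pow_zero,
      one_mul]
    exact mul_ne_zero (pow_ne_zero _ hv) (pow_ne_zero _ (inv_ne_zero hq))
  eq_or_lt w y hy := by
    rw [repr_C'] at hy
    exact eq_or_lt_of_klPoly_ne_zero b fun h => hy (by rw [h, map_zero, mul_zero, mul_zero])
  mul_simple w s hs hw y hy := by
    have hsymm := (isKL_klPoly_and_symm b w).2 s hs hw y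
    rw [repr_C', repr_C', hsymm]
    -- The exponent `l w - l y` is truncated, so the sign is sure to alternate only while `l (y s) ≤
    -- l w`. This holds when the polynomial is nonzero.
    by_cases h0 : klPoly b w y = 0
    · simp [h0]
    · have h1 := (isLengthFn_length b).mul_simple_of_lt hs hy
      have h2 : length b (y * s) ≤ length b w := by
        rcases eq_or_lt_of_klPoly_ne_zero b (hsymm.trans_ne h0) with h | h
        · rw [h]
        · exact h.le
      obtain ⟨d, hd⟩ := Nat.exists_eq_add_of_le h2
      rw [show length b w - length b (y * s) = d by omega,
        show length b w - length b y = d + 1 by omega, h1, pow_succ, pow_succ]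
      ring

end Descents

end AffineHecke

end

/-! ### The two dualities for the extended affine Weyl group. -/

theorem lemma2p2
    {ι V V' k : Type*} [Finite ι] [AddCommGroup V] [Module ℝ V] [AddCommGroup V'] [Module ℝ V']
    (R : RootPairing ι ℝ V V') [R.IsRootSystem] [R.IsCrystallographic] [R.IsReduced]
    [R.IsIrreducible] (b : R.Base)
    [Field k] (q v : k) (hq : q ≠ 0) (hv : v ^ 2 = q)
    (w₀ : R.weylGroup)
    (hw₀ : ∀ u : R.weylGroup, AffineHecke.length b (SemidirectProduct.inr u) ≤
      AffineHecke.length b (SemidirectProduct.inr w₀)) :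
    ∃ I I' M M' : Submodule (AffineHecke.Hecke b q) (AffineHecke.Hecke b q),
      I.restrictScalars k =
        Submodule.span k (AffineHecke.C b q v '' (AffineHecke.Y₀ b)ᶜ) ∧
      I'.restrictScalars k =
        Submodule.span k (AffineHecke.C' b q v '' (AffineHecke.Y₀ b)ᶜ) ∧
      M.restrictScalars k =
        Submodule.span k (AffineHecke.C b q v '' AffineHecke.Γ₀ b) ∧
      M'.restrictScalars k =
        Submodule.span k (AffineHecke.C' b q v '' AffineHecke.Γ₀ b) ∧
      M = Submodule.span (AffineHecke.Hecke b q)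
        {AffineHecke.C b q v (SemidirectProduct.inr w₀)} ∧
      M' = Submodule.span (AffineHecke.Hecke b q)
        {AffineHecke.C' b q v (SemidirectProduct.inr w₀)} ∧
      (∃ e : (AffineHecke.Hecke b q ⧸ I) ≃ₗ[AffineHecke.Hecke b q] M',
        ∀ h : AffineHecke.Hecke b q,
          (e (Submodule.Quotient.mk h) : AffineHecke.Hecke b q) =
            h * AffineHecke.C' b q v (SemidirectProduct.inr w₀)) ∧
      (∃ e : (AffineHecke.Hecke b q ⧸ I') ≃ₗ[AffineHecke.Hecke b q] M,
        ∀ h : AffineHecke.Hecke b q,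
          (e (Submodule.Quotient.mk h) : AffineHecke.Hecke b q) =
            h * AffineHecke.C b q v (SemidirectProduct.inr w₀)) := by
  open AffineHecke in
  -- The highest coroot, hence `s₀`, needs a root; without roots the space would be zero, which
  -- irreducibility excludes.
  have : Nonempty ι := by
    by_contra! h
    have := RootPairing.IsIrreducible.nontrivial R
    have hspan := RootPairing.IsRootSystem.span_root_eq_top (P := R)
    rw [Set.range_eq_empty, Submodule.span_empty] at hspan
    exact bot_ne_top hspan
  have hv0 : v ≠ 0 := by
    rintro rfl
    exact hq (by rw [← hv, zero_pow two_ne_zero])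
  have hlen := isLengthFn_length b
  have hC := isSymmetricFamily_C b (q := q) hv0
  have hC' := isSymmetricFamily_C' b hq hv0
  have hw₀mem : (SemidirectProduct.inr w₀ : ExtAffineWeyl R) ∈
      Subgroup.closure (finiteSimples b) := by
    rw [← finiteWeyl_eq_closure]
    exact ⟨w₀, rfl⟩
  have hmax : ∀ u ∈ Subgroup.closure (finiteSimples b),
      length b u ≤ length b (SemidirectProduct.inr w₀) := by
    rw [← finiteWeyl_eq_closure]
    rintro _ ⟨u, rfl⟩
    exact hw₀ u
  have hr : (q * 1 + 1) * ((1 : k) - 1) = 0 := by ring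
  have hr' : (q * -q⁻¹ + 1) * (-q⁻¹ - 1) = 0 := by
    rw [mul_neg, mul_inv_cancel₀ hq, neg_add_cancel, zero_mul]
  -- The ratios `1` and `-q⁻¹` give `I` and `M'`; exchanging the two families gives `I'` and `M`.
  obtain ⟨I, M', hI, hM', hM'', he⟩ := exists_ideals (isHeckeBasis_T q hlen) hlen hC hC' hq hr hr'
    (by rw [mul_one, mul_neg, mul_inv_cancel₀ hq]) (fun s hs => hs.1) hw₀mem hmax
  obtain ⟨I', M, hI', hM, hMM, he'⟩ := exists_ideals (isHeckeBasis_T q hlen) hlen hC' hC hq hr' hr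
    (by rw [mul_one, mul_neg, mul_inv_cancel₀ hq]) (fun s hs => hs.1) hw₀mem hmax
  rw [compl_Y₀_eq, Γ₀_eq]
  exact ⟨I, I', M, M', hI, hI', hM, hM', hMM, hM'', he, he'⟩
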